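/- **Setting.** Let $n\ge 1$ and equip $\mathbb R^n$ with the supremum norm $|x|=\max_i|x_i|$; $Q(x,t)$ denotes the closed cube with centre $x$, sidelength $t$ and sides parallel to the axes. Let $\Omega\subsetneq\mathbb R^n$ be a strongly Lipschitz domain: a non-empty proper open connected set whose boundary is covered by finitely many open sets, in each of which $\Omega$ coincides with the region above a rotated graph of a Lipschitz function, at most one of the resulting boundary parts being unbounded. Put $\operatorname{diam}(\Omega)=\sup\{|x-y|:x,y\in\Omega\}\in(0,\infty]$ and $d_\Omega=2\operatorname{diam}(\Omega)$. Let $A:\mathbb R^n\to M_n(\mathbb C)$ be measurable and elliptic: for some $\delta\in(0,1]$, $|A(x)\xi\cdot\overline\eta|\le\delta^{-1}|\xi||\eta|$ for almost every $x$ and all $\xi,\eta\in\mathbb C^n$, and $\Re(A(x)\xi\cdot\overline\xi)\ge\delta|\xi|^2$ for all $x$ and $\xi$. Let $L=-\mathrm{div}(A\nabla)$ be the operator on $L^2(\Omega)$ (complex-valued functions) with the Dirichlet boundary condition: with $V=W^{1,2}_0(\Omega)$, the closure of $C_c^\infty(\Omega)$ in $W^{1,2}(\Omega)$, one has $u\in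 D(L)$ and $Lu=w\in L^2(\Omega)$ if and only if $u\in V$ and $\int_\Omega A\nabla u\cdot\overline{\nabla g}\,dx=\int_\Omega w\,\overline g\,dx$ for all $g\in V$. Let $\{e^{-tL}\}_{t\ge0}$ be the semigroup on $L^2(\Omega)$ with generator $-L$. Assume that it has the Gaussian property $(G_{\operatorname{diam}(\Omega)})$ with exponent $\mu\in(0,1]$: for every $t\in(0,\operatorname{diam}(\Omega))$ the operator $e^{-tL}$ has a measurable kernel $K_t$ on $\Omega\times\Omega$, and there are constants $C,\alpha>0$ such that for all such $t$ and all $x,y,y_1,y_2\in\Omega$, $$|K_t(x,y)|\le \frac{C}{t^{n/2}}e^{-\alpha|x-y|^2/t},\qquad |K_t(x,y_1)-K_t(x,y_2)|+|K_t(y_1,x)-K_t(y_2,x)|\le\frac{C}{t^{n/2}}\,\frac{|y_1-y_2|^\mu}{t^{\mu/2}}.$$ (In particular, for $f\in L^2(\Omega)$ and $t>0$, $e^{-tL}f$ has a continuous representative on $\Omega$, which is used below.) Let $\Phi:(0,\infty)\to(0,\infty)$ be continuous, strictly increasing, subadditive and of upper type $1$ (there is $C>0$ with $\Phi(st)\le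 Ct\,\Phi(s)$ for all $t\ge1$, $s>0$), and suppose that $$p_\Phi:=\sup\{p>0:\ \Phi(st)\le t^p\Phi(s)\ \text{for all } t\in(0,1),\ s>0\}\in\Bigl(\frac n{n+\mu},1\Bigr].$$ Extend $\Phi$ by $\Phi(0)=0$, $\Phi(\infty)=\infty$. A measurable function $g:\Omega\to[0,\infty]$ belongs to $L^\Phi(\Omega)$ if $\int_\Omega\Phi(g)\,dx<\infty$, and $\|g\|_{L^\Phi(\Omega)}:=\inf\{\lambda>0:\int_\Omega\Phi(g/\lambda)\,dx\le1\}$. For $f\in L^2(\Omega)$ and $x\in\Omega$ let $$\mathcal N_h(f)(x)=\sup_{y\in\Omega,\ t\in(0,d_\Omega),\ |y-x|<t}|e^{-t^2L}f(y)|,\qquad \widetilde S_h(f)(x)=\Bigl\{\int_{\Gamma(x)}|t\nabla e^{-t^2L}f(y)|^2\frac{dy\,dt}{t\,|Q(x,t)\cap\Omega|}\Bigr\}^{1/2},$$ where $\Gamma(x)=\{(y,t)\in\Omega\times(0,d_\Omega):|y-x|<t\}$. Write $f\in H_{\Phi,\mathcal N_h}(\Omega)\cap L^2(\Omega)$ if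 $f\in L^2(\Omega)$ and $\mathcal N_h(f)\in L^\Phi(\Omega)$, and put $\|f\|_{H_{\Phi,\mathcal N_h}(\Omega)}=\|\mathcal N_h(f)\|_{L^\Phi(\Omega)}$. **Proposition 3.2.** There exists a constant $C\in(0,\infty)$, independent of $f$, such that for all $f\in H_{\Phi,\mathcal N_h}(\Omega)\cap L^2(\Omega)$ one has $\widetilde S_h(f)\in L^\Phi(\Omega)$ and $$\bigl\|\widetilde S_h(f)\bigr\|_{L^\Phi(\Omega)}\le C\,\|f\|_{H_{\Phi,\mathcal N_h}(\Omega)}.$$ -/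

import Mathlib

open MeasureTheory Filter Set
open scoped ENNReal NNReal Topology ContDiff Matrix

noncomputable section

namespace OrliczHardy

/-! ### The domain

`ℝⁿ` is `Fin n → ℝ`; its norm in Mathlib is the supremum norm, so `Metric.ball x t` and
`Metric.closedBall x (t / 2)` are cubes with sides parallel to the axes, and `Metric.ediam` is the
diameter for the supremum norm. -/

/-- The open epigraph `{x : (O x)_k > φ((O x)_j, j ≠ k)}` of a function `φ` of `n - 1` variables,
in the coordinates rotated by the matrix `O`, the `k`-th one being the vertical one. -/
def rotatedEpigraph {n : ℕ} (O : Matrix (Fin n) (Fin n) ℝ) (k : Fin n)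
    (φ : ({j : Fin n // j ≠ k} → ℝ) → ℝ) : Set (Fin n → ℝ) :=
  {x | φ (fun j => (O *ᵥ x) j) < (O *ᵥ x) k}

/-- Strongly Lipschitz domain: a proper open connected subset of `ℝⁿ` whose boundary is covered by
finitely many open sets `U i`, in each of which the domain is the part lying above a rotated
graph of a Lipschitz function; at most one of the boundary parts is unbounded. -/
structure IsStronglyLipschitzDomain {n : ℕ} (Ω : Set (Fin n → ℝ)) : Prop where
  isOpen : IsOpen Ω
  isConnected : IsConnected Ω
  ne_univ : Ω ≠ univ
  boundary : ∃ (m : ℕ) (U : Fin m → Set (Fin n → ℝ)),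
    (∀ i, IsOpen (U i)) ∧ frontier Ω ⊆ ⋃ i, U i ∧
    (∀ i, ∃ O ∈ Matrix.orthogonalGroup (Fin n) ℝ, ∃ (k : Fin n)
      (φ : ({j : Fin n // j ≠ k} → ℝ) → ℝ) (K : ℝ≥0),
      LipschitzWith K φ ∧ Ω ∩ U i = rotatedEpigraph O k φ ∩ U i) ∧
    (∀ i j, ¬ Bornology.IsBounded (frontier Ω ∩ U i) →
      ¬ Bornology.IsBounded (frontier Ω ∩ U j) → i = j)

/-- `d_Ω = 2 diam Ω`, an element of `[0, ∞]`. -/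
def dOmega {n : ℕ} (Ω : Set (Fin n → ℝ)) : ℝ≥0∞ := 2 * Metric.ediam Ω

/-! ### Sobolev spaces -/

/-- `L²(Ω)`, complex valued. -/
abbrev L2 {n : ℕ} (Ω : Set (Fin n → ℝ)) : Type :=
  Lp ℂ 2 (volume.restrict Ω)

/-- `L²(Ω; ℂⁿ)`, with the Euclidean norm on `ℂⁿ`. -/
abbrev L2Vec {n : ℕ} (Ω : Set (Fin n → ℝ)) : Type :=
  Lp (EuclideanSpace ℂ (Fin n)) 2 (volume.restrict Ω)

/-- `φ ∈ C_c^∞(Ω)`, complex valued. -/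
structure IsTestFunction {n : ℕ} (Ω : Set (Fin n → ℝ)) (φ : (Fin n → ℝ) → ℂ) : Prop where
  contDiff : ContDiff ℝ ∞ φ
  hasCompactSupport : HasCompactSupport φ
  tsupport_subset : tsupport φ ⊆ Ω

/-- The classical gradient of a function. -/
def classicalGrad {n : ℕ} (φ : (Fin n → ℝ) → ℂ) (x : Fin n → ℝ) : EuclideanSpace ℂ (Fin n) :=
  WithLp.toLp 2 (fun i => fderiv ℝ φ x (Pi.single i 1))

/-- `G` is the distributional gradient of `u` on `Ω`. -/
def IsWeakGradient {n : ℕ} {Ω : Set (Fin n → ℝ)} (u : L2 Ω) (G : L2Vec Ω) : Prop :=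
  ∀ φ : (Fin n → ℝ) → ℂ, IsTestFunction Ω φ → ∀ i : Fin n,
    ∫ x in Ω, u x * classicalGrad φ x i = - ∫ x in Ω, G x i * φ x

/-- `W^{1,2}(Ω)` as a subset of `L²(Ω)`. -/
def sobolevW {n : ℕ} (Ω : Set (Fin n → ℝ)) : Set (L2 Ω) :=
  {u | ∃ G : L2Vec Ω, IsWeakGradient u G}

open Classical in
/-- The distributional gradient `∇u` of `u ∈ W^{1,2}(Ω)` (zero if `u ∉ W^{1,2}(Ω)`). -/
def weakGrad {n : ℕ} {Ω : Set (Fin n → ℝ)} (u : L2 Ω) : L2Vec Ω :=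
  if h : ∃ G : L2Vec Ω, IsWeakGradient u G then h.choose else 0

/-- `W_0^{1,2}(Ω)`: the closure of `C_c^∞(Ω)` in `W^{1,2}(Ω)`. -/
def sobolevW0 {n : ℕ} (Ω : Set (Fin n → ℝ)) : Set (L2 Ω) :=
  {u | u ∈ sobolevW Ω ∧ ∀ ε : ℝ≥0∞, 0 < ε → ∃ φ : (Fin n → ℝ) → ℂ, IsTestFunction Ω φ ∧
    eLpNorm (fun x => u x - φ x) 2 (volume.restrict Ω) +
      eLpNorm (fun x => weakGrad u x - classicalGrad φ x) 2 (volume.restrict Ω) < ε}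

/-! ### The operator and its semigroup -/

/-- The ellipticity class `𝒜(δ)`. -/
structure IsElliptic {n : ℕ} (δ : ℝ) (A : (Fin n → ℝ) → Matrix (Fin n) (Fin n) ℂ) : Prop where
  measurable : ∀ i j, Measurable fun x => A x i j
  bounded : ∀ᵐ x, ∀ ξ η : EuclideanSpace ℂ (Fin n), ‖ξ‖ = 1 → ‖η‖ = 1 →
    ‖(A x *ᵥ ξ.ofLp) ⬝ᵥ star η.ofLp‖ ≤ δ⁻¹
  coercive : ∀ x, ∀ ξ : EuclideanSpace ℂ (Fin n),
    δ * ‖ξ‖ ^ 2 ≤ ((A x *ᵥ ξ.ofLp) ⬝ᵥ star ξ.ofLp).re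

/-- The graph of the operator `L = -div(A∇)` with form domain `V`, largest possible domain: `u`
is in `D(L)` and `Lu = w` if and only if `u ∈ V` and
`∫_Ω A∇u · conj(∇g) = ⟨w, g⟩` for all `g ∈ V`. -/
def IsDivFormOperator {n : ℕ} {Ω : Set (Fin n → ℝ)} (A : (Fin n → ℝ) → Matrix (Fin n) (Fin n) ℂ)
    (V : Set (L2 Ω)) (u w : L2 Ω) : Prop :=
  u ∈ V ∧ ∀ g ∈ V,
    ∫ x in Ω, (A x *ᵥ (weakGrad u x).ofLp) ⬝ᵥ star (weakGrad g x).ofLp =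
      ∫ x in Ω, w x * star (g x)

/-- `T` (of which only the times `t ≥ 0` matter) is the strongly continuous semigroup of bounded
operators whose generator is `-L`, the operator `L` being given by its graph. -/
structure IsSemigroupGeneratedByNeg {X : Type*} [NormedAddCommGroup X] [NormedSpace ℂ X]
    (L : X → X → Prop) (T : ℝ → X →L[ℂ] X) : Prop where
  zero : T 0 = ContinuousLinearMap.id ℂ X
  add : ∀ s t : ℝ, 0 ≤ s → 0 ≤ t → T (s + t) = (T s).comp (T t)
  continuous : ∀ f : X, ContinuousOn (fun t : ℝ => T t f) (Ici 0)
  generator : ∀ u w : X, L u w ↔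
    Tendsto (fun t : ℝ => ((t⁻¹ : ℝ) : ℂ) • (T t u - u)) (𝓝[>] 0) (𝓝 (-w))

open Classical in
/-- The semigroup `e^{-tL}`, `t ≥ 0`, on `L²(Ω)`, where `L = -div(A∇)` satisfies the Dirichlet
boundary condition, that is, has form domain `W_0^{1,2}(Ω)`. For elliptic `A` this semigroup
exists and its values at `t ≥ 0` are unique. -/
def heatSemigroup {n : ℕ} (Ω : Set (Fin n → ℝ)) (A : (Fin n → ℝ) → Matrix (Fin n) (Fin n) ℂ) :
    ℝ → L2 Ω →L[ℂ] L2 Ω :=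
  if h : ∃ T : ℝ → L2 Ω →L[ℂ] L2 Ω,
      IsSemigroupGeneratedByNeg (IsDivFormOperator A (sobolevW0 Ω)) T
  then h.choose else 0

/-- The Gaussian property `(G_β)`, with Hölder exponent `μ`, of a family `T t = e^{-tL}` of
operators on `L²(Ω)`: for `t ∈ (0, β)` the operator `T t` has a kernel `K t` with Gaussian bounds
which is Hölder continuous in each variable. -/
def HasGaussianProperty {n : ℕ} {Ω : Set (Fin n → ℝ)} (T : ℝ → L2 Ω →L[ℂ] L2 Ω)
    (β : ℝ≥0∞) (μ : ℝ) : Prop :=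
  ∃ K : ℝ → (Fin n → ℝ) → (Fin n → ℝ) → ℂ,
    (∀ t : ℝ, 0 < t → ENNReal.ofReal t < β →
      Measurable (fun p : Ω × Ω => K t p.1 p.2) ∧
      ∀ f : L2 Ω, ∀ᵐ x ∂(volume.restrict Ω), T t f x = ∫ y in Ω, K t x y * f y) ∧
    (∃ C > 0, ∃ α > 0, ∀ t : ℝ, 0 < t → ENNReal.ofReal t < β → ∀ x ∈ Ω, ∀ y ∈ Ω,
      ‖K t x y‖ ≤ C / t ^ ((n : ℝ) / 2) * Real.exp (-α * ‖x - y‖ ^ 2 / t)) ∧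
    (∃ C > 0, ∀ t : ℝ, 0 < t → ENNReal.ofReal t < β → ∀ x ∈ Ω, ∀ y₁ ∈ Ω, ∀ y₂ ∈ Ω,
      ‖K t x y₁ - K t x y₂‖ + ‖K t y₁ x - K t y₂ x‖ ≤
        C / t ^ ((n : ℝ) / 2) * (‖y₁ - y₂‖ ^ μ / t ^ (μ / 2)))

/-! ### Orlicz functions and Orlicz norms -/

/-- The strictly critical lower type index
`p_Φ = sup {p > 0 : Φ(st) ≤ t^p Φ(s) for all t ∈ (0,1), s > 0}`. -/
def criticalLowerType (Φ : ℝ → ℝ) : ℝ :=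
  sSup {p : ℝ | 0 < p ∧ ∀ t s : ℝ, 0 < t → t < 1 → 0 < s → Φ (s * t) ≤ t ^ p * Φ s}

/-- The standing assumptions on `Φ : (0, ∞) → (0, ∞)` (only the values on `(0, ∞)` matter). -/
structure AssumptionA (n : ℕ) (μ : ℝ) (Φ : ℝ → ℝ) : Prop where
  pos : ∀ s, 0 < s → 0 < Φ s
  upperType : ∃ C > 0, ∀ t s : ℝ, 1 ≤ t → 0 < s → Φ (s * t) ≤ C * t * Φ s
  lt_criticalLowerType : (n : ℝ) / (n + μ) < criticalLowerType Φ
  criticalLowerType_le : criticalLowerType Φ ≤ 1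
  continuousOn : ContinuousOn Φ (Ioi 0)
  strictMonoOn : StrictMonoOn Φ (Ioi 0)
  subadditive : ∀ s t : ℝ, 0 < s → 0 < t → Φ (s + t) ≤ Φ s + Φ t

open Classical in
/-- The extension of `Φ` to `[0, ∞]` by `Φ(0) = 0` and `Φ(∞) = ∞`, its limits at the endpoints. -/
def extendPhi (Φ : ℝ → ℝ) (a : ℝ≥0∞) : ℝ≥0∞ :=
  if a = 0 then 0 else if a = ⊤ then ⊤ else ENNReal.ofReal (Φ a.toReal)

/-- A nonnegative function `g` belongs to `L^Φ(Ω)`. -/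
def MemOrlicz {n : ℕ} (Φ : ℝ → ℝ) (Ω : Set (Fin n → ℝ)) (g : (Fin n → ℝ) → ℝ≥0∞) : Prop :=
  AEMeasurable g (volume.restrict Ω) ∧ ∫⁻ x in Ω, extendPhi Φ (g x) < ⊤

/-- `‖g‖_{L^Φ(Ω)} = inf {λ > 0 : ∫_Ω Φ(g/λ) ≤ 1}` for a nonnegative function `g`. -/
def orliczNorm {n : ℕ} (Φ : ℝ → ℝ) (Ω : Set (Fin n → ℝ)) (g : (Fin n → ℝ) → ℝ≥0∞) : ℝ≥0∞ :=
  ⨅ (l : ℝ) (_ : 0 < l ∧ ∫⁻ x in Ω, extendPhi Φ (g x / ENNReal.ofReal l) ≤ 1), ENNReal.ofReal l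

/-! ### The nontangential maximal function and the area function -/

open Classical in
/-- The continuous representative on `Ω` of a class `u` (unique on `Ω` when it exists; it exists
for `u = e^{-tL} f`, `t > 0`, under the Gaussian property). It gives `e^{-tL} f (y)` its meaning
at every point `y ∈ Ω`. -/
def contRep {n : ℕ} {Ω : Set (Fin n → ℝ)} (u : L2 Ω) : (Fin n → ℝ) → ℂ :=
  if h : ∃ g : (Fin n → ℝ) → ℂ, ContinuousOn g Ω ∧ u =ᵐ[volume.restrict Ω] g
  then h.choose else u

/-- `𝒩_h f (x) = sup {|e^{-t²L} f (y)| : y ∈ Ω, t ∈ (0, 2 diam Ω), |y - x| < t}`. -/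
def maximalFn {n : ℕ} {Ω : Set (Fin n → ℝ)} (A : (Fin n → ℝ) → Matrix (Fin n) (Fin n) ℂ)
    (f : L2 Ω) (x : Fin n → ℝ) : ℝ≥0∞ :=
  ⨆ (y : Fin n → ℝ) (t : ℝ) (_ : y ∈ Ω ∧ 0 < t ∧ ENNReal.ofReal t < dOmega Ω ∧ ‖y - x‖ < t),
    ‖contRep (heatSemigroup Ω A (t ^ 2) f) y‖ₑ

/-- `S̃_h f (x) = (∫_{Γ(x)} |t ∇e^{-t²L} f (y)|² dy dt / (t |Q(x,t) ∩ Ω|))^{1/2}`, where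
`Γ(x) = {(y,t) : y ∈ Ω, 0 < t < 2 diam Ω, |y - x| < t}` and `Q(x,t)` is the closed cube with centre
`x` and sidelength `t`. The integral over the cone is written as an iterated one. -/
def areaFn {n : ℕ} {Ω : Set (Fin n → ℝ)} (A : (Fin n → ℝ) → Matrix (Fin n) (Fin n) ℂ)
    (f : L2 Ω) (x : Fin n → ℝ) : ℝ≥0∞ :=
  (∫⁻ t in {t : ℝ | 0 < t ∧ ENNReal.ofReal t < dOmega Ω},
    ∫⁻ y in Ω ∩ Metric.ball x t,
      ‖t • weakGrad (heatSemigroup Ω A (t ^ 2) f) y‖ₑ ^ 2 /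
        (ENNReal.ofReal t * volume (Metric.closedBall x (t / 2) ∩ Ω))) ^ (1 / 2 : ℝ)

/-- `f ∈ H_{Φ,𝒩_h}(Ω) ∩ L²(Ω)`, that is, `f ∈ L²(Ω)` and `𝒩_h f ∈ L^Φ(Ω)`. -/
def MemHardy {n : ℕ} {Ω : Set (Fin n → ℝ)} (Φ : ℝ → ℝ)
    (A : (Fin n → ℝ) → Matrix (Fin n) (Fin n) ℂ) (f : L2 Ω) : Prop :=
  MemOrlicz Φ Ω (maximalFn A f)

/-- `‖f‖_{H_{Φ,𝒩_h}(Ω)} = ‖𝒩_h f‖_{L^Φ(Ω)}`. -/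
def hardyNorm {n : ℕ} {Ω : Set (Fin n → ℝ)} (Φ : ℝ → ℝ)
    (A : (Fin n → ℝ) → Matrix (Fin n) (Fin n) ℂ) (f : L2 Ω) : ℝ≥0∞ :=
  orliczNorm Φ Ω (maximalFn A f)

end OrliczHardy

end

/-!
The proof is a good-`λ` argument. Let `N = 𝒩_h f` and `S = S̃_h f`, and fix `Λ`. Off a set of
measure at most a multiple of `|{N > Λ}|` (Vitali's covering lemma and the measure density of `Ω`)
even the cones of aperture `4` avoid the points where `|e^{-t²L} f| > Λ`, so `|e^{-t²L} f| ≤ Λ` on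
the sawtooth region over the remaining good points. Differentiating `‖χ_t e^{-t²L} f‖²` for a
Lipschitz cut-off `χ_t` of that region and using ellipticity bounds the energy
`∫∫ |t ∇e^{-t²L} f|² dy dt / t` there by `Λ² |{N > Λ}| + ∫_{N ≤ Λ} N²`. By Fubini's theorem and
Chebyshev's inequality this bounds `|{S > Λ}|`. Summing over `Λ = 2^k` against `Φ(2^{k+1})` gives
the modular inequality: the series converge as `k → -∞` because `Φ` has positive lower type, and
as `k → ∞` because its upper type is less than `2`.
-/

noncomputable section

namespace OrliczHardy

section GraphCone

variable {E F : Type*} [NormedAddCommGroup E] [NormedSpace ℝ E] [NormedAddCommGroup F]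
  [NormedSpace ℝ F] {h : E →L[ℝ] F} {l : E →L[ℝ] ℝ} {K : ℝ≥0} {φ : F → ℝ} {x v : E} {t : ℝ}

/-- The open cone of directions which leave the graph `{x | φ (h x) = l x}` of any `K`-Lipschitz
function `φ` strictly upwards; `h` and `l` are the horizontal and the vertical coordinate. -/
def graphCone (h : E →L[ℝ] F) (l : E →L[ℝ] ℝ) (K : ℝ≥0) : Set E :=
  {v | K * ‖h v‖ < l v}

lemma isOpen_graphCone : IsOpen (graphCone h l K) :=
  isOpen_lt (by fun_prop) (by fun_prop)

lemma smul_mem_graphCone (hv : v ∈ graphCone h l K) {a : ℝ} (ha : 0 < a) :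
    a • v ∈ graphCone h l K := by
  have : a * (K * ‖h v‖) < a * l v := mul_lt_mul_of_pos_left hv ha
  simpa [graphCone, norm_smul, abs_of_pos ha, mul_left_comm] using this

lemma convex_graphCone : Convex ℝ (graphCone h l K) := by
  refine convex_iff_forall_pos.2 fun v hv w hw a b ha hb _ => ?_
  have hv' : K * ‖h (a • v)‖ < l (a • v) := smul_mem_graphCone hv ha
  have hw' : K * ‖h (b • w)‖ < l (b • w) := smul_mem_graphCone hw hb
  calc (K : ℝ) * ‖h (a • v + b • w)‖ ≤ K * (‖h (a • v)‖ + ‖h (b • w)‖) := by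
        rw [map_add]; gcongr; exact norm_add_le _ _
    _ < l (a • v) + l (b • w) := by rw [mul_add]; exact add_lt_add hv' hw'
    _ = l (a • v + b • w) := (map_add l _ _).symm

lemma graphCone_inter_nonempty_of_mem_nhds_zero (hne : (graphCone h l K).Nonempty) {s : Set E}
    (hs : s ∈ 𝓝 0) : (graphCone h l K ∩ s).Nonempty := by
  obtain ⟨v, hv⟩ := hne
  have hlim : Tendsto (fun a : ℝ => a • v) (𝓝[>] 0) (𝓝 0) := by
    have : Continuous fun a : ℝ => a • v := by fun_prop
    simpa using (this.tendsto 0).mono_left nhdsWithin_le_nhds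
  obtain ⟨a, has, ha⟩ := ((hlim.eventually hs).and self_mem_nhdsWithin).exists
  exact ⟨a • v, smul_mem_graphCone hv ha, has⟩

lemma graph_lt_add_of_mem_graphCone (hφ : LipschitzWith K φ) (hx : φ (h x) ≤ l x)
    (hv : v ∈ graphCone h l K) : φ (h (x + v)) < l (x + v) := by
  have hv' : K * ‖h v‖ < l v := hv
  have hdist := (le_abs_self _).trans (hφ.dist_le_mul (h (x + v)) (h x))
  rw [dist_eq_norm, ← map_sub, add_sub_cancel_left] at hdist
  rw [map_add l]
  linarith

lemma sub_lt_graph_of_mem_graphCone (hφ : LipschitzWith K φ) (hx : l x ≤ φ (h x))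
    (hv : v ∈ graphCone h l K) : l (x - v) < φ (h (x - v)) := by
  have hv' : K * ‖h v‖ < l v := hv
  have hdist := (le_abs_self _).trans (hφ.dist_le_mul (h x) (h (x - v)))
  rw [dist_eq_norm, ← map_sub, sub_sub_cancel] at hdist
  rw [map_sub l]
  linarith

lemma exists_abs_eq_and_add_smul_graph_ne (hφ : LipschitzWith K φ) (x : E) (ht : 0 < t) :
    ∃ r : ℝ, |r| = t ∧ ∀ v ∈ graphCone h l K, φ (h (x + r • v)) ≠ l (x + r • v) := by
  rcases le_total (φ (h x)) (l x) with hx | hx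
  · exact ⟨t, abs_of_pos ht, fun v hv =>
      (graph_lt_add_of_mem_graphCone hφ hx (smul_mem_graphCone hv ht)).ne⟩
  · refine ⟨-t, by rw [abs_neg, abs_of_pos ht], fun v hv => ?_⟩
    rw [neg_smul, ← sub_eq_add_neg]
    exact (sub_lt_graph_of_mem_graphCone hφ hx (smul_mem_graphCone hv ht)).ne'

lemma subset_of_isPreconnected_of_disjoint_frontier {X : Type*}
    [TopologicalSpace X] {s Ω : Set X} (hs : IsPreconnected s) (hΩ : IsOpen Ω)
    (hne : (s ∩ Ω).Nonempty) (hd : Disjoint s (frontier Ω)) : s ⊆ Ω := by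
  refine hs.subset_of_closure_inter_subset hΩ hne fun z hz => ?_
  by_contra hzΩ
  exact hd.le_bot ⟨hz.2, hΩ.frontier_eq ▸ ⟨hz.1, hzΩ⟩⟩

lemma image_graphCone_inter_ball_subset {Ω : Set E} (hΩ : IsOpen Ω)
    (hne : (graphCone h l K).Nonempty) (hx : x ∈ Ω) {r : ℝ}
    (hd : Disjoint ((fun v => x + r • v) '' (graphCone h l K ∩ Metric.ball 0 1)) (frontier Ω)) :
    (fun v => x + r • v) '' (graphCone h l K ∩ Metric.ball 0 1) ⊆ Ω := by
  have hcont : Continuous fun v : E => x + r • v := by fun_prop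
  refine subset_of_isPreconnected_of_disjoint_frontier ?_ hΩ ?_ hd
  · exact (convex_graphCone.inter (convex_ball 0 1)).isPreconnected.image _ hcont.continuousOn
  · have hnhds : Metric.ball 0 1 ∩ (fun v : E => x + r • v) ⁻¹' Ω ∈ 𝓝 (0 : E) :=
      inter_mem (Metric.ball_mem_nhds 0 one_pos)
        (hcont.continuousAt.preimage_mem_nhds (hΩ.mem_nhds (by simpa using hx)))
    obtain ⟨v, hv, hv1, hvΩ⟩ := graphCone_inter_nonempty_of_mem_nhds_zero hne hnhds
    exact ⟨_, ⟨v, ⟨hv, hv1⟩, rfl⟩, hvΩ⟩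

lemma measure_graphCone_inter_ball_pos [MeasurableSpace E] {ν : Measure E} [ν.IsOpenPosMeasure]
    (hne : (graphCone h l K).Nonempty) :
    0 < ν (graphCone h l K ∩ Metric.ball 0 1) :=
  (isOpen_graphCone.inter Metric.isOpen_ball).measure_pos _
    (graphCone_inter_nonempty_of_mem_nhds_zero hne (Metric.ball_mem_nhds 0 one_pos))

open scoped Pointwise in
lemma measure_graphCone_mul_le [FiniteDimensional ℝ E] [MeasurableSpace E] [BorelSpace E]
    {ν : Measure E} [ν.IsAddHaarMeasure] {Ω : Set E} (hΩ : IsOpen Ω)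
    (hne : (graphCone h l K).Nonempty)
    (hφ : LipschitzWith K φ) (hx : x ∈ Ω) (ht : 0 < t)
    (hfr : frontier Ω ∩ Metric.ball x t ⊆ {y | φ (h y) = l y}) :
    ν (graphCone h l K ∩ Metric.ball 0 1) * ENNReal.ofReal t ^ Module.finrank ℝ E ≤
      ν (Metric.ball x t ∩ Ω) := by
  obtain ⟨r, hr, hgraph⟩ := exists_abs_eq_and_add_smul_graph_ne (h := h) (l := l) hφ x ht
  set S := graphCone h l K ∩ Metric.ball (0 : E) 1
  have hball : (fun v => x + r • v) '' S ⊆ Metric.ball x t := by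
    rintro _ ⟨v, ⟨-, hv⟩, rfl⟩
    rw [mem_ball_zero_iff] at hv
    rw [mem_ball_iff_norm, add_sub_cancel_left, norm_smul, Real.norm_eq_abs, hr]
    exact mul_lt_of_lt_one_right ht hv
  have hsub : (fun v => x + r • v) '' S ⊆ Ω := by
    refine image_graphCone_inter_ball_subset hΩ hne hx (Set.disjoint_left.2 fun z hz hzf => ?_)
    obtain ⟨v, hv, rfl⟩ := hz
    exact hgraph v hv.1 (hfr ⟨hzf, hball ⟨v, hv, rfl⟩⟩)
  calc ν S * ENNReal.ofReal t ^ Module.finrank ℝ E = ν ((fun v => x + r • v) '' S) := by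
        have himage : (fun v => x + r • v) '' S = (fun v => x + v) '' (r • S) := by
          rw [← image_smul, image_image]
        rw [himage, image_add_left, measure_preimage_add, Measure.addHaar_smul, abs_pow, hr,
          ENNReal.ofReal_pow ht.le, mul_comm]
    _ ≤ ν (Metric.ball x t ∩ Ω) := measure_mono (subset_inter hball hsub)

end GraphCone

section Density

variable {n : ℕ} {Ω : Set (Fin n → ℝ)} {x : Fin n → ℝ} {c : ℝ≥0} {t : ℝ}

/-- The coordinate `(O x)_k`. -/
def rotatedCoord (O : Matrix (Fin n) (Fin n) ℝ) (k : Fin n) : (Fin n → ℝ) →L[ℝ] ℝ :=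
  (ContinuousLinearMap.proj k).comp O.mulVecLin.toContinuousLinearMap

/-- The remaining coordinates `(O x)_j`, `j ≠ k`. -/
def rotatedCoords (O : Matrix (Fin n) (Fin n) ℝ) (k : Fin n) :
    (Fin n → ℝ) →L[ℝ] ({j : Fin n // j ≠ k} → ℝ) :=
  ContinuousLinearMap.pi fun j => rotatedCoord O j

lemma graphCone_rotated_nonempty {O : Matrix (Fin n) (Fin n) ℝ}
    (hO : O ∈ Matrix.orthogonalGroup (Fin n) ℝ) (k : Fin n) (K : ℝ≥0) :
    (graphCone (rotatedCoords O k) (rotatedCoord O k) K).Nonempty := by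
  obtain ⟨v, hv⟩ : ∃ v, O *ᵥ v = Pi.single k 1 :=
    ⟨star O *ᵥ Pi.single k 1, by
      rw [Matrix.mulVec_mulVec, Matrix.mem_unitaryGroup_iff.1 hO, Matrix.one_mulVec]⟩
  have hcoord (j : Fin n) : rotatedCoord O j v = (Pi.single k 1 : Fin n → ℝ) j := congrFun hv j
  have hcoords : rotatedCoords O k v = 0 :=
    funext fun j => (hcoord j).trans (Pi.single_eq_of_ne j.2 1)
  exact ⟨v, by simp [graphCone, hcoord, hcoords]⟩

lemma frontier_inter_subset_graph {U : Set (Fin n → ℝ)} (hU : IsOpen U)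
    {O : Matrix (Fin n) (Fin n) ℝ} {k : Fin n} {φ : ({j : Fin n // j ≠ k} → ℝ) → ℝ}
    (hφ : Continuous φ) (hΩU : Ω ∩ U = rotatedEpigraph O k φ ∩ U) :
    frontier Ω ∩ U ⊆ {y | φ (rotatedCoords O k y) = rotatedCoord O k y} := by
  rw [← frontier_inter_open_inter hU, hΩU, frontier_inter_open_inter hU]
  exact inter_subset_left.trans (frontier_lt_subset_eq (f := fun y => φ (rotatedCoords O k y))
    (by fun_prop) (rotatedCoord O k).continuous)

/-- `Ω` fills at least the amount `c tⁿ` of the ball of radius `t` around `x`. -/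
def FillsBall (c : ℝ≥0) (Ω : Set (Fin n → ℝ)) (x : Fin n → ℝ) (t : ℝ) : Prop :=
  c * ENNReal.ofReal t ^ n ≤ volume (Metric.ball x t ∩ Ω)

lemma FillsBall.mono {c' : ℝ≥0} (hf : FillsBall c Ω x t) (hc : c' ≤ c) : FillsBall c' Ω x t :=
  (mul_le_mul_left (ENNReal.coe_le_coe.2 hc) _).trans hf

lemma FillsBall.of_ball_subset {y : Fin n → ℝ} {a : ℝ≥0} (hf : FillsBall c Ω y (a * t))
    (hsub : Metric.ball y (a * t) ⊆ Metric.ball x t) : FillsBall (c * a ^ n) Ω x t := by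
  refine le_of_eq_of_le ?_ (le_trans hf (measure_mono (inter_subset_inter_left _ hsub)))
  rw [ENNReal.ofReal_mul a.coe_nonneg, ENNReal.ofReal_coe_nnreal, mul_pow, ENNReal.coe_mul,
    ENNReal.coe_pow, mul_assoc]

lemma exists_fillsBall_of_chart (hΩ : IsOpen Ω) {U : Set (Fin n → ℝ)} (hU : IsOpen U)
    {O : Matrix (Fin n) (Fin n) ℝ} (hO : O ∈ Matrix.orthogonalGroup (Fin n) ℝ) {k : Fin n}
    {φ : ({j : Fin n // j ≠ k} → ℝ) → ℝ} {K : ℝ≥0} (hφ : LipschitzWith K φ)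
    (hΩU : Ω ∩ U = rotatedEpigraph O k φ ∩ U) :
    ∃ c : ℝ≥0, 0 < c ∧ ∀ x ∈ Ω, ∀ t : ℝ, 0 < t → frontier Ω ∩ Metric.ball x t ⊆ U →
      FillsBall c Ω x t := by
  set S := graphCone (rotatedCoords O k) (rotatedCoord O k) K ∩ Metric.ball (0 : Fin n → ℝ) 1
  have hne := graphCone_rotated_nonempty hO k K
  have hfin : volume S ≠ ⊤ := ((measure_mono inter_subset_right).trans_lt measure_ball_lt_top).ne
  refine ⟨(volume S).toNNReal,
    ENNReal.toNNReal_pos (measure_graphCone_inter_ball_pos hne).ne' hfin,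
    fun x hx t ht hfr => ?_⟩
  have hfill := measure_graphCone_mul_le (ν := volume) hΩ hne hφ hx ht
    ((subset_inter inter_subset_left hfr).trans (frontier_inter_subset_graph hU hφ.continuous hΩU))
  rw [Module.finrank_fin_fun] at hfill
  rwa [FillsBall, ENNReal.coe_toNNReal hfin]

lemma exists_norm_eq_of_not_isBounded {E : Type*} [SeminormedAddCommGroup E] {s : Set E} {x₀ : E}
    (hs : IsPreconnected s) (hb : ¬ Bornology.IsBounded s) (hx₀ : x₀ ∈ s) {r : ℝ}
    (hr : ‖x₀‖ ≤ r) : ∃ y ∈ s, ‖y‖ = r := by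
  obtain ⟨z, hz, hrz⟩ : ∃ z ∈ s, r ≤ ‖z‖ := by
    by_contra! hcon
    exact hb (isBounded_iff_forall_norm_le.2 ⟨r, fun x hx => (hcon x hx).le⟩)
  exact hs.intermediate_value hx₀ hz continuous_norm.continuousOn ⟨hr, hrz⟩

namespace IsStronglyLipschitzDomain

lemma exists_charts (hΩ : IsStronglyLipschitzDomain Ω) :
    ∃ (m : ℕ) (U : Fin m → Set (Fin n → ℝ)) (c : ℝ≥0), Nonempty (Fin m) ∧ (∀ i, IsOpen (U i)) ∧
      frontier Ω ⊆ ⋃ i, U i ∧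
      (∀ i j, ¬ Bornology.IsBounded (frontier Ω ∩ U i) →
        ¬ Bornology.IsBounded (frontier Ω ∩ U j) → i = j) ∧
      0 < c ∧ ∀ i, ∀ x ∈ Ω, ∀ t : ℝ, 0 < t → frontier Ω ∩ Metric.ball x t ⊆ U i →
        FillsBall c Ω x t := by
  obtain ⟨m, U, hU, hcov, hgraph, huniq⟩ := hΩ.boundary
  have hfill (i : Fin m) : ∃ c : ℝ≥0, 0 < c ∧ ∀ x ∈ Ω, ∀ t : ℝ, 0 < t →
      frontier Ω ∩ Metric.ball x t ⊆ U i → FillsBall c Ω x t := by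
    obtain ⟨O, hO, k, φ, K, hφ, hΩU⟩ := hgraph i
    exact exists_fillsBall_of_chart hΩ.isOpen (hU i) hO hφ hΩU
  choose c hc hfill using hfill
  obtain ⟨z, hz⟩ := nonempty_frontier_iff.2 ⟨hΩ.isConnected.nonempty, hΩ.ne_univ⟩
  obtain ⟨i₀, -⟩ := mem_iUnion.1 (hcov hz)
  have hne : (Finset.univ : Finset (Fin m)).Nonempty := ⟨i₀, Finset.mem_univ _⟩
  refine ⟨m, U, Finset.univ.inf' hne c, ⟨i₀⟩, hU, hcov, huniq,
    (Finset.lt_inf'_iff hne).2 fun i _ => hc i, fun i x hx t ht hfr => ?_⟩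
  exact (hfill i x hx t ht hfr).mono (Finset.inf'_le c (Finset.mem_univ i))

lemma exists_fillsBall_of_small_radius (hΩ : IsStronglyLipschitzDomain Ω) (ρ : ℝ) :
    ∃ r : ℝ≥0, 0 < r ∧ ∃ c : ℝ≥0, 0 < c ∧ ∀ x ∈ Ω, ‖x‖ ≤ ρ → ∀ t : ℝ, 0 < t → t ≤ r →
      FillsBall c Ω x t := by
  obtain ⟨m, U, c, ⟨i₀⟩, hU, hcov, -, hc, hfill⟩ := hΩ.exists_charts
  have hK : IsCompact (frontier Ω ∩ Metric.closedBall 0 (ρ + 1)) :=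
    (isCompact_closedBall 0 (ρ + 1)).inter_left isClosed_frontier
  obtain ⟨s, hs, hleb⟩ := lebesgue_number_lemma_of_metric hK hU (inter_subset_left.trans hcov)
  refine ⟨min (s / 2).toNNReal 1, lt_min (Real.toNNReal_pos.2 (half_pos hs)) one_pos, c, hc,
    fun x hx hxρ t ht htr => ?_⟩
  rw [NNReal.coe_min, Real.coe_toNNReal _ (half_pos hs).le, le_min_iff, NNReal.coe_one] at htr
  rcases (frontier Ω ∩ Metric.ball x t).eq_empty_or_nonempty with hemp | ⟨z, hzf, hzt⟩
  · exact hfill i₀ x hx t ht (hemp ▸ empty_subset _)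
  · have hzρ : ‖z‖ ≤ ρ + 1 := by
      have := norm_le_norm_add_norm_sub' z x
      rw [mem_ball_iff_norm] at hzt
      linarith
    obtain ⟨i, hi⟩ := hleb z ⟨hzf, by simpa using hzρ⟩
    refine hfill i x hx t ht fun y hy => hi ?_
    have := dist_triangle_right y z x
    have := Metric.mem_ball.1 hzt
    have := Metric.mem_ball.1 hy.2
    rw [Metric.mem_ball]
    linarith

lemma exists_fillsBall_of_norm_le (hΩ : IsStronglyLipschitzDomain Ω) (ρ : ℝ) (T : ℝ≥0) :
    ∃ c : ℝ≥0, 0 < c ∧ ∀ x ∈ Ω, ‖x‖ ≤ ρ → ∀ t : ℝ, 0 < t → t ≤ T → FillsBall c Ω x t := by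
  obtain ⟨r, hr, c, hc, hsmall⟩ := hΩ.exists_fillsBall_of_small_radius ρ
  rcases le_total T r with hT | hT
  · exact ⟨c, hc, fun x hx hxρ t ht htT => hsmall x hx hxρ t ht (htT.trans hT)⟩
  · have hT0 : 0 < T := hr.trans_le hT
    refine ⟨c * (r / T) ^ n, mul_pos hc (pow_pos (div_pos hr hT0) n), fun x hx hxρ t ht htT => ?_⟩
    have hrT : ((r / T : ℝ≥0) : ℝ) ≤ 1 := by exact_mod_cast (div_le_one hT0).2 hT
    refine (hsmall x hx hxρ _ (mul_pos (NNReal.coe_pos.2 (div_pos hr hT0)) ht) ?_).of_ball_subset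
      (Metric.ball_subset_ball (mul_le_of_le_one_left ht.le hrT))
    rw [NNReal.coe_div, div_mul_eq_mul_div, div_le_iff₀ (NNReal.coe_pos.2 hT0)]
    exact mul_le_mul_of_nonneg_left htT r.2

/-- Far from the origin only the unbounded boundary part is seen, so that its cone works at all
scales up to the distance from the origin. -/
lemma exists_fillsBall_of_le_norm (hΩ : IsStronglyLipschitzDomain Ω) :
    ∃ R c : ℝ≥0, 0 < c ∧ ∀ x ∈ Ω, R ≤ ‖x‖ → ∀ t : ℝ, 0 < t → t ≤ ‖x‖ / 2 →
      FillsBall c Ω x t := by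
  obtain ⟨m, U, c, ⟨i₀⟩, -, hcov, huniq, hc, hfill⟩ := hΩ.exists_charts
  have hbdd : Bornology.IsBounded (⋃ i ∈ {i | Bornology.IsBounded (frontier Ω ∩ U i)},
      frontier Ω ∩ U i) :=
    (Bornology.isBounded_biUnion (Set.toFinite _)).2 fun i hi => hi
  obtain ⟨R, hR0, hR⟩ := hbdd.subset_ball_lt 0 0
  lift R to ℝ≥0 using hR0.le
  have hfar : ∀ z ∈ frontier Ω, R ≤ ‖z‖ →
      ∃ i, ¬ Bornology.IsBounded (frontier Ω ∩ U i) ∧ z ∈ U i := by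
    intro z hz hzR
    obtain ⟨i, hi⟩ := mem_iUnion.1 (hcov hz)
    exact ⟨i, fun hb => hzR.not_gt (mem_ball_zero_iff.1 (hR (mem_biUnion hb ⟨hz, hi⟩))), hi⟩
  obtain ⟨i, hi⟩ : ∃ i, ∀ z ∈ frontier Ω, R ≤ ‖z‖ → z ∈ U i := by
    by_cases hex : ∃ i, ¬ Bornology.IsBounded (frontier Ω ∩ U i)
    · obtain ⟨i, hi⟩ := hex
      refine ⟨i, fun z hz hzR => ?_⟩
      obtain ⟨j, hj, hzj⟩ := hfar z hz hzR
      exact huniq i j hi hj ▸ hzj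
    · refine ⟨i₀, fun z hz hzR => ?_⟩
      obtain ⟨j, hj, -⟩ := hfar z hz hzR
      exact absurd ⟨j, hj⟩ hex
  refine ⟨2 * R, c, hc, fun x hx hxR t ht htx =>
    hfill i x hx t ht fun z hz => hi z hz.1 ?_⟩
  have := norm_le_norm_add_norm_sub z x
  have := mem_ball_iff_norm.1 hz.2
  rw [NNReal.coe_mul, NNReal.coe_ofNat] at hxR
  linarith

lemma exists_fillsBall_of_large_radius (hΩ : IsStronglyLipschitzDomain Ω)
    (hb : ¬ Bornology.IsBounded Ω) :
    ∃ T c : ℝ≥0, 0 < c ∧ ∀ x ∈ Ω, ∀ t : ℝ, T < t → FillsBall c Ω x t := by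
  obtain ⟨R, c, hc, hfar⟩ := hΩ.exists_fillsBall_of_le_norm
  obtain ⟨x₀, hx₀⟩ := hΩ.isConnected.nonempty
  refine ⟨4 * max R ‖x₀‖₊, c * (1 / 8) ^ n, by positivity, fun x hx t ht => ?_⟩
  have hRt : R < t / 4 ∧ ‖x₀‖ < t / 4 := by
    rw [← max_lt_iff]
    push_cast at ht
    linarith
  obtain ⟨y, hy, hyt, hxy⟩ : ∃ y ∈ Ω, t / 4 ≤ ‖y‖ ∧ dist y x ≤ t / 2 := by
    rcases le_or_gt (t / 4) ‖x‖ with hxt | hxt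
    · exact ⟨x, hx, hxt, by rw [dist_self]; linarith [R.coe_nonneg]⟩
    · obtain ⟨y, hy, hyt⟩ :=
        exists_norm_eq_of_not_isBounded hΩ.isConnected.isPreconnected hb hx₀ hRt.2.le
      exact ⟨y, hy, hyt.ge, by rw [dist_eq_norm]; linarith [norm_sub_le y x]⟩
  have ht0 : 0 < t / 4 := R.coe_nonneg.trans_lt hRt.1
  have h8 : ((1 / 8 : ℝ≥0) : ℝ) = 1 / 8 := by simp
  refine FillsBall.of_ball_subset (y := y) (hfar y hy (hRt.1.le.trans hyt) _ ?_ ?_)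
    (Metric.ball_subset_ball' ?_) <;> rw [h8] <;> linarith [ht0]

lemma exists_fillsBall_of_not_isBounded (hΩ : IsStronglyLipschitzDomain Ω)
    (hb : ¬ Bornology.IsBounded Ω) :
    ∃ c : ℝ≥0, 0 < c ∧ ∀ x ∈ Ω, ∀ t : ℝ, 0 < t → FillsBall c Ω x t := by
  obtain ⟨R, c₁, hc₁, hfar⟩ := hΩ.exists_fillsBall_of_le_norm
  obtain ⟨T, c₂, hc₂, hlarge⟩ := hΩ.exists_fillsBall_of_large_radius hb
  obtain ⟨c₃, hc₃, hnear⟩ := hΩ.exists_fillsBall_of_norm_le (max R (2 * T)) T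
  refine ⟨min c₁ (min c₂ c₃), lt_min hc₁ (lt_min hc₂ hc₃), fun x hx t ht => ?_⟩
  rcases lt_or_ge (T : ℝ) t with htT | htT
  · exact (hlarge x hx t htT).mono ((min_le_right _ _).trans (min_le_left _ _))
  rcases le_or_gt ‖x‖ (max R (2 * T)) with hxR | hxR
  · exact (hnear x hx hxR t ht htT).mono ((min_le_right _ _).trans (min_le_right _ _))
  · rw [max_lt_iff] at hxR
    exact (hfar x hx hxR.1.le t ht (by linarith)).mono (min_le_left _ _)

end IsStronglyLipschitzDomain

/-- The scales `0 < t < d_Ω` of the area function. -/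
def times (Ω : Set (Fin n → ℝ)) : Set ℝ := {t : ℝ | 0 < t ∧ ENNReal.ofReal t < dOmega Ω}

/-- The interior measure density condition: `Ω` fills a fixed portion of the balls centred in it,
at all scales below `d_Ω`. -/
def HasMeasureDensity (c : ℝ≥0) (Ω : Set (Fin n → ℝ)) : Prop :=
  ∀ x ∈ Ω, ∀ t ∈ times Ω, FillsBall c Ω x t

lemma IsStronglyLipschitzDomain.exists_hasMeasureDensity (hΩ : IsStronglyLipschitzDomain Ω) :
    ∃ c : ℝ≥0, 0 < c ∧ HasMeasureDensity c Ω := by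
  by_cases hb : Bornology.IsBounded Ω
  · obtain ⟨ρ, hρ⟩ := hb.exists_norm_le
    obtain ⟨c, hc, hfill⟩ := hΩ.exists_fillsBall_of_norm_le ρ (dOmega Ω).toNNReal
    refine ⟨c, hc, fun x hx t ht => hfill x hx (hρ x hx) t ht.1 ?_⟩
    have hfin : dOmega Ω ≠ ⊤ := ENNReal.mul_ne_top (by simp) hb.ediam_ne_top
    exact (ENNReal.ofReal_le_iff_le_toReal hfin).1 ht.2.le
  · obtain ⟨c, hc, hfill⟩ := hΩ.exists_fillsBall_of_not_isBounded hb
    exact ⟨c, hc, fun x hx t ht => hfill x hx t ht.1⟩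

end Density

section Multiplication

variable {α : Type*} {m : MeasurableSpace α} {μ : Measure α} {E : Type*} [NormedAddCommGroup E]
  [NormedSpace ℝ E]

/-- Multiplication of an `L²` function by a bounded real function. -/
def mulOp {g : α → ℝ} (hg : MemLp g ∞ μ) : Lp E 2 μ →L[ℝ] Lp E 2 μ :=
  (ContinuousLinearMap.lsmul ℝ ℝ).holderL μ ∞ 2 2 hg.toLp

lemma coeFn_mulOp {g : α → ℝ} (hg : MemLp g ∞ μ) (u : Lp E 2 μ) :
    mulOp hg u =ᵐ[μ] fun x => g x • u x := by
  have h := (ContinuousLinearMap.lsmul ℝ ℝ).coeFn_holder (r := 2) hg.toLp u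
  filter_upwards [h, hg.coeFn_toLp] with x hx hgx
  rwa [← hgx]

/-- Multiplication of a scalar `L²` function by a bounded vector field. -/
def mulVecOp [NormedSpace ℂ E] [IsScalarTower ℝ ℂ E] {w : α → E} (hw : MemLp w ∞ μ) :
    Lp ℂ 2 μ →L[ℝ] Lp E 2 μ :=
  (ContinuousLinearMap.lsmul ℝ ℂ).flip.holderL μ ∞ 2 2 hw.toLp

lemma coeFn_mulVecOp [NormedSpace ℂ E] [IsScalarTower ℝ ℂ E] {w : α → E} (hw : MemLp w ∞ μ)
    (u : Lp ℂ 2 μ) : mulVecOp hw u =ᵐ[μ] fun x => u x • w x := by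
  have h := (ContinuousLinearMap.lsmul ℝ ℂ).flip.coeFn_holder (r := 2) hw.toLp u
  filter_upwards [h, hw.coeFn_toLp] with x hx hwx
  rwa [← hwx]

end Multiplication

section Sobolev

variable {n : ℕ} {Ω : Set (Fin n → ℝ)} {φ ψ : (Fin n → ℝ) → ℂ} {x : Fin n → ℝ}

lemma classicalGrad_apply (φ : (Fin n → ℝ) → ℂ) (x : Fin n → ℝ) (i : Fin n) :
    classicalGrad φ x i = fderiv ℝ φ x (Pi.single i 1) := rfl

lemma continuous_classicalGrad (hφ : ContDiff ℝ ∞ φ) :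
    Continuous (classicalGrad φ) := by
  refine (PiLp.continuous_toLp 2 _).comp (continuous_pi fun i => ?_)
  exact (hφ.continuous_fderiv (by simp)).clm_apply continuous_const

lemma classicalGrad_add (hφ : ContDiff ℝ ∞ φ) (hψ : ContDiff ℝ ∞ ψ)
    (x : Fin n → ℝ) :
    classicalGrad (fun y => φ y + ψ y) x = classicalGrad φ x + classicalGrad ψ x := by
  ext i
  rw [PiLp.add_apply, classicalGrad_apply, classicalGrad_apply, classicalGrad_apply,
    fderiv_fun_add (hφ.differentiable (by simp) x) (hψ.differentiable (by simp) x)]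
  rfl

lemma classicalGrad_mul (hφ : ContDiff ℝ ∞ φ) (hψ : ContDiff ℝ ∞ ψ)
    (x : Fin n → ℝ) :
    classicalGrad (fun y => φ y * ψ y) x = φ x • classicalGrad ψ x + ψ x • classicalGrad φ x := by
  ext i
  rw [PiLp.add_apply, PiLp.smul_apply, PiLp.smul_apply, classicalGrad_apply, classicalGrad_apply,
    classicalGrad_apply,
    fderiv_fun_mul (hφ.differentiable (by simp) x) (hψ.differentiable (by simp) x)]
  rfl

lemma classicalGrad_const_mul (c : ℂ) (hφ : ContDiff ℝ ∞ φ)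
    (x : Fin n → ℝ) :
    classicalGrad (fun y => c * φ y) x = c • classicalGrad φ x := by
  rw [classicalGrad_mul contDiff_const hφ]
  ext i
  simp [classicalGrad_apply]

lemma classicalGrad_eq_zero_of_notMem (hx : x ∉ tsupport φ) : classicalGrad φ x = 0 := by
  have : fderiv ℝ φ x = 0 :=
    image_eq_zero_of_notMem_tsupport fun h => hx (tsupport_fderiv_subset ℝ h)
  ext i
  simp [classicalGrad_apply, this]

namespace IsTestFunction

lemma add (hφ : IsTestFunction Ω φ) (hψ : IsTestFunction Ω ψ) :
    IsTestFunction Ω (fun x => φ x + ψ x) :=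
  ⟨hφ.contDiff.add hψ.contDiff, hφ.hasCompactSupport.add hψ.hasCompactSupport,
    (tsupport_add φ ψ).trans (union_subset hφ.tsupport_subset hψ.tsupport_subset)⟩

lemma mul_left (hφ : IsTestFunction Ω φ) (hψ : ContDiff ℝ ∞ ψ) :
    IsTestFunction Ω (fun x => ψ x * φ x) :=
  ⟨hψ.mul hφ.contDiff, hφ.hasCompactSupport.mul_left,
    (tsupport_mul_subset_right).trans hφ.tsupport_subset⟩

lemma zero : IsTestFunction Ω (fun _ => 0) :=
  ⟨contDiff_const, HasCompactSupport.zero, by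
    have : tsupport (fun _ : Fin n → ℝ => (0 : ℂ)) = ∅ := tsupport_eq_empty_iff.2 rfl
    simp [this]⟩

lemma memLp (hφ : IsTestFunction Ω φ) :
    MemLp φ 2 (volume.restrict Ω) :=
  (hφ.contDiff.continuous.memLp_of_hasCompactSupport hφ.hasCompactSupport)

lemma hasCompactSupport_grad (hφ : IsTestFunction Ω φ) :
    HasCompactSupport (classicalGrad φ) :=
  HasCompactSupport.intro hφ.hasCompactSupport fun _ hx => classicalGrad_eq_zero_of_notMem hx

lemma memLp_grad (hφ : IsTestFunction Ω φ) :
    MemLp (classicalGrad φ) 2 (volume.restrict Ω) :=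
  (continuous_classicalGrad hφ.contDiff).memLp_of_hasCompactSupport hφ.hasCompactSupport_grad

lemma eq_zero_of_notMem (hφ : IsTestFunction Ω φ) (hx : x ∉ Ω) : φ x = 0 :=
  image_eq_zero_of_notMem_tsupport fun h => hx (hφ.tsupport_subset h)

lemma integral_mul_grad (hφ : IsTestFunction Ω φ) (hψ : IsTestFunction Ω ψ) (i : Fin n) :
    ∫ x in Ω, φ x * classicalGrad ψ x i = - ∫ x in Ω, classicalGrad φ x i * ψ x := by
  have hcont {χ : (Fin n → ℝ) → ℂ} (hχ : IsTestFunction Ω χ) :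
      Continuous fun x => fderiv ℝ χ x (Pi.single i 1) :=
    (hχ.contDiff.continuous_fderiv (by simp)).clm_apply continuous_const
  have hφc := hφ.contDiff.continuous
  have hψc := hψ.contDiff.continuous
  rw [setIntegral_eq_integral_of_forall_compl_eq_zero fun x hx => by
      rw [hφ.eq_zero_of_notMem hx, zero_mul],
    setIntegral_eq_integral_of_forall_compl_eq_zero fun x hx => by
      rw [hψ.eq_zero_of_notMem hx, mul_zero]]
  exact integral_mul_fderiv_eq_neg_fderiv_mul_of_integrable
    (((hcont hφ).mul hψc).integrable_of_hasCompactSupport hψ.hasCompactSupport.mul_left)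
    ((hφc.mul (hcont hψ)).integrable_of_hasCompactSupport hφ.hasCompactSupport.mul_right)
    ((hφc.mul hψc).integrable_of_hasCompactSupport hφ.hasCompactSupport.mul_right)
    (fun x _ => hφ.contDiff.differentiable (by simp) x)
    (fun x _ => hψ.contDiff.differentiable (by simp) x)

end IsTestFunction

variable (Ω) in
/-- The pairs `(φ, ∇φ)`, `φ ∈ C_c^∞(Ω)`. -/
def testGraph : Submodule ℂ (L2 Ω × L2Vec Ω) where
  carrier := {p | ∃ φ, IsTestFunction Ω φ ∧ p.1 =ᵐ[volume.restrict Ω] φ ∧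
    p.2 =ᵐ[volume.restrict Ω] classicalGrad φ}
  add_mem' := by
    rintro p q ⟨φ, hφ, hφ1, hφ2⟩ ⟨ψ, hψ, hψ1, hψ2⟩
    refine ⟨_, hφ.add hψ, ?_, ?_⟩
    · filter_upwards [Lp.coeFn_add p.1 q.1, hφ1, hψ1] with x h1 h2 h3
      rw [Prod.fst_add, h1, Pi.add_apply, h2, h3]
    · filter_upwards [Lp.coeFn_add p.2 q.2, hφ2, hψ2] with x h1 h2 h3
      rw [Prod.snd_add, h1, Pi.add_apply, h2, h3, classicalGrad_add hφ.contDiff hψ.contDiff]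
  zero_mem' := by
    refine ⟨_, IsTestFunction.zero, Lp.coeFn_zero _ _ _, ?_⟩
    refine (Lp.coeFn_zero _ _ _).trans (Eventually.of_forall fun x => ?_)
    ext i
    simp [classicalGrad_apply]
  smul_mem' := by
    rintro c p ⟨φ, hφ, hφ1, hφ2⟩
    refine ⟨_, hφ.mul_left (contDiff_const (c := c)), ?_, ?_⟩
    · filter_upwards [Lp.coeFn_smul c p.1, hφ1] with x h1 h2
      rw [Prod.smul_fst, h1, Pi.smul_apply, h2, smul_eq_mul]
    · filter_upwards [Lp.coeFn_smul c p.2, hφ2] with x h1 h2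
      rw [Prod.smul_snd, h1, Pi.smul_apply, h2, classicalGrad_const_mul c hφ.contDiff]

variable (Ω) in
/-- The graph of the gradient on `W_0^{1,2}(Ω)`. -/
def gradGraph : Submodule ℂ (L2 Ω × L2Vec Ω) := (testGraph Ω).topologicalClosure

lemma continuous_integral_clm_mul {α E : Type*} {m : MeasurableSpace α} {μ : Measure α}
    [NormedAddCommGroup E] [NormedSpace ℂ E] (ℓ : E →L[ℂ] ℂ) {h : α → ℂ} (hh : MemLp h 2 μ) :
    Continuous fun u : Lp E 2 μ => ∫ x, ℓ (u x) * h x ∂μ := by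
  have hpair : (fun u : Lp E 2 μ => ∫ x, ℓ (u x) * h x ∂μ) = fun u =>
      ((ContinuousLinearMap.mul ℂ ℂ).comp ℓ).lpPairing μ 2 2 u hh.toLp := by
    ext u
    rw [ContinuousLinearMap.lpPairing_eq_integral]
    refine integral_congr_ae ?_
    filter_upwards [hh.coeFn_toLp] with x hx
    rw [hx]
    rfl
  rw [hpair]
  exact ((((ContinuousLinearMap.mul ℂ ℂ).comp ℓ).lpPairing μ 2 2).flip _).continuous

lemma isWeakGradient_of_mem_gradGraph {u : L2 Ω} {G : L2Vec Ω} (h : (u, G) ∈ gradGraph Ω) :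
    IsWeakGradient u G := by
  intro ψ hψ i
  have hgrad : MemLp (fun x => classicalGrad ψ x i) 2 (volume.restrict Ω) :=
    hψ.memLp_grad.continuousLinearMap_comp (EuclideanSpace.proj (𝕜 := ℂ) i)
  have hcont : Continuous fun p : L2 Ω × L2Vec Ω =>
      (∫ x in Ω, p.1 x * classicalGrad ψ x i) + ∫ x in Ω, p.2 x i * ψ x :=
    ((continuous_integral_clm_mul (.id ℂ ℂ) hgrad).comp continuous_fst).add
      ((continuous_integral_clm_mul (EuclideanSpace.proj i) hψ.memLp).comp continuous_snd)
  refine eq_neg_of_add_eq_zero_left (closure_minimal ?_ (isClosed_eq hcont continuous_const) h)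
  rintro p ⟨φ, hφ, hφp, hφp'⟩
  have hleft : ∫ x in Ω, p.1 x * classicalGrad ψ x i = ∫ x in Ω, φ x * classicalGrad ψ x i :=
    integral_congr_ae (hφp.mono fun x hx => congrArg (· * classicalGrad ψ x i) hx)
  have hright : ∫ x in Ω, p.2 x i * ψ x = ∫ x in Ω, classicalGrad φ x i * ψ x :=
    integral_congr_ae (hφp'.mono fun x hx => congrArg (fun v => v i * ψ x) hx)
  rw [mem_ofPred_eq, hleft, hright, hφ.integral_mul_grad hψ i, neg_add_cancel]

lemma ae_eq_zero_of_integral_mul_testFunction_eq_zero (hΩ : IsOpen Ω) {h : (Fin n → ℝ) → ℂ}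
    (hloc : LocallyIntegrableOn h Ω)
    (h0 : ∀ φ, IsTestFunction Ω φ → ∫ x in Ω, h x * φ x = 0) :
    ∀ᵐ x ∂(volume.restrict Ω), h x = 0 := by
  rw [ae_restrict_iff' hΩ.measurableSet]
  refine hΩ.ae_eq_zero_of_integral_contDiff_smul_eq_zero hloc fun g hg hgc hgs => ?_
  have htest : IsTestFunction Ω (fun x => (g x : ℂ)) :=
    ⟨Complex.ofRealCLM.contDiff.comp hg, hgc.comp_left Complex.ofReal_zero,
      (tsupport_comp_subset Complex.ofReal_zero g).trans hgs⟩
  rw [← setIntegral_eq_integral_of_forall_compl_eq_zero (s := Ω) fun x hx => by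
    rw [image_eq_zero_of_notMem_tsupport fun hx' => hx (hgs hx'), zero_smul], ← h0 _ htest]
  simp only [Complex.real_smul, mul_comm]

lemma IsWeakGradient.unique (hΩ : IsOpen Ω) {u : L2 Ω} {G G' : L2Vec Ω} (h : IsWeakGradient u G)
    (h' : IsWeakGradient u G') : G = G' := by
  have hmem (H : L2Vec Ω) (i : Fin n) : MemLp (fun x => H x i) 2 (volume.restrict Ω) :=
    (Lp.memLp H).continuousLinearMap_comp (EuclideanSpace.proj (𝕜 := ℂ) i)
  have hint (H : L2Vec Ω) (i : Fin n) {φ} (hφ : IsTestFunction Ω φ) :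
      Integrable (fun x => H x i * φ x) (volume.restrict Ω) :=
    (hmem H i).integrable_mul hφ.memLp
  have hcoord (i : Fin n) : ∀ᵐ x ∂(volume.restrict Ω), G x i - G' x i = 0 := by
    refine ae_eq_zero_of_integral_mul_testFunction_eq_zero hΩ
      (locallyIntegrableOn_of_locallyIntegrable_restrict
        (((hmem G i).sub (hmem G' i)).locallyIntegrable one_le_two)) fun φ hφ => ?_
    simp_rw [sub_mul]
    rw [integral_sub (hint G i hφ) (hint G' i hφ), sub_eq_zero]
    exact neg_inj.1 ((h _ hφ i).symm.trans (h' _ hφ i))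
  refine Lp.ext ?_
  filter_upwards [ae_all_iff.2 hcoord] with x hx
  ext i
  exact sub_eq_zero.1 (hx i)

lemma weakGrad_eq (hΩ : IsOpen Ω) {u : L2 Ω} {G : L2Vec Ω} (h : IsWeakGradient u G) :
    weakGrad u = G := by
  have hex : ∃ G : L2Vec Ω, IsWeakGradient u G := ⟨G, h⟩
  rw [weakGrad, dif_pos hex]
  exact hex.choose_spec.unique hΩ h

lemma mem_gradGraph_iff {u : L2 Ω} {G : L2Vec Ω} :
    (u, G) ∈ gradGraph Ω ↔ ∀ ε : ℝ≥0∞, 0 < ε → ∃ φ : (Fin n → ℝ) → ℂ, IsTestFunction Ω φ ∧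
      eLpNorm (fun x => u x - φ x) 2 (volume.restrict Ω) +
        eLpNorm (fun x => G x - classicalGrad φ x) 2 (volume.restrict Ω) < ε := by
  have hdist {E : Type _} [NormedAddCommGroup E] {v w : Lp E 2 (volume.restrict Ω)}
      {g : (Fin n → ℝ) → E} (hw : w =ᵐ[volume.restrict Ω] g) :
      edist v w = eLpNorm (fun x => v x - g x) 2 (volume.restrict Ω) := by
    rw [Lp.edist_def]
    exact eLpNorm_congr_ae (hw.mono fun x hx => congrArg (v x - ·) hx)
  refine EMetric.mem_closure_iff.trans
    ⟨fun h ε hε => ?_, fun h ε hε => ?_⟩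
  · obtain ⟨p, ⟨φ, hφ, hφp, hφp'⟩, hlt⟩ := h (ε / 2) (ENNReal.half_pos hε.ne')
    rw [Prod.edist_eq, max_lt_iff, hdist hφp, hdist hφp'] at hlt
    exact ⟨φ, hφ, (ENNReal.add_lt_add hlt.1 hlt.2).trans_eq (ENNReal.add_halves ε)⟩
  · obtain ⟨φ, hφ, hlt⟩ := h ε hε
    refine ⟨(hφ.memLp.toLp, hφ.memLp_grad.toLp), ⟨φ, hφ, hφ.memLp.coeFn_toLp,
      hφ.memLp_grad.coeFn_toLp⟩, lt_of_le_of_lt ?_ hlt⟩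
    rw [Prod.edist_eq, hdist hφ.memLp.coeFn_toLp, hdist hφ.memLp_grad.coeFn_toLp]
    exact max_le le_self_add le_add_self

lemma mem_sobolevW0_iff {u : L2 Ω} : u ∈ sobolevW0 Ω ↔ (u, weakGrad u) ∈ gradGraph Ω :=
  ⟨fun h => mem_gradGraph_iff.2 h.2,
    fun h => ⟨⟨_, isWeakGradient_of_mem_gradGraph h⟩, mem_gradGraph_iff.1 h⟩⟩

lemma mem_sobolevW0_of_mem_gradGraph (hΩ : IsOpen Ω) {u : L2 Ω} {G : L2Vec Ω}
    (h : (u, G) ∈ gradGraph Ω) : u ∈ sobolevW0 Ω ∧ weakGrad u = G := by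
  have hgrad := weakGrad_eq hΩ (isWeakGradient_of_mem_gradGraph h)
  exact ⟨mem_sobolevW0_iff.2 (hgrad ▸ h), hgrad⟩

lemma sub_mem_sobolevW0 (hΩ : IsOpen Ω) {u v : L2 Ω} (hu : u ∈ sobolevW0 Ω)
    (hv : v ∈ sobolevW0 Ω) : u - v ∈ sobolevW0 Ω ∧ weakGrad (u - v) = weakGrad u - weakGrad v :=
  mem_sobolevW0_of_mem_gradGraph hΩ
    ((gradGraph Ω).sub_mem (mem_sobolevW0_iff.1 hu) (mem_sobolevW0_iff.1 hv))

lemma mem_sobolevW0_of_tendsto (hΩ : IsOpen Ω) {u : ℕ → L2 Ω} {u₀ : L2 Ω} {G : L2Vec Ω}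
    (hu : ∀ k, u k ∈ sobolevW0 Ω) (h1 : Tendsto u atTop (𝓝 u₀))
    (h2 : Tendsto (fun k => weakGrad (u k)) atTop (𝓝 G)) :
    u₀ ∈ sobolevW0 Ω ∧ weakGrad u₀ = G := by
  refine mem_sobolevW0_of_mem_gradGraph hΩ ?_
  exact isClosed_closure.mem_of_tendsto (h1.prodMk_nhds h2)
    (Eventually.of_forall fun k => mem_sobolevW0_iff.1 (hu k))

lemma weakGrad_zero (hΩ : IsOpen Ω) : weakGrad (0 : L2 Ω) = 0 :=
  (mem_sobolevW0_of_mem_gradGraph hΩ (gradGraph Ω).zero_mem).2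

/-- The gradient of a real function, as a complex vector field. -/
def realGrad (χ : (Fin n → ℝ) → ℝ) : (Fin n → ℝ) → EuclideanSpace ℂ (Fin n) :=
  classicalGrad fun x => (χ x : ℂ)

lemma realGrad_const (c : ℝ) (x : Fin n → ℝ) : realGrad (fun _ : Fin n → ℝ => c) x = 0 := by
  ext i
  simp [realGrad, classicalGrad_apply]

/-- Smooth bounded real functions with bounded gradient. -/
structure IsCutoff (χ : (Fin n → ℝ) → ℝ) : Prop where
  contDiff : ContDiff ℝ ∞ χ
  bounded : ∃ C, ∀ x, ‖χ x‖ ≤ C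
  grad_bounded : ∃ C, ∀ x, ‖realGrad χ x‖ ≤ C

namespace IsCutoff

variable {χ : (Fin n → ℝ) → ℝ}

lemma contDiff_ofReal (h : IsCutoff χ) : ContDiff ℝ ∞ fun x => (χ x : ℂ) :=
  Complex.ofRealCLM.contDiff.comp h.contDiff

lemma memLp (h : IsCutoff χ) : MemLp χ ∞ (volume.restrict Ω) :=
  memLp_top_of_bound h.contDiff.continuous.aestronglyMeasurable _
    (Eventually.of_forall h.bounded.choose_spec)

lemma continuous_grad (h : IsCutoff χ) : Continuous (realGrad χ) :=
  continuous_classicalGrad h.contDiff_ofReal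

lemma memLp_grad (h : IsCutoff χ) : MemLp (realGrad χ) ∞ (volume.restrict Ω) :=
  memLp_top_of_bound h.continuous_grad.aestronglyMeasurable _
    (Eventually.of_forall h.grad_bounded.choose_spec)

lemma const (c : ℝ) : IsCutoff (fun _ : Fin n → ℝ => c) :=
  ⟨contDiff_const, ⟨‖c‖, fun _ => le_rfl⟩, ⟨0, fun x => by simp [realGrad_const]⟩⟩

lemma realGrad_sq (h : IsCutoff χ) (x : Fin n → ℝ) :
    realGrad (fun y => χ y ^ 2) x = ((2 * χ x : ℝ) : ℂ) • realGrad χ x := by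
  have e : (fun y => ((χ y ^ 2 : ℝ) : ℂ)) = fun y => (χ y : ℂ) * χ y := by
    ext y; push_cast; ring
  rw [realGrad, e, classicalGrad_mul h.contDiff_ofReal h.contDiff_ofReal, ← two_smul ℂ, smul_smul]
  push_cast
  rfl

lemma sq (h : IsCutoff χ) : IsCutoff fun x => χ x ^ 2 := by
  obtain ⟨C, hC⟩ := h.bounded
  obtain ⟨D, hD⟩ := h.grad_bounded
  refine ⟨h.contDiff.pow 2, ⟨C ^ 2, fun x => ?_⟩, ⟨2 * C * D, fun x => ?_⟩⟩
  · rw [norm_pow]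
    exact pow_le_pow_left₀ (norm_nonneg _) (hC x) 2
  · rw [h.realGrad_sq, norm_smul, Complex.norm_real, norm_mul, Real.norm_two]
    have := norm_nonneg (χ x)
    exact mul_le_mul (mul_le_mul_of_nonneg_left (hC x) zero_le_two) (hD x) (norm_nonneg _)
      (by linarith [hC x])

lemma mulOp_mem_sobolevW0 (h : IsCutoff χ) (hΩ : IsOpen Ω) {u : L2 Ω} (hu : u ∈ sobolevW0 Ω) :
    mulOp h.memLp u ∈ sobolevW0 Ω ∧
      weakGrad (mulOp h.memLp u) = mulOp h.memLp (weakGrad u) + mulVecOp h.memLp_grad u := by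
  refine mem_sobolevW0_of_mem_gradGraph hΩ ?_
  let Θ : L2 Ω × L2Vec Ω → L2 Ω × L2Vec Ω := fun p =>
    (mulOp h.memLp p.1, mulOp h.memLp p.2 + mulVecOp h.memLp_grad p.1)
  have hcont : Continuous Θ := by fun_prop
  have hmaps : MapsTo Θ (testGraph Ω) (testGraph Ω) := by
    rintro p ⟨φ, hφ, hu, hG⟩
    refine ⟨_, hφ.mul_left h.contDiff_ofReal, ?_, ?_⟩
    · filter_upwards [coeFn_mulOp h.memLp p.1, hu] with x hmul hux
      rw [hmul, hux, Complex.real_smul]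
    · filter_upwards [Lp.coeFn_add (mulOp h.memLp p.2) (mulVecOp h.memLp_grad p.1),
        coeFn_mulOp h.memLp p.2, coeFn_mulVecOp h.memLp_grad p.1, hu, hG]
        with x hadd hmul hvec hux hGx
      rw [hadd, Pi.add_apply, hmul, hvec, hux, hGx,
        classicalGrad_mul h.contDiff_ofReal hφ.contDiff]
      rfl
  exact hmaps.closure hcont (mem_sobolevW0_iff.1 hu)

end IsCutoff

end Sobolev

lemma hasDerivWithinAt_Ioi_iff_tendsto_slope_zero {E : Type*} [NormedAddCommGroup E]
    [NormedSpace ℝ E] {f : ℝ → E} {f' : E} {x : ℝ} :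
    HasDerivWithinAt f f' (Ioi x) x ↔
      Tendsto (fun t => t⁻¹ • (f (x + t) - f x)) (𝓝[>] 0) (𝓝 f') := by
  have hmap : map (x + ·) (𝓝[>] 0) = 𝓝[>] x := by
    simpa only [Homeomorph.coe_addLeft, add_zero, image_const_add_Ioi] using
      (Homeomorph.addLeft x).isEmbedding.map_nhdsWithin_eq (Ioi 0) 0
  rw [hasDerivWithinAt_iff_tendsto_slope' self_notMem_Ioi, ← hmap, tendsto_map'_iff]
  refine tendsto_congr fun t => ?_
  simp [slope_def_module]

namespace IsSemigroupGeneratedByNeg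

variable {X : Type*} [NormedAddCommGroup X] [NormedSpace ℂ X] {L : X → X → Prop}
  {T : ℝ → X →L[ℂ] X} {u w f : X} {s t : ℝ}

lemma add_apply (hT : IsSemigroupGeneratedByNeg L T) (hs : 0 ≤ s) (ht : 0 ≤ t) (f : X) :
    T (s + t) f = T s (T t f) :=
  DFunLike.congr_fun (hT.add s t hs ht) f

lemma generator_sub (hT : IsSemigroupGeneratedByNeg L T) {u' w' : X} (h : L u w)
    (h' : L u' w') : L (u - u') (w - w') := by
  rw [hT.generator] at *
  have hlim := h.sub h'
  rw [neg_sub_neg, ← neg_sub] at hlim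
  refine hlim.congr fun t => ?_
  rw [map_sub, ← smul_sub, sub_sub_sub_comm]

lemma generator_smul (hT : IsSemigroupGeneratedByNeg L T) (h : L u w) (c : ℂ) :
    L (c • u) (c • w) := by
  rw [hT.generator] at *
  rw [← smul_neg]
  refine (h.const_smul c).congr fun t => ?_
  rw [map_smul, ← smul_sub, smul_comm]

lemma generator_map (hT : IsSemigroupGeneratedByNeg L T) (h : L u w) (hs : 0 ≤ s) :
    L (T s u) (T s w) := by
  rw [hT.generator] at *
  rw [← map_neg]
  refine (((T s).continuous.tendsto _).comp h).congr' ?_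
  filter_upwards [self_mem_nhdsWithin] with t ht
  have ht : 0 ≤ t := le_of_lt ht
  rw [Function.comp_apply, map_smul, map_sub, ← hT.add_apply hs ht, ← hT.add_apply ht hs,
    add_comm s t]

lemma intervalIntegrable (hT : IsSemigroupGeneratedByNeg L T) (f : X) (hs : 0 ≤ s)
    (ht : 0 ≤ t) : IntervalIntegrable (fun r => T r f) volume s t :=
  ((hT.continuous f).mono (ordConnected_Ici.uIcc_subset hs ht)).intervalIntegrable

variable [NormedSpace ℝ X]

lemma tendsto_average [CompleteSpace X] (hT : IsSemigroupGeneratedByNeg L T) (f : X)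
    (hs : 0 ≤ s) :
    Tendsto (fun t => t⁻¹ • ∫ r in s..(s + t), T r f) (𝓝[>] 0) (𝓝 (T s f)) := by
  have hcont : ContinuousOn (fun r => T r f) (Ioi s) :=
    (hT.continuous f).mono fun r hr => hs.trans (le_of_lt hr)
  have hderiv : HasDerivWithinAt (fun v => ∫ r in s..v, T r f) (T s f) (Ici s) s :=
    intervalIntegral.integral_hasDerivWithinAt_right IntervalIntegrable.refl
      (hcont.stronglyMeasurableAtFilter_nhdsWithin measurableSet_Ioi s)
      (((hT.continuous f) s hs).mono fun r hr => hs.trans (le_of_lt hr))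
  simpa using hasDerivWithinAt_Ioi_iff_tendsto_slope_zero.1 hderiv.Ioi_of_Ici

variable [IsScalarTower ℝ ℂ X]

lemma hasDerivWithinAt (hT : IsSemigroupGeneratedByNeg L T) (h : L u w) (hs : 0 ≤ s) :
    HasDerivWithinAt (fun r => T r u) (-T s w) (Ioi s) s := by
  rw [hasDerivWithinAt_Ioi_iff_tendsto_slope_zero]
  refine ((hT.generator _ _).1 (hT.generator_map h hs)).congr' ?_
  filter_upwards [self_mem_nhdsWithin] with t ht
  rw [← hT.add_apply (le_of_lt ht) hs, add_comm t s, ← algebraMap_smul ℂ t⁻¹]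
  rfl

variable [CompleteSpace X]

lemma map_integral (hT : IsSemigroupGeneratedByNeg L T) (f : X) (hs : 0 ≤ s) (ht : 0 ≤ t) :
    T t (∫ r in 0..s, T r f) = ∫ r in t..(t + s), T r f := by
  calc T t (∫ r in 0..s, T r f) = ∫ r in 0..s, T t (T r f) :=
        (((T t).restrictScalars ℝ).intervalIntegral_comp_comm
          (hT.intervalIntegrable f le_rfl hs)).symm
    _ = ∫ r in 0..s, T (t + r) f := by
        refine intervalIntegral.integral_congr fun r hr => ?_
        rw [uIcc_of_le hs] at hr
        exact (hT.add_apply ht hr.1 f).symm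
    _ = ∫ r in t..(t + s), T r f := by
        rw [intervalIntegral.integral_comp_add_left fun r => T r f, add_zero]

lemma generator_integral (hT : IsSemigroupGeneratedByNeg L T) (f : X) (hs : 0 ≤ s) :
    L (∫ r in 0..s, T r f) (f - T s f) := by
  rw [hT.generator, neg_sub]
  have hlim := (hT.tendsto_average f hs).sub (hT.tendsto_average f le_rfl)
  rw [hT.zero, ContinuousLinearMap.id_apply] at hlim
  refine hlim.congr' ?_
  filter_upwards [self_mem_nhdsWithin] with t ht
  have ht : 0 ≤ t := le_of_lt ht
  rw [hT.map_integral f hs ht, add_comm t s, zero_add, ← smul_sub,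
    ← intervalIntegral.integral_interval_sub_interval_comm'
      (hT.intervalIntegrable f ht (add_nonneg hs ht)) (hT.intervalIntegrable f le_rfl hs)
      (hT.intervalIntegrable f ht le_rfl), ← algebraMap_smul ℂ t⁻¹]
  rfl

lemma exists_seq_tendsto (hT : IsSemigroupGeneratedByNeg L T) (f : X) :
    ∃ u w : ℕ → X, (∀ k, L (u k) (w k)) ∧ Tendsto u atTop (𝓝 f) := by
  have hseq : Tendsto (fun k : ℕ => 1 / ((k : ℝ) + 1)) atTop (𝓝[>] 0) :=
    tendsto_nhdsWithin_iff.2 ⟨tendsto_one_div_add_atTop_nhds_zero_nat,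
      Eventually.of_forall fun k => mem_Ioi.2 Nat.one_div_pos_of_nat⟩
  have hlim := (hT.tendsto_average f le_rfl).comp hseq
  rw [hT.zero, ContinuousLinearMap.id_apply] at hlim
  refine ⟨_, fun k => (((1 / ((k : ℝ) + 1))⁻¹ : ℝ) : ℂ) • (f - T (1 / ((k : ℝ) + 1)) f),
    fun k => ?_, hlim⟩
  have hgen := hT.generator_smul (hT.generator_integral f (Nat.one_div_pos_of_nat (n := k)).le)
    ((1 / ((k : ℝ) + 1))⁻¹ : ℝ)
  simpa [← algebraMap_smul ℂ ((k : ℝ) + 1)] using hgen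

end IsSemigroupGeneratedByNeg

section L2Norm

variable {α E : Type*} {m : MeasurableSpace α} {μ : Measure α} [NormedAddCommGroup E]

lemma eLpNorm_two_sq_eq_lintegral (f : α → E) :
    eLpNorm f 2 μ ^ 2 = ∫⁻ x, ‖f x‖ₑ ^ 2 ∂μ := by
  have h := eLpNorm_nnreal_pow_eq_lintegral (f := f) (μ := μ) (p := 2) two_ne_zero
  simpa only [NNReal.coe_ofNat, ENNReal.rpow_ofNat, ENNReal.coe_ofNat] using h

lemma enorm_sq_eq_lintegral (f : Lp E 2 μ) : ‖f‖ₑ ^ 2 = ∫⁻ x, ‖f x‖ₑ ^ 2 ∂μ := by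
  rw [Lp.enorm_def, eLpNorm_two_sq_eq_lintegral]

lemma enorm_sq_eq_ofReal (v : E) : ‖v‖ₑ ^ 2 = ENNReal.ofReal (‖v‖ ^ 2) := by
  rw [ENNReal.ofReal_pow (norm_nonneg _), ofReal_norm]

lemma norm_sq_eq_integral (f : Lp E 2 μ) : ‖f‖ ^ 2 = ∫ x, ‖f x‖ ^ 2 ∂μ := by
  rw [integral_eq_lintegral_of_nonneg_ae (Eventually.of_forall fun _ => sq_nonneg _)
    ((Lp.aestronglyMeasurable f).norm.pow 2)]
  simp_rw [← enorm_sq_eq_ofReal]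
  rw [← enorm_sq_eq_lintegral, ENNReal.toReal_pow, toReal_enorm]

lemma integrable_norm_sq (f : Lp E 2 μ) : Integrable (fun x => ‖f x‖ ^ 2) μ :=
  (Lp.memLp f).norm.integrable_sq

end L2Norm

section Form

variable {n : ℕ}

/-- The sesquilinear form `A ξ · conj η`. -/
def form (M : Matrix (Fin n) (Fin n) ℂ) (ξ η : EuclideanSpace ℂ (Fin n)) : ℂ :=
  (M *ᵥ ξ.ofLp) ⬝ᵥ star η.ofLp

variable (M : Matrix (Fin n) (Fin n) ℂ)

lemma form_add_right (ξ η ζ : EuclideanSpace ℂ (Fin n)) :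
    form M ξ (η + ζ) = form M ξ η + form M ξ ζ := by
  simp [form, dotProduct_add]

lemma form_smul_right (c : ℂ) (ξ η : EuclideanSpace ℂ (Fin n)) :
    form M ξ (c • η) = star c * form M ξ η := by
  simp [form, dotProduct_smul]

lemma form_smul_left (c : ℂ) (ξ η : EuclideanSpace ℂ (Fin n)) :
    form M (c • ξ) η = c * form M ξ η := by
  simp [form, Matrix.mulVec_smul, smul_dotProduct]

lemma norm_form_le_of_unit {C : ℝ} (h : ∀ ξ η : EuclideanSpace ℂ (Fin n), ‖ξ‖ = 1 → ‖η‖ = 1 →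
    ‖form M ξ η‖ ≤ C) (ξ η : EuclideanSpace ℂ (Fin n)) : ‖form M ξ η‖ ≤ C * ‖ξ‖ * ‖η‖ := by
  rcases eq_or_ne ξ 0 with rfl | hξ
  · simp [form]
  rcases eq_or_ne η 0 with rfl | hη
  · simp [form]
  have hunit := h _ _ (norm_smul_inv_norm (𝕜 := ℂ) hξ) (norm_smul_inv_norm (𝕜 := ℂ) hη)
  rw [form_smul_left, form_smul_right, norm_mul, norm_mul, norm_star, norm_inv, norm_inv,
    RCLike.norm_ofReal, RCLike.norm_ofReal, abs_norm, abs_norm] at hunit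
  rw [mul_left_comm, inv_mul_le_iff₀ (norm_pos_iff.2 hη), inv_mul_le_iff₀ (norm_pos_iff.2 hξ)]
    at hunit
  linarith

variable {M}

lemma re_form_sq_smul_add_ge {δ : ℝ} (hδ : 0 < δ) {ξ w : EuclideanSpace ℂ (Fin n)}
    (hb : ‖form M ξ w‖ ≤ δ⁻¹ * ‖ξ‖ * ‖w‖) (hc : δ * ‖ξ‖ ^ 2 ≤ (form M ξ ξ).re)
    (c : ℝ) (v : ℂ) :
    δ / 2 * ‖c • ξ‖ ^ 2 - 2 / δ ^ 3 * ‖v • w‖ ^ 2 ≤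
      (form M ξ (c ^ 2 • ξ + v • (((2 * c : ℝ) : ℂ) • w))).re := by
  have hdiag : δ * ‖c • ξ‖ ^ 2 ≤ (form M ξ (c ^ 2 • ξ)).re := by
    rw [← Complex.coe_smul (c ^ 2), form_smul_right, Complex.star_def, Complex.conj_ofReal,
      Complex.re_ofReal_mul, norm_smul, mul_pow, Real.norm_eq_abs, sq_abs, mul_left_comm]
    gcongr
  have hcross : ‖form M ξ (v • (((2 * c : ℝ) : ℂ) • w))‖ ≤ 2 / δ * (‖c • ξ‖ * ‖v • w‖) := by
    calc ‖form M ξ (v • (((2 * c : ℝ) : ℂ) • w))‖ = ‖v‖ * (2 * |c| * ‖form M ξ w‖) := by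
          rw [form_smul_right, form_smul_right, norm_mul, norm_mul, norm_star, norm_star,
            Complex.norm_real, Real.norm_eq_abs, abs_mul, abs_two]
      _ ≤ ‖v‖ * (2 * |c| * (δ⁻¹ * ‖ξ‖ * ‖w‖)) := by gcongr
      _ = 2 / δ * (‖c • ξ‖ * ‖v • w‖) := by
          rw [norm_smul, norm_smul, Real.norm_eq_abs]
          ring
  have hyoung : 2 / δ * (‖c • ξ‖ * ‖v • w‖) ≤
      δ / 2 * ‖c • ξ‖ ^ 2 + 2 / δ ^ 3 * ‖v • w‖ ^ 2 := by
    have hsq : 0 ≤ δ / 2 * (‖c • ξ‖ - 2 / δ ^ 2 * ‖v • w‖) ^ 2 := by positivity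
    refine sub_nonneg.1 (hsq.trans_eq ?_)
    field
  rw [form_add_right, Complex.add_re]
  linarith [(abs_le.1 ((Complex.abs_re_le_norm _).trans hcross)).1]

variable {Ω : Set (Fin n → ℝ)} {A : (Fin n → ℝ) → Matrix (Fin n) (Fin n) ℂ} {δ : ℝ}

lemma IsElliptic.ae_norm_form_le (hA : IsElliptic δ A) :
    ∀ᵐ x ∂(volume.restrict Ω), ∀ ξ η, ‖form (A x) ξ η‖ ≤ δ⁻¹ * ‖ξ‖ * ‖η‖ := by
  filter_upwards [ae_restrict_of_ae hA.bounded] with x hx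
  exact norm_form_le_of_unit _ hx

lemma IsElliptic.integrable_form (hA : IsElliptic δ A) (G H : L2Vec Ω) :
    Integrable (fun x => form (A x) (G x) (H x)) (volume.restrict Ω) := by
  have hcoord (F : L2Vec Ω) (i : Fin n) :
      AEStronglyMeasurable (fun x => F x i) (volume.restrict Ω) :=
    ((Lp.memLp F).continuousLinearMap_comp (EuclideanSpace.proj (𝕜 := ℂ) i)).1
  have hbound : Integrable (fun x => δ⁻¹ * (‖G x‖ * ‖H x‖)) (volume.restrict Ω) :=
    ((Lp.memLp G).norm.integrable_mul (Lp.memLp H).norm).const_mul _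
  refine hbound.mono' ?_ ?_
  · simp only [form, dotProduct, Matrix.mulVec]
    exact Finset.aestronglyMeasurable_fun_sum _ fun i _ =>
      (Finset.aestronglyMeasurable_fun_sum _ fun j _ =>
        (hA.measurable i j).aestronglyMeasurable.mul (hcoord G j)).mul
      (continuous_star.comp_aestronglyMeasurable (hcoord H i))
  · filter_upwards [hA.ae_norm_form_le] with x hx
    exact (hx _ _).trans_eq (mul_assoc _ _ _)

lemma inner_mulOp_mulOp {χ : (Fin n → ℝ) → ℝ} (hχ : IsCutoff χ) (u w : L2 Ω) :
    inner ℂ (mulOp hχ.memLp u) (mulOp hχ.memLp w) = inner ℂ (mulOp hχ.sq.memLp u) w := by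
  rw [L2.inner_def, L2.inner_def]
  refine integral_congr_ae ?_
  filter_upwards [coeFn_mulOp hχ.memLp u, coeFn_mulOp hχ.memLp w, coeFn_mulOp hχ.sq.memLp u]
    with x hu hw hu'
  rw [hu, hw, hu', inner_smul_left_eq_smul, inner_smul_right_eq_smul, inner_smul_left_eq_smul,
    smul_smul, pow_two]

namespace IsDivFormOperator

variable {u w : L2 Ω}

lemma inner_eq_integral_form (h : IsDivFormOperator A (sobolevW0 Ω) u w) {g : L2 Ω}
    (hg : g ∈ sobolevW0 Ω) :
    inner ℂ g w = ∫ x in Ω, form (A x) (weakGrad u x) (weakGrad g x) := by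
  rw [L2.inner_def]
  exact (h.2 g hg).symm

lemma caccioppoli (h : IsDivFormOperator A (sobolevW0 Ω) u w) (hΩ : IsOpen Ω)
    (hA : IsElliptic δ A) (hδ : 0 < δ) {χ : (Fin n → ℝ) → ℝ} (hχ : IsCutoff χ) :
    δ / 2 * ‖mulOp hχ.memLp (weakGrad u)‖ ^ 2 - 2 / δ ^ 3 * ‖mulVecOp hχ.memLp_grad u‖ ^ 2 ≤
      (inner ℂ (mulOp hχ.memLp u) (mulOp hχ.memLp w)).re := by
  obtain ⟨hmem, hgrad⟩ := hχ.sq.mulOp_mem_sobolevW0 hΩ h.1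
  have hform := hA.integrable_form (weakGrad u) (weakGrad (mulOp hχ.sq.memLp u))
  have hl := (integrable_norm_sq (mulOp hχ.memLp (weakGrad u))).const_mul (δ / 2)
  have hr := (integrable_norm_sq (mulVecOp hχ.memLp_grad u)).const_mul (2 / δ ^ 3)
  rw [inner_mulOp_mulOp hχ, h.inner_eq_integral_form hmem, norm_sq_eq_integral, norm_sq_eq_integral,
    ← integral_const_mul, ← integral_const_mul, ← integral_sub hl hr]
  refine (integral_mono_ae (hl.sub hr) hform.re ?_).trans_eq (integral_re hform)
  rw [hgrad]
  filter_upwards [hA.ae_norm_form_le, coeFn_mulOp hχ.memLp (weakGrad u),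
    coeFn_mulVecOp hχ.memLp_grad u, coeFn_mulOp hχ.sq.memLp (weakGrad u),
    coeFn_mulVecOp hχ.sq.memLp_grad u, Lp.coeFn_add (mulOp hχ.sq.memLp (weakGrad u))
      (mulVecOp hχ.sq.memLp_grad u)] with x hbound hmul hvec hmul' hvec' hadd
  rw [Pi.sub_apply, hmul, hvec, hadd, Pi.add_apply, hmul', hvec', hχ.realGrad_sq]
  exact re_form_sq_smul_add_ge hδ (hbound _ _) (hA.coercive x _) _ _

lemma norm_weakGrad_sq_le (h : IsDivFormOperator A (sobolevW0 Ω) u w) (hA : IsElliptic δ A) :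
    δ * ‖weakGrad u‖ ^ 2 ≤ ‖w‖ * ‖u‖ := by
  have hform := hA.integrable_form (weakGrad u) (weakGrad u)
  calc δ * ‖weakGrad u‖ ^ 2 = ∫ x in Ω, δ * ‖weakGrad u x‖ ^ 2 := by
        rw [norm_sq_eq_integral, integral_const_mul]
    _ ≤ ∫ x in Ω, (form (A x) (weakGrad u x) (weakGrad u x)).re :=
        integral_mono ((integrable_norm_sq _).const_mul _) hform.re fun x => hA.coercive x _
    _ = (inner ℂ u w).re := by
        rw [h.inner_eq_integral_form h.1]
        exact integral_re hform
    _ ≤ ‖w‖ * ‖u‖ := by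
        rw [mul_comm]
        exact (Complex.re_le_norm _).trans (norm_inner_le_norm u w)

end IsDivFormOperator

end Form

section Energy

lemma tendsto_lintegral_enorm_sq_comp {α E F : Type*} {m : MeasurableSpace α} {μ : Measure α}
    [NormedAddCommGroup E] [NormedSpace ℝ E] [NormedAddCommGroup F] [NormedSpace ℝ F]
    (L : E →L[ℝ] F) {G : ℕ → α → E} {G₀ : α → E} (hG : ∀ k, MemLp (G k) 2 μ) (hG₀ : MemLp G₀ 2 μ)
    (hlim : Tendsto (fun k => eLpNorm (G k - G₀) 2 μ) atTop (𝓝 0)) :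
    Tendsto (fun k => ∫⁻ s, ‖L (G k s)‖ₑ ^ 2 ∂μ) atTop (𝓝 (∫⁻ s, ‖L (G₀ s)‖ₑ ^ 2 ∂μ)) := by
  have hL {H : α → E} (hH : MemLp H 2 μ) :
      ∫⁻ s, ‖L (H s)‖ₑ ^ 2 ∂μ = ‖L.compLpL 2 μ hH.toLp‖ₑ ^ 2 := by
    rw [enorm_sq_eq_lintegral]
    refine lintegral_congr_ae ?_
    filter_upwards [L.coeFn_compLpL hH.toLp, hH.coeFn_toLp] with s hs hs'
    rw [hs, hs']
  simp only [hL (hG _), hL hG₀]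
  have htoLp := (Lp.tendsto_Lp_iff_tendsto_eLpNorm'' G hG G₀ hG₀).2 hlim
  exact ((ENNReal.continuous_pow 2).tendsto _).comp
    (((L.compLpL 2 μ).continuous.tendsto _).comp htoLp).enorm

lemma lintegral_Ioc_enorm_sq_eq_ofReal {E : Type*} [NormedAddCommGroup E] {F : ℝ → E} {a b : ℝ}
    (hab : a ≤ b) (hF : ContinuousOn F (Icc a b)) :
    ∫⁻ s in Ioc a b, ‖F s‖ₑ ^ 2 = ENNReal.ofReal (∫ s in a..b, ‖F s‖ ^ 2) := by
  have hint : IntegrableOn (fun s => ‖F s‖ ^ 2) (Ioc a b) :=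
    ((hF.norm.pow 2).integrableOn_Icc).mono_set Ioc_subset_Icc_self
  rw [intervalIntegral.integral_of_le hab, ofReal_integral_eq_lintegral_ofReal hint
    (Eventually.of_forall fun s => sq_nonneg _)]
  exact lintegral_congr fun s => enorm_sq_eq_ofReal _

variable {n : ℕ} {Ω : Set (Fin n → ℝ)} {A : (Fin n → ℝ) → Matrix (Fin n) (Fin n) ℂ} {δ : ℝ}
  {T : ℝ → L2 Ω →L[ℂ] L2 Ω} {u w : L2 Ω} {χ : (Fin n → ℝ) → ℝ} {a b : ℝ}

lemma mulOp_one {E : Type*} [NormedAddCommGroup E] [NormedSpace ℝ E]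
    (hg : MemLp (fun _ : Fin n → ℝ => (1 : ℝ)) ∞ (volume.restrict Ω))
    (u : Lp E 2 (volume.restrict Ω)) : mulOp hg u = u := by
  refine Lp.ext ?_
  filter_upwards [coeFn_mulOp hg u] with x hx
  rw [hx, one_smul]

lemma mulVecOp_grad_const (c : ℝ) (u : L2 Ω) :
    mulVecOp (IsCutoff.const (n := n) c).memLp_grad u = 0 := by
  refine Lp.ext ?_
  filter_upwards [coeFn_mulVecOp (IsCutoff.const (n := n) c).memLp_grad u,
    Lp.coeFn_zero (EuclideanSpace ℂ (Fin n)) 2 (volume.restrict Ω)] with x hx hzero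
  rw [hx, hzero, realGrad_const, smul_zero, Pi.zero_apply]

lemma re_inner_mulOp (hχ : MemLp χ ∞ (volume.restrict Ω)) (u w : L2 Ω) :
    inner ℝ (mulOp hχ u) (mulOp hχ w) = (inner ℂ (mulOp hχ u) (mulOp hχ w)).re := by
  rw [L2.inner_def, L2.inner_def]
  exact integral_re (L2.integrable_inner _ _)

namespace IsSemigroupGeneratedByNeg

lemma continuousOn_weakGrad (hT : IsSemigroupGeneratedByNeg (IsDivFormOperator A (sobolevW0 Ω)) T)
    (hΩ : IsOpen Ω) (hA : IsElliptic δ A) (hδ : 0 < δ)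
    (h : IsDivFormOperator A (sobolevW0 Ω) u w) :
    ContinuousOn (fun s => weakGrad (T s u)) (Ici 0) := by
  intro s hs
  have htendsto (v : L2 Ω) : Tendsto (fun r => T r v - T s v) (𝓝[Ici 0] s) (𝓝 0) := by
    simpa using (hT.continuous v s hs).sub_const (T s v)
  have hsqrt : Tendsto (fun r => √(‖T r w - T s w‖ * ‖T r u - T s u‖ / δ)) (𝓝[Ici 0] s) (𝓝 0) := by
    simpa using (((htendsto w).norm.mul (htendsto u).norm).div_const δ).sqrt
  rw [ContinuousWithinAt, tendsto_iff_norm_sub_tendsto_zero]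
  refine squeeze_zero' (Eventually.of_forall fun _ => norm_nonneg _) ?_ hsqrt
  filter_upwards [self_mem_nhdsWithin] with r hr
  have hTr := hT.generator_map h (mem_Ici.1 hr)
  have hTs := hT.generator_map h (mem_Ici.1 hs)
  rw [← (sub_mem_sobolevW0 hΩ hTr.1 hTs.1).2]
  refine Real.le_sqrt_of_sq_le ?_
  rw [le_div_iff₀' hδ]
  exact (hT.generator_sub hTr hTs).norm_weakGrad_sq_le hA

lemma norm_sq_mulOp_sub_le_integral
    (hT : IsSemigroupGeneratedByNeg (IsDivFormOperator A (sobolevW0 Ω)) T)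
    (hΩ : IsOpen Ω) (hA : IsElliptic δ A) (hδ : 0 < δ)
    (h : IsDivFormOperator A (sobolevW0 Ω) u w) (hχ : IsCutoff χ) (ha : 0 ≤ a) (hab : a ≤ b) :
    ‖mulOp hχ.memLp (T b u)‖ ^ 2 - ‖mulOp hχ.memLp (T a u)‖ ^ 2 ≤
      4 / δ ^ 3 * (∫ s in a..b, ‖mulVecOp hχ.memLp_grad (T s u)‖ ^ 2) -
        δ * ∫ s in a..b, ‖mulOp hχ.memLp (weakGrad (T s u))‖ ^ 2 := by
  have hsub : Icc a b ⊆ Ici 0 := fun s hs => ha.trans hs.1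
  have hcont := (hT.continuous u).mono hsub
  have hvec : ContinuousOn (fun s => ‖mulVecOp hχ.memLp_grad (T s u)‖ ^ 2) (Icc a b) :=
    ((mulVecOp hχ.memLp_grad).continuous.comp_continuousOn hcont).norm.pow 2
  have hgrad : ContinuousOn (fun s => ‖mulOp hχ.memLp (weakGrad (T s u))‖ ^ 2) (Icc a b) :=
    ((mulOp hχ.memLp).continuous.comp_continuousOn
      ((hT.continuousOn_weakGrad hΩ hA hδ h).mono hsub)).norm.pow 2
  rw [← intervalIntegral.integral_const_mul, ← intervalIntegral.integral_const_mul,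
    ← intervalIntegral.integral_sub ((hvec.intervalIntegrable_of_Icc hab).const_mul _)
      ((hgrad.intervalIntegrable_of_Icc hab).const_mul _)]
  refine intervalIntegral.sub_le_integral_of_hasDeriv_right_of_le hab
    (g := fun s => ‖mulOp hχ.memLp (T s u)‖ ^ 2)
    (g' := fun s => 2 * inner ℝ (mulOp hχ.memLp (T s u)) (mulOp hχ.memLp (-T s w)))
    (((mulOp hχ.memLp).continuous.comp_continuousOn hcont).norm.pow 2) (fun s hs => ?_)
    ((hvec.const_mul _).sub (hgrad.const_mul _)).integrableOn_Icc fun s hs => ?_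
  · exact ((mulOp hχ.memLp).hasFDerivAt.comp_hasDerivWithinAt s
      (hT.hasDerivWithinAt h (ha.trans hs.1.le))).norm_sq
  · have hcacc := (hT.generator_map h (ha.trans hs.1.le)).caccioppoli hΩ hA hδ hχ
    rw [map_neg, inner_neg_right, re_inner_mulOp]
    linear_combination 2 * hcacc

lemma energy_le_of_mem_domain
    (hT : IsSemigroupGeneratedByNeg (IsDivFormOperator A (sobolevW0 Ω)) T)
    (hΩ : IsOpen Ω) (hA : IsElliptic δ A) (hδ : 0 < δ)
    (h : IsDivFormOperator A (sobolevW0 Ω) u w) (hχ : IsCutoff χ) (ha : 0 ≤ a) (hab : a ≤ b) :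
    ENNReal.ofReal δ * (∫⁻ s in Ioc a b, ‖mulOp hχ.memLp (weakGrad (T s u))‖ₑ ^ 2) +
        ‖mulOp hχ.memLp (T b u)‖ₑ ^ 2 ≤
      ‖mulOp hχ.memLp (T a u)‖ₑ ^ 2 +
        ENNReal.ofReal (4 / δ ^ 3) * ∫⁻ s in Ioc a b, ‖mulVecOp hχ.memLp_grad (T s u)‖ₑ ^ 2 := by
  have hsub : Icc a b ⊆ Ici 0 := fun s hs => ha.trans hs.1
  have hnonneg {E : Type} [NormedAddCommGroup E] (F : ℝ → E) : 0 ≤ ∫ s in a..b, ‖F s‖ ^ 2 :=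
    intervalIntegral.integral_nonneg hab fun s _ => sq_nonneg _
  have hgrad : ContinuousOn (fun s => mulOp hχ.memLp (weakGrad (T s u))) (Icc a b) :=
    (mulOp hχ.memLp).continuous.comp_continuousOn
      ((hT.continuousOn_weakGrad hΩ hA hδ h).mono hsub)
  have hvec : ContinuousOn (fun s => mulVecOp hχ.memLp_grad (T s u)) (Icc a b) :=
    (mulVecOp hχ.memLp_grad).continuous.comp_continuousOn ((hT.continuous u).mono hsub)
  rw [lintegral_Ioc_enorm_sq_eq_ofReal hab hgrad, lintegral_Ioc_enorm_sq_eq_ofReal hab hvec,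
    enorm_sq_eq_ofReal, enorm_sq_eq_ofReal,
    ← ENNReal.ofReal_mul hδ.le, ← ENNReal.ofReal_mul (by positivity),
    ← ENNReal.ofReal_add (mul_nonneg hδ.le (hnonneg _)) (sq_nonneg _),
    ← ENNReal.ofReal_add (sq_nonneg _) (mul_nonneg (by positivity) (hnonneg _))]
  refine ENNReal.ofReal_le_ofReal ?_
  linarith [hT.norm_sq_mulOp_sub_le_integral hΩ hA hδ h hχ ha hab]

lemma global_energy_le_of_mem_domain
    (hT : IsSemigroupGeneratedByNeg (IsDivFormOperator A (sobolevW0 Ω)) T)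
    (hΩ : IsOpen Ω) (hA : IsElliptic δ A) (hδ : 0 < δ)
    (h : IsDivFormOperator A (sobolevW0 Ω) u w) (hb : 0 ≤ b) :
    ENNReal.ofReal δ * (∫⁻ s in Ioc 0 b, ‖weakGrad (T s u)‖ₑ ^ 2) + ‖T b u‖ₑ ^ 2 ≤ ‖u‖ₑ ^ 2 := by
  simpa [mulOp_one, mulVecOp_grad_const, hT.zero] using
    hT.energy_le_of_mem_domain hΩ hA hδ h (IsCutoff.const 1) le_rfl hb

lemma norm_apply_le (hT : IsSemigroupGeneratedByNeg (IsDivFormOperator A (sobolevW0 Ω)) T)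
    (hΩ : IsOpen Ω) (hA : IsElliptic δ A) (hδ : 0 < δ) (hb : 0 ≤ b) (f : L2 Ω) :
    ‖T b f‖ ≤ ‖f‖ := by
  obtain ⟨u, w, hL, hu⟩ := hT.exists_seq_tendsto f
  refine le_of_tendsto_of_tendsto' (((T b).continuous.tendsto f).comp hu).norm hu.norm fun k => ?_
  have hsq : ‖T b (u k)‖ₑ ^ 2 ≤ ‖u k‖ₑ ^ 2 :=
    le_add_self.trans (hT.global_energy_le_of_mem_domain hΩ hA hδ (hL k) hb)
  exact enorm_le_iff_norm_le.1 ((ENNReal.pow_le_pow_left_iff two_ne_zero).1 hsq)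

lemma eLpNorm_weakGrad_sq_le_of_mem_domain
    (hT : IsSemigroupGeneratedByNeg (IsDivFormOperator A (sobolevW0 Ω)) T)
    (hΩ : IsOpen Ω) (hA : IsElliptic δ A) (hδ : 0 < δ)
    (h : IsDivFormOperator A (sobolevW0 Ω) u w) :
    ENNReal.ofReal δ * eLpNorm (fun s => weakGrad (T s u)) 2 (volume.restrict (Ioi 0)) ^ 2 ≤
      ‖u‖ₑ ^ 2 := by
  have hIoi : Ioi (0 : ℝ) = ⋃ k : ℕ, Ioc 0 (k : ℝ) :=
    (iUnion_Ioc_eq_Ioi_self_iff.2 fun s _ => exists_nat_ge s).symm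
  have hmono : Monotone fun k : ℕ => Ioc 0 (k : ℝ) := fun k l hkl =>
    Ioc_subset_Ioc_right (Nat.cast_le.2 hkl)
  rw [eLpNorm_two_sq_eq_lintegral, hIoi, setLIntegral_iUnion_of_directed _ hmono.directed_le,
    ENNReal.mul_iSup]
  exact iSup_le fun k => le_self_add.trans
    (hT.global_energy_le_of_mem_domain hΩ hA hδ h (Nat.cast_nonneg k))

lemma memLp_weakGrad_of_mem_domain
    (hT : IsSemigroupGeneratedByNeg (IsDivFormOperator A (sobolevW0 Ω)) T)
    (hΩ : IsOpen Ω) (hA : IsElliptic δ A) (hδ : 0 < δ)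
    (h : IsDivFormOperator A (sobolevW0 Ω) u w) :
    MemLp (fun s => weakGrad (T s u)) 2 (volume.restrict (Ioi 0)) := by
  refine ⟨((hT.continuousOn_weakGrad hΩ hA hδ h).mono
    Ioi_subset_Ici_self).aestronglyMeasurable measurableSet_Ioi, lt_top_iff_ne_top.2 fun htop => ?_⟩
  have hle := hT.eLpNorm_weakGrad_sq_le_of_mem_domain hΩ hA hδ h
  rw [htop, ENNReal.top_pow two_ne_zero, ENNReal.mul_top (ENNReal.ofReal_pos.2 hδ).ne',
    top_le_iff] at hle
  exact ENNReal.pow_ne_top enorm_ne_top hle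

lemma dist_weakGrad_sq_le (hT : IsSemigroupGeneratedByNeg (IsDivFormOperator A (sobolevW0 Ω)) T)
    (hΩ : IsOpen Ω) (hA : IsElliptic δ A) (hδ : 0 < δ) {u' w' : L2 Ω}
    (h : IsDivFormOperator A (sobolevW0 Ω) u w) (h' : IsDivFormOperator A (sobolevW0 Ω) u' w') :
    δ * dist (hT.memLp_weakGrad_of_mem_domain hΩ hA hδ h).toLp
      (hT.memLp_weakGrad_of_mem_domain hΩ hA hδ h').toLp ^ 2 ≤ ‖u - u'‖ ^ 2 := by
  have hle := hT.eLpNorm_weakGrad_sq_le_of_mem_domain hΩ hA hδ (hT.generator_sub h h')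
  have hsub : eLpNorm (fun s => weakGrad (T s (u - u'))) 2 (volume.restrict (Ioi 0)) =
      edist (hT.memLp_weakGrad_of_mem_domain hΩ hA hδ h).toLp
        (hT.memLp_weakGrad_of_mem_domain hΩ hA hδ h').toLp := by
    rw [Lp.edist_toLp_toLp]
    refine eLpNorm_congr_ae ?_
    filter_upwards [ae_restrict_mem measurableSet_Ioi] with s hs
    rw [map_sub]
    exact (sub_mem_sobolevW0 hΩ (hT.generator_map h (le_of_lt hs)).1
      (hT.generator_map h' (le_of_lt hs)).1).2
  rw [hsub, edist_dist, ← ENNReal.ofReal_pow dist_nonneg, ← ENNReal.ofReal_mul hδ.le,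
    enorm_sq_eq_ofReal] at hle
  exact (ENNReal.ofReal_le_ofReal_iff (sq_nonneg _)).1 hle

lemma exists_seq_tendsto_eLpNorm_weakGrad
    (hT : IsSemigroupGeneratedByNeg (IsDivFormOperator A (sobolevW0 Ω)) T)
    (hΩ : IsOpen Ω) (hA : IsElliptic δ A) (hδ : 0 < δ) (f : L2 Ω) :
    ∃ u w : ℕ → L2 Ω, (∀ k, IsDivFormOperator A (sobolevW0 Ω) (u k) (w k)) ∧
      Tendsto u atTop (𝓝 f) ∧ MemLp (fun s => weakGrad (T s f)) 2 (volume.restrict (Ioi 0)) ∧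
      Tendsto (fun k => eLpNorm (fun s => weakGrad (T s (u k)) - weakGrad (T s f)) 2
        (volume.restrict (Ioi 0))) atTop (𝓝 0) := by
  obtain ⟨u, w, hL, hu⟩ := hT.exists_seq_tendsto f
  have hmem (k) := hT.memLp_weakGrad_of_mem_domain hΩ hA hδ (hL k)
  obtain ⟨G, hG⟩ : ∃ G, Tendsto (fun k => (hmem k).toLp) atTop (𝓝 G) := by
    refine cauchySeq_tendsto_of_complete (cauchySeq_iff_tendsto_dist_atTop_0.2 ?_)
    have hdist : Tendsto (fun p : ℕ × ℕ => √(‖u p.1 - u p.2‖ ^ 2 / δ)) atTop (𝓝 0) := by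
      simpa [dist_eq_norm] using
        (((cauchySeq_iff_tendsto_dist_atTop_0.1 hu.cauchySeq).pow 2).div_const δ).sqrt
    refine squeeze_zero (fun _ => dist_nonneg) (fun p => ?_) hdist
    exact Real.le_sqrt_of_sq_le ((le_div_iff₀' hδ).2
      (hT.dist_weakGrad_sq_le hΩ hA hδ (hL p.1) (hL p.2)))
  have hG_eq : G =ᵐ[volume.restrict (Ioi 0)] fun s => weakGrad (T s f) := by
    obtain ⟨φ, hφ, hae⟩ := (tendstoInMeasure_of_tendsto_Lp hG).exists_seq_tendsto_ae
    filter_upwards [hae, ae_all_iff.2 fun k => (hmem k).coeFn_toLp,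
      ae_restrict_mem measurableSet_Ioi] with s hs hcoe hpos
    simp only [hcoe] at hs
    exact (mem_sobolevW0_of_tendsto hΩ
      (fun k => (hT.generator_map (hL (φ k)) (le_of_lt hpos)).1)
      (((T s).continuous.tendsto f).comp (hu.comp hφ.tendsto_atTop)) hs).2.symm
  have hmemf := (memLp_congr_ae hG_eq).1 (Lp.memLp G)
  refine ⟨u, w, hL, hu, hmemf, ?_⟩
  refine (Lp.tendsto_Lp_iff_tendsto_eLpNorm'' _ hmem _ hmemf).1 ?_
  rwa [(Lp.toLp_coeFn G (Lp.memLp G)).symm.trans ((MemLp.toLp_eq_toLp_iff _ hmemf).2 hG_eq)] at hG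

lemma memLp_weakGrad (hT : IsSemigroupGeneratedByNeg (IsDivFormOperator A (sobolevW0 Ω)) T)
    (hΩ : IsOpen Ω) (hA : IsElliptic δ A) (hδ : 0 < δ) (f : L2 Ω) :
    MemLp (fun s => weakGrad (T s f)) 2 (volume.restrict (Ioi 0)) := by
  obtain ⟨_, _, _, _, hmem, _⟩ := hT.exists_seq_tendsto_eLpNorm_weakGrad hΩ hA hδ f
  exact hmem

lemma tendsto_eLpNorm_apply_sub
    (hT : IsSemigroupGeneratedByNeg (IsDivFormOperator A (sobolevW0 Ω)) T)
    (hΩ : IsOpen Ω) (hA : IsElliptic δ A) (hδ : 0 < δ) {u : ℕ → L2 Ω} {f : L2 Ω}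
    (hu : Tendsto u atTop (𝓝 f)) (ha : 0 ≤ a) :
    Tendsto (fun k => eLpNorm (fun s => T s (u k) - T s f) 2 (volume.restrict (Ioc a b)))
      atTop (𝓝 0) := by
  have hle (k : ℕ) : eLpNorm (fun s => T s (u k) - T s f) 2 (volume.restrict (Ioc a b)) ≤
      (volume.restrict (Ioc a b)) univ ^ (2 : ℝ≥0∞).toReal⁻¹ * ENNReal.ofReal ‖u k - f‖ := by
    refine eLpNorm_le_of_ae_bound ?_
    filter_upwards [ae_restrict_mem measurableSet_Ioc] with s hs
    rw [← map_sub]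
    exact hT.norm_apply_le hΩ hA hδ (ha.trans hs.1.le) _
  refine tendsto_of_tendsto_of_tendsto_of_le_of_le tendsto_const_nhds ?_ (fun _ => zero_le) hle
  have hlim := ENNReal.Tendsto.const_mul
    (a := (volume.restrict (Ioc a b)) univ ^ (2 : ℝ≥0∞).toReal⁻¹)
    (ENNReal.tendsto_ofReal (tendsto_iff_norm_sub_tendsto_zero.1 hu))
    (Or.inr (ENNReal.rpow_ne_top_of_nonneg (by positivity) (measure_ne_top _ _)))
  simpa using hlim

theorem energy_le (hT : IsSemigroupGeneratedByNeg (IsDivFormOperator A (sobolevW0 Ω)) T)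
    (hΩ : IsOpen Ω) (hA : IsElliptic δ A) (hδ : 0 < δ) (f : L2 Ω) (hχ : IsCutoff χ)
    (ha : 0 ≤ a) (hab : a ≤ b) :
    ENNReal.ofReal δ * (∫⁻ s in Ioc a b, ‖mulOp hχ.memLp (weakGrad (T s f))‖ₑ ^ 2) +
        ‖mulOp hχ.memLp (T b f)‖ₑ ^ 2 ≤
      ‖mulOp hχ.memLp (T a f)‖ₑ ^ 2 +
        ENNReal.ofReal (4 / δ ^ 3) * ∫⁻ s in Ioc a b, ‖mulVecOp hχ.memLp_grad (T s f)‖ₑ ^ 2 := by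
  obtain ⟨u, w, hL, hu, hmemf, hlim⟩ := hT.exists_seq_tendsto_eLpNorm_weakGrad hΩ hA hδ f
  have hle : volume.restrict (Ioc a b) ≤ volume.restrict (Ioi 0) :=
    Measure.restrict_mono_set _ fun s hs => ha.trans_lt hs.1
  have hmemT (v : L2 Ω) : MemLp (fun s => T s v) 2 (volume.restrict (Ioc a b)) := by
    refine MemLp.of_bound (((hT.continuous v).mono fun s hs =>
      ha.trans hs.1.le).aestronglyMeasurable measurableSet_Ioc) ‖v‖ ?_
    filter_upwards [ae_restrict_mem measurableSet_Ioc] with s hs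
    exact hT.norm_apply_le hΩ hA hδ (ha.trans hs.1.le) v
  have hgrad := tendsto_lintegral_enorm_sq_comp (mulOp hχ.memLp)
    (fun k => (hT.memLp_weakGrad_of_mem_domain hΩ hA hδ (hL k)).mono_measure hle)
    (hmemf.mono_measure hle) (tendsto_of_tendsto_of_tendsto_of_le_of_le tendsto_const_nhds hlim
      (fun _ => zero_le) fun _ => eLpNorm_mono_measure _ hle)
  have hvec := tendsto_lintegral_enorm_sq_comp (mulVecOp hχ.memLp_grad) (fun k => hmemT (u k))
    (hmemT f) (hT.tendsto_eLpNorm_apply_sub hΩ hA hδ hu ha)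
  have hend (s : ℝ) : Tendsto (fun k => ‖mulOp hχ.memLp (T s (u k))‖ₑ ^ 2) atTop
      (𝓝 (‖mulOp hχ.memLp (T s f)‖ₑ ^ 2)) :=
    ((ENNReal.continuous_pow 2).tendsto _).comp
      ((((mulOp hχ.memLp).continuous.comp (T s).continuous).tendsto f).comp hu).enorm
  exact le_of_tendsto_of_tendsto'
    ((ENNReal.Tendsto.const_mul hgrad (Or.inr ENNReal.ofReal_ne_top)).add (hend b))
    ((hend a).add (ENNReal.Tendsto.const_mul hvec (Or.inr ENNReal.ofReal_ne_top)))
    fun k => hT.energy_le_of_mem_domain hΩ hA hδ (hL k) hχ ha hab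

end IsSemigroupGeneratedByNeg

end Energy

section Cutoff

open Metric

lemma lipschitzWith_bump_convolution {F : Type*} [NormedAddCommGroup F] [NormedSpace ℝ F]
    [FiniteDimensional ℝ F] [MeasurableSpace F] [BorelSpace F] {μ : Measure F} [μ.IsAddHaarMeasure]
    {g : F → ℝ} {K : ℝ≥0} (hg : LipschitzWith K g) (φ : ContDiffBump (0 : F)) :
    LipschitzWith K (convolution (φ.normed μ) g (ContinuousLinearMap.lsmul ℝ ℝ) μ) := by
  have hint (x : F) : Integrable (fun t => φ.normed μ t * g (x - t)) μ :=
    φ.hasCompactSupport_normed.convolutionExists_left (ContinuousLinearMap.lsmul ℝ ℝ)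
      φ.continuous_normed hg.continuous.locallyIntegrable x
  refine LipschitzWith.of_dist_le_mul fun x y => ?_
  calc dist (∫ t, φ.normed μ t * g (x - t) ∂μ) (∫ t, φ.normed μ t * g (y - t) ∂μ)
      = ‖∫ t, φ.normed μ t * (g (x - t) - g (y - t)) ∂μ‖ := by
        rw [dist_eq_norm, ← integral_sub (hint x) (hint y)]
        simp_rw [mul_sub]
    _ ≤ ∫ t, φ.normed μ t * (K * dist x y) ∂μ := by
        refine norm_integral_le_of_norm_le (φ.integrable_normed.mul_const _)
          (Eventually.of_forall fun t => ?_)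
        rw [norm_mul, Real.norm_of_nonneg (φ.nonneg_normed t), ← dist_eq_norm]
        gcongr
        · exact φ.nonneg_normed t
        · simpa using hg.dist_le_mul (x - t) (y - t)
    _ = K * dist x y := by rw [integral_mul_const, φ.integral_normed, one_mul]

lemma exists_contDiff_lipschitzWith_cutoff {F : Type*} [NormedAddCommGroup F] [NormedSpace ℝ F]
    [FiniteDimensional ℝ F] (E : Set F) {r : ℝ} (hr : 0 < r) :
    ∃ χ : F → ℝ, ContDiff ℝ ∞ χ ∧ LipschitzWith (r / 4).toNNReal⁻¹ χ ∧ (∀ x, ‖χ x‖ ≤ 1) ∧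
      (∀ x ∈ thickening r E, χ x = 1) ∧ tsupport χ ⊆ thickening (2 * r) E := by
  borelize F
  let φ : ContDiffBump (0 : F) := ⟨r / 8, r / 4, by positivity, by linarith⟩
  have hr4 : 0 < r / 4 := by positivity
  let g : F → ℝ := fun x => thickenedIndicator hr4 (thickening (r + r / 4) E) x
  have hg : LipschitzWith (r / 4).toNNReal⁻¹ g := lipschitzWith_thickenedIndicator hr4 _
  let χ := convolution (φ.normed Measure.addHaar) g (ContinuousLinearMap.lsmul ℝ ℝ)
    Measure.addHaar
  have hone {x : F} (hx : x ∈ thickening r E) : ∀ y ∈ ball x φ.rOut, g y = 1 := fun y hy =>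
    congrArg NNReal.toReal <| thickenedIndicator_one hr4 _ <| by
      rw [add_comm]
      exact thickening_thickening_subset _ _ _ (mem_thickening_iff.2 ⟨x, hx, hy⟩)
  have hzero {x : F} (hx : x ∉ thickening (r / 4 + (r / 4 + (r + r / 4))) E) :
      ∀ y ∈ ball x φ.rOut, g y = 0 := fun y hy =>
    congrArg NNReal.toReal <| thickenedIndicator_zero hr4 _ fun hy' => hx <|
      thickening_thickening_subset _ _ _ (mem_thickening_iff.2
        ⟨y, thickening_thickening_subset _ _ _ hy', mem_ball'.1 hy⟩)
  have hχ {x : F} {c : ℝ} (hc : ∀ y ∈ ball x φ.rOut, g y = c) : χ x = c := by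
    have hcx := hc x (mem_ball_self φ.rOut_pos)
    exact (φ.normed_convolution_eq_right fun y hy => (hc y hy).trans hcx.symm).trans hcx
  refine ⟨χ, φ.hasCompactSupport_normed.contDiff_convolution_left _ φ.contDiff_normed
    hg.continuous.locallyIntegrable, lipschitzWith_bump_convolution hg φ, fun x => ?_,
    fun x hx => hχ (hone hx), ?_⟩
  · rw [← dist_zero_right]
    refine dist_convolution_le zero_le_one φ.support_normed_eq.subset φ.nonneg_normed
      φ.integral_normed hg.continuous.aestronglyMeasurable fun y _ => ?_
    rw [dist_zero_right, NNReal.norm_eq]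
    exact_mod_cast thickenedIndicator_le_one hr4 _ y
  · have hsupp : Function.support χ ⊆ thickening (r / 4 + (r / 4 + (r + r / 4))) E := fun x hx =>
      not_imp_comm.1 (fun hx' => hχ (hzero hx')) hx
    exact (closure_mono hsupp).trans ((closure_thickening_subset_cthickening _ _).trans
      (cthickening_subset_thickening' (by positivity) (by linarith) E))

variable {n : ℕ}

lemma realGrad_apply {χ : (Fin n → ℝ) → ℝ} {x : Fin n → ℝ} (h : DifferentiableAt ℝ χ x)
    (i : Fin n) : realGrad χ x i = (fderiv ℝ χ x (Pi.single i 1) : ℝ) := by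
  rw [realGrad, classicalGrad_apply]
  exact DFunLike.congr_fun (Complex.ofRealCLM.hasFDerivAt.comp x h.hasFDerivAt).fderiv _

lemma norm_realGrad_le {χ : (Fin n → ℝ) → ℝ} {x : Fin n → ℝ} (h : DifferentiableAt ℝ χ x) :
    ‖realGrad χ x‖ ≤ √n * ‖fderiv ℝ χ x‖ := by
  rw [EuclideanSpace.norm_eq, ← Real.sqrt_sq (norm_nonneg (fderiv ℝ χ x)),
    ← Real.sqrt_mul (Nat.cast_nonneg n)]
  refine Real.sqrt_le_sqrt ?_
  calc ∑ i, ‖realGrad χ x i‖ ^ 2 ≤ ∑ _i : Fin n, ‖fderiv ℝ χ x‖ ^ 2 := by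
        refine Finset.sum_le_sum fun i _ => ?_
        gcongr
        rw [realGrad_apply h, Complex.norm_real]
        refine ((fderiv ℝ χ x).le_opNorm _).trans_eq ?_
        rw [Pi.norm_single, norm_one, mul_one]
    _ = n * ‖fderiv ℝ χ x‖ ^ 2 := by simp

/-- `χ` is a cutoff function at scale `r` around `E`: it is `1` on the `r`-neighbourhood of `E`,
is supported in the `2r`-neighbourhood, and has gradient of size `O(1 / r)`. -/
structure IsCutoffAround (E : Set (Fin n → ℝ)) (r : ℝ) (χ : (Fin n → ℝ) → ℝ) : Prop
    extends IsCutoff χ where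
  norm_le_one : ∀ x, ‖χ x‖ ≤ 1
  eq_one : ∀ x ∈ thickening r E, χ x = 1
  tsupport_subset : tsupport χ ⊆ thickening (2 * r) E
  norm_realGrad_le : ∀ x, ‖realGrad χ x‖ ≤ 4 * √n / r

lemma exists_isCutoffAround (E : Set (Fin n → ℝ)) {r : ℝ} (hr : 0 < r) :
    ∃ χ, IsCutoffAround E r χ := by
  obtain ⟨χ, hsmooth, hlip, hle, hone, hsupp⟩ := exists_contDiff_lipschitzWith_cutoff E hr
  have hgrad (x : Fin n → ℝ) : ‖realGrad χ x‖ ≤ 4 * √n / r := by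
    calc ‖realGrad χ x‖ ≤ √n * ‖fderiv ℝ χ x‖ :=
          norm_realGrad_le (hsmooth.differentiable (by simp) x)
      _ ≤ √n * (r / 4).toNNReal⁻¹ := by gcongr; exact norm_fderiv_le_of_lipschitz ℝ hlip
      _ = 4 * √n / r := by
          rw [NNReal.coe_inv, Real.coe_toNNReal _ (by positivity)]
          field_simp
  exact ⟨χ, ⟨hsmooth, ⟨1, hle⟩, ⟨_, hgrad⟩⟩, hle, hone, hsupp, hgrad⟩

namespace IsCutoffAround

variable {E : Set (Fin n → ℝ)} {r : ℝ} {χ : (Fin n → ℝ) → ℝ} {x : Fin n → ℝ}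

lemma eq_zero (h : IsCutoffAround E r χ) (hx : x ∉ thickening (2 * r) E) : χ x = 0 :=
  image_eq_zero_of_notMem_tsupport fun hx' => hx (h.tsupport_subset hx')

lemma realGrad_eq_zero (h : IsCutoffAround E r χ)
    (hx : x ∉ thickening (2 * r) E \ thickening r E) : realGrad χ x = 0 := by
  have hfderiv : fderiv ℝ χ x = 0 := by
    by_cases hxr : x ∈ thickening r E
    · have heq : χ =ᶠ[𝓝 x] fun _ => 1 := by
        filter_upwards [isOpen_thickening.mem_nhds hxr] using h.eq_one
      rw [heq.fderiv_eq, fderiv_const_apply]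
    · exact fderiv_of_notMem_tsupport ℝ fun hx' => hx ⟨h.tsupport_subset hx', hxr⟩
  refine norm_le_zero_iff.1 ((OrliczHardy.norm_realGrad_le
    (h.contDiff.differentiable (by simp) x)).trans_eq ?_)
  rw [hfderiv, norm_zero, mul_zero]

end IsCutoffAround

end Cutoff

section Sawtooth

open Metric

variable {n : ℕ} {Ω E : Set (Fin n → ℝ)}

lemma mem_times_of_le {s t : ℝ} (ht : t ∈ times Ω) (hs : 0 < s) (hst : s ≤ t) : s ∈ times Ω :=
  ⟨hs, (ENNReal.ofReal_le_ofReal hst).trans_lt ht.2⟩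

/-- The part of `Ω` at distance between `2 t` and `4 t` from `E`, where the cutoff functions around
`E` at scale `2 t` have their gradients. -/
def annulus (Ω E : Set (Fin n → ℝ)) (t : ℝ) : Set (Fin n → ℝ) :=
  Ω ∩ (thickening (4 * t) E \ thickening (2 * t) E)

lemma measurableSet_annulus (hΩ : IsOpen Ω) (E : Set (Fin n → ℝ)) (t : ℝ) :
    MeasurableSet (annulus Ω E t) :=
  hΩ.measurableSet.inter (isOpen_thickening.measurableSet.diff isOpen_thickening.measurableSet)

lemma sum_volume_annulus_le (hΩ : IsOpen Ω) (E : Set (Fin n → ℝ)) {ε : ℝ} (hε : 0 < ε) (m : ℕ) :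
    ∑ j ∈ Finset.range m, volume (annulus Ω E (ε * 2 ^ j)) ≤ volume (Ω \ E) := by
  rw [← measure_biUnion_finset _ fun j _ => measurableSet_annulus hΩ E _]
  · refine measure_mono (iUnion₂_subset fun j _ x hx => ⟨hx.1, fun hxE => hx.2.2 ?_⟩)
    exact self_subset_thickening (by positivity) _ hxE
  · refine Pairwise.set_pairwise ((symm_disjoint.comap _).pairwise_on _ |>.2 ?_) _
    intro i j hij
    refine Set.disjoint_left.2 fun x hx hx' => hx'.2.2 (thickening_mono ?_ _ hx.2.1)
    calc 4 * (ε * 2 ^ i) = 2 * (ε * 2 ^ (i + 1)) := by ring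
      _ ≤ 2 * (ε * 2 ^ j) := by gcongr; exacts [one_le_two, hij]

lemma enorm_mulOp_sq {F : Type*} [NormedAddCommGroup F] [NormedSpace ℝ F] {g : (Fin n → ℝ) → ℝ}
    (hg : MemLp g ∞ (volume.restrict Ω)) (v : Lp F 2 (volume.restrict Ω)) :
    ‖mulOp hg v‖ₑ ^ 2 = ∫⁻ x in Ω, ‖g x‖ₑ ^ 2 * ‖v x‖ₑ ^ 2 := by
  rw [enorm_sq_eq_lintegral]
  refine lintegral_congr_ae ?_
  filter_upwards [coeFn_mulOp hg v] with x hx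
  rw [hx, enorm_smul, mul_pow]

lemma setLIntegral_le_const_mul {X : Type*} [MeasurableSpace X] {μ : Measure X} {s t : Set X}
    {F : X → ℝ≥0∞} {c : ℝ≥0∞} (h : ∀ᵐ x ∂(μ.restrict s), F x ≤ t.indicator (fun _ => c) x) :
    ∫⁻ x in s, F x ∂μ ≤ c * μ t :=
  (lintegral_mono_ae h).trans <| (lintegral_indicator_const_le _ _).trans <| by
    gcongr; exact Measure.restrict_le_self

namespace IsCutoffAround

variable {t : ℝ} {χ χ' : (Fin n → ℝ) → ℝ} {Λ : ℝ≥0∞} {v : L2 Ω}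

lemma enorm_sq_mul_le (hχ : IsCutoffAround E t χ) (x : Fin n → ℝ) (a : ℝ≥0∞) :
    ‖χ x‖ₑ ^ 2 * a ≤ a :=
  mul_le_of_le_one_left' <| pow_le_one' 
    (by rw [← ofReal_norm]; exact ENNReal.ofReal_le_one.2 (hχ.norm_le_one x)) 2

lemma enorm_mulVecOp_grad_sq_le (hχ : IsCutoffAround E (2 * t) χ) (hΩ : IsOpen Ω) (ht : 0 < t)
    (hv : ∀ᵐ y ∂(volume.restrict Ω), y ∈ thickening (4 * t) E → ‖v y‖ₑ ≤ Λ) :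
    ‖mulVecOp hχ.memLp_grad v‖ₑ ^ 2 ≤
      ENNReal.ofReal (4 * n / t ^ 2) * (Λ ^ 2 * volume (annulus Ω E t)) := by
  rw [enorm_sq_eq_lintegral, ← mul_assoc]
  refine setLIntegral_le_const_mul ?_
  filter_upwards [hv, coeFn_mulVecOp hχ.memLp_grad v, ae_restrict_mem hΩ.measurableSet]
    with x hvx hx hxΩ
  rw [hx, enorm_smul, mul_pow, mul_comm]
  by_cases hxt : x ∈ thickening (2 * (2 * t)) E \ thickening (2 * t) E
  · have hxt4 : x ∈ thickening (4 * t) E := by convert hxt.1 using 2; ring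
    rw [indicator_of_mem (show x ∈ annulus Ω E t from ⟨hxΩ, hxt4, hxt.2⟩)]
    gcongr
    · calc ‖realGrad χ x‖ₑ ^ 2 ≤ ENNReal.ofReal (4 * √n / (2 * t)) ^ 2 := by
            gcongr
            rw [← ofReal_norm]
            exact ENNReal.ofReal_le_ofReal (hχ.norm_realGrad_le x)
        _ = ENNReal.ofReal (4 * n / t ^ 2) := by
            rw [← ENNReal.ofReal_pow (by positivity)]
            congr 1
            rw [div_pow, mul_pow, Real.sq_sqrt n.cast_nonneg]
            field_simp
            ring
    · exact hvx hxt4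
  · simp [hχ.realGrad_eq_zero hxt]

lemma enorm_mulOp_sq_le_add_annulus (hχ : IsCutoffAround E (2 * t) χ)
    (hχ' : IsCutoffAround E (2 * (2 * t)) χ') (hΩ : IsOpen Ω)
    (hv : ∀ᵐ y ∂(volume.restrict Ω), y ∈ thickening (4 * (2 * t)) E → ‖v y‖ₑ ≤ Λ) :
    ‖mulOp hχ'.memLp v‖ₑ ^ 2 ≤ ‖mulOp hχ.memLp v‖ₑ ^ 2 +
      (Λ ^ 2 * volume (annulus Ω E t) + Λ ^ 2 * volume (annulus Ω E (2 * t))) := by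
  set U := annulus Ω E t ∪ annulus Ω E (2 * t)
  have hUmeas : MeasurableSet U :=
    (measurableSet_annulus hΩ E t).union (measurableSet_annulus hΩ E (2 * t))
  have hpt : ∀ᵐ x ∂(volume.restrict Ω), ‖χ' x‖ₑ ^ 2 * ‖v x‖ₑ ^ 2 ≤
      ‖χ x‖ₑ ^ 2 * ‖v x‖ₑ ^ 2 + U.indicator (fun _ => Λ ^ 2) x := by
    filter_upwards [hv, ae_restrict_mem hΩ.measurableSet] with x hvx hxΩ
    by_cases hx2 : x ∈ thickening (2 * t) E
    · refine le_add_right ((hχ'.enorm_sq_mul_le x _).trans_eq ?_)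
      rw [hχ.eq_one x hx2, enorm_one, one_pow, one_mul]
    by_cases hx8 : x ∈ thickening (4 * (2 * t)) E
    · have hxU : x ∈ U := by
        by_cases hx4 : x ∈ thickening (4 * t) E
        · exact Or.inl ⟨hxΩ, hx4, hx2⟩
        · exact Or.inr ⟨hxΩ, hx8, by rwa [← mul_assoc, show (2 * 2 : ℝ) = 4 by norm_num]⟩
      rw [indicator_of_mem hxU]
      exact le_add_left ((hχ'.enorm_sq_mul_le x _).trans (by gcongr; exact hvx hx8))
    · rw [hχ'.eq_zero fun hx => hx8 (by convert hx using 2; ring)]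
      simp
  rw [enorm_mulOp_sq, enorm_mulOp_sq, ← mul_add]
  calc ∫⁻ x in Ω, ‖χ' x‖ₑ ^ 2 * ‖v x‖ₑ ^ 2
      ≤ ∫⁻ x in Ω, ‖χ x‖ₑ ^ 2 * ‖v x‖ₑ ^ 2 + U.indicator (fun _ => Λ ^ 2) x := lintegral_mono_ae hpt
    _ = (∫⁻ x in Ω, ‖χ x‖ₑ ^ 2 * ‖v x‖ₑ ^ 2) + ∫⁻ x in Ω, U.indicator (fun _ => Λ ^ 2) x :=
        lintegral_add_right _ (measurable_const.indicator hUmeas)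
    _ ≤ _ := by
        gcongr
        exact (setLIntegral_le_const_mul (ae_of_all _ fun _ => le_rfl)).trans
          (by gcongr; exact measure_union_le _ _)

lemma enorm_mulOp_sq_le_of_le (hχ : IsCutoffAround E (2 * t) χ) {N : (Fin n → ℝ) → ℝ≥0∞}
    (hEΩ : E ⊆ Ω) (hv : ∀ᵐ y ∂(volume.restrict Ω), y ∈ thickening (4 * t) E → ‖v y‖ₑ ≤ Λ)
    (hvE : ∀ᵐ y ∂(volume.restrict E), ‖v y‖ₑ ≤ N y) :
    ‖mulOp hχ.memLp v‖ₑ ^ 2 ≤ Λ ^ 2 * volume (Ω \ E) + ∫⁻ y in E, N y ^ 2 := by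
  rw [enorm_mulOp_sq]
  calc ∫⁻ x in Ω, ‖χ x‖ₑ ^ 2 * ‖v x‖ₑ ^ 2
      = ∫⁻ x in Ω \ E ∪ E, ‖χ x‖ₑ ^ 2 * ‖v x‖ₑ ^ 2 := by rw [sdiff_union_of_subset hEΩ]
    _ ≤ (∫⁻ x in Ω \ E, ‖χ x‖ₑ ^ 2 * ‖v x‖ₑ ^ 2) + ∫⁻ x in E, ‖χ x‖ₑ ^ 2 * ‖v x‖ₑ ^ 2 :=
        lintegral_union_le _ _ _
    _ ≤ (∫⁻ _ in Ω \ E, Λ ^ 2) + ∫⁻ x in E, N x ^ 2 := by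
        refine add_le_add (lintegral_mono_ae ?_) (lintegral_mono_ae ?_)
        · filter_upwards [ae_restrict_of_ae_restrict_of_subset sdiff_subset hv] with x hvx
          by_cases hx : x ∈ thickening (4 * t) E
          · exact (hχ.enorm_sq_mul_le x _).trans (by gcongr; exact hvx hx)
          · rw [hχ.eq_zero fun hx' => hx (by convert hx' using 2; ring)]
            simp
        · filter_upwards [hvE] with x hvx
          exact (hχ.enorm_sq_mul_le x _).trans (by gcongr)
    _ = _ := by rw [setLIntegral_const]

end IsCutoffAround

/-- Each `u t` is bounded by `Λ` at the points at distance less than `4 t` from `E ⊆ Ω` (that is,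
`|u| ≤ Λ` on the sawtooth region of aperture `4` over `E`), and by `N` on `E` itself. -/
structure IsSawtoothBound (Ω E : Set (Fin n → ℝ)) (u : ℝ → (Fin n → ℝ) → ℂ) (Λ : ℝ≥0∞)
    (N : (Fin n → ℝ) → ℝ≥0∞) : Prop where
  subset : E ⊆ Ω
  enorm_le : ∀ t ∈ times Ω, ∀ᵐ y ∂(volume.restrict Ω), y ∈ thickening (4 * t) E → ‖u t y‖ₑ ≤ Λ
  enorm_le_on : ∀ t ∈ times Ω, ∀ᵐ y ∂(volume.restrict E), ‖u t y‖ₑ ≤ N y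

/-- The Dirichlet energy of `v` on the slice at time `s` of the sawtooth region of aperture `1` over
`E`; time is measured parabolically, `s = t ^ 2`. -/
def sliceEnergy (E : Set (Fin n → ℝ)) (s : ℝ) (v : L2 Ω) : ℝ≥0∞ :=
  ∫⁻ y in Ω ∩ thickening √s E, ‖weakGrad v y‖ₑ ^ 2

lemma IsCutoffAround.sliceEnergy_le {t s : ℝ} {χ : (Fin n → ℝ) → ℝ}
    (hχ : IsCutoffAround E t χ) (hΩ : IsOpen Ω) (hs : √s ≤ t) (v : L2 Ω) :
    sliceEnergy E s v ≤ ‖mulOp hχ.memLp (weakGrad v)‖ₑ ^ 2 := by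
  rw [enorm_mulOp_sq]
  calc ∫⁻ y in Ω ∩ thickening √s E, ‖weakGrad v y‖ₑ ^ 2
      = ∫⁻ y in Ω ∩ thickening √s E, ‖χ y‖ₑ ^ 2 * ‖weakGrad v y‖ₑ ^ 2 := by
        refine setLIntegral_congr_fun
          (hΩ.measurableSet.inter isOpen_thickening.measurableSet) fun y hy => ?_
        simp only [hχ.eq_one y (thickening_mono hs _ hy.2), enorm_one, one_pow, one_mul]
    _ ≤ _ := lintegral_mono_set inter_subset_left

lemma setLIntegral_Ioc_le_sum {F : ℝ → ℝ≥0∞} {σ : ℕ → ℝ} (hσ : Monotone σ) (m : ℕ) :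
    ∫⁻ s in Ioc (σ 0) (σ m), F s ≤ ∑ j ∈ Finset.range m, ∫⁻ s in Ioc (σ j) (σ (j + 1)), F s := by
  induction m with
  | zero => simp
  | succ m ih =>
    rw [Finset.sum_range_succ, ← Ioc_union_Ioc_eq_Ioc (hσ m.zero_le) (hσ m.le_succ)]
    exact (lintegral_union_le _ _ _).trans (by gcongr)

lemma sum_add_le_add_sum {I e b : ℕ → ℝ≥0∞} {m : ℕ}
    (h : ∀ j < m, I j + e (j + 1) ≤ e j + b j) :
    ∑ j ∈ Finset.range m, I j + e m ≤ e 0 + ∑ j ∈ Finset.range m, b j := by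
  induction m with
  | zero => simp
  | succ m ih =>
    rw [Finset.sum_range_succ, Finset.sum_range_succ, add_assoc, ← add_assoc (e 0)]
    calc _ ≤ ∑ j ∈ Finset.range m, I j + (e m + b m) := by gcongr _ + ?_; exact h m m.lt_succ_self
      _ ≤ _ := by
        rw [← add_assoc]
        gcongr ?_ + _
        exact ih fun j hj => h j (hj.trans m.lt_succ_self)

namespace IsSemigroupGeneratedByNeg

variable {A : (Fin n → ℝ) → Matrix (Fin n) (Fin n) ℂ} {δ : ℝ} {T : ℝ → L2 Ω →L[ℂ] L2 Ω}
  {f : L2 Ω} {Λ : ℝ≥0∞} {N : (Fin n → ℝ) → ℝ≥0∞} {t : ℝ} {χ χ' : (Fin n → ℝ) → ℝ}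

lemma lintegral_grad_cutoff_le (hΩ : IsOpen Ω)
    (hb : IsSawtoothBound Ω E (fun t => T (t ^ 2) f) Λ N) (ht : 0 < t) (ht2 : 2 * t ∈ times Ω)
    (hχ : IsCutoffAround E (2 * t) χ) :
    ∫⁻ s in Ioc (t ^ 2) ((2 * t) ^ 2), ‖mulVecOp hχ.memLp_grad (T s f)‖ₑ ^ 2 ≤
      ENNReal.ofReal (12 * n) * (Λ ^ 2 * volume (annulus Ω E t)) := by
  calc ∫⁻ s in Ioc (t ^ 2) ((2 * t) ^ 2), ‖mulVecOp hχ.memLp_grad (T s f)‖ₑ ^ 2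
      ≤ ∫⁻ _ in Ioc (t ^ 2) ((2 * t) ^ 2),
          ENNReal.ofReal (4 * n / t ^ 2) * (Λ ^ 2 * volume (annulus Ω E t)) := by
        refine setLIntegral_mono' measurableSet_Ioc fun s hs => ?_
        have hs0 : 0 < s := (pow_pos ht 2).trans hs.1
        have hts : t ≤ √s := Real.le_sqrt_of_sq_le hs.1.le
        have hst : √s ≤ 2 * t := Real.sqrt_le_iff.2 ⟨ht2.1.le, hs.2⟩
        have hv := hb.enorm_le √s (mem_times_of_le ht2 (Real.sqrt_pos.2 hs0) hst)
        rw [Real.sq_sqrt hs0.le] at hv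
        refine hχ.enorm_mulVecOp_grad_sq_le hΩ ht ?_
        filter_upwards [hv] with y hy hyE using hy (thickening_mono (by gcongr) _ hyE)
    _ = _ := by
        rw [setLIntegral_const, Real.volume_Ioc, mul_right_comm,
          ← ENNReal.ofReal_mul (by positivity)]
        congr 2
        field_simp
        ring

lemma dyadic_energy_le (hT : IsSemigroupGeneratedByNeg (IsDivFormOperator A (sobolevW0 Ω)) T)
    (hΩ : IsOpen Ω) (hA : IsElliptic δ A) (hδ : 0 < δ)
    (hb : IsSawtoothBound Ω E (fun t => T (t ^ 2) f) Λ N) (ht : 0 < t) (ht2 : 2 * t ∈ times Ω)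
    (hχ : IsCutoffAround E (2 * t) χ) (hχ' : IsCutoffAround E (2 * (2 * t)) χ') :
    ENNReal.ofReal δ * (∫⁻ s in Ioc (t ^ 2) ((2 * t) ^ 2), sliceEnergy E s (T s f)) +
        ‖mulOp hχ'.memLp (T ((2 * t) ^ 2) f)‖ₑ ^ 2 ≤
      ‖mulOp hχ.memLp (T (t ^ 2) f)‖ₑ ^ 2 +
        ((ENNReal.ofReal (48 * n / δ ^ 3) + 1) * (Λ ^ 2 * volume (annulus Ω E t)) +
          Λ ^ 2 * volume (annulus Ω E (2 * t))) := by
  set a := Λ ^ 2 * volume (annulus Ω E t)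
  set a' := Λ ^ 2 * volume (annulus Ω E (2 * t))
  have hsq : t ^ 2 ≤ (2 * t) ^ 2 := by gcongr; linarith
  have hslice : ∫⁻ s in Ioc (t ^ 2) ((2 * t) ^ 2), sliceEnergy E s (T s f) ≤
      ∫⁻ s in Ioc (t ^ 2) ((2 * t) ^ 2), ‖mulOp hχ.memLp (weakGrad (T s f))‖ₑ ^ 2 :=
    setLIntegral_mono' measurableSet_Ioc fun s hs =>
      hχ.sliceEnergy_le hΩ (Real.sqrt_le_iff.2 ⟨ht2.1.le, hs.2⟩) _
  calc _ ≤ ENNReal.ofReal δ *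
          (∫⁻ s in Ioc (t ^ 2) ((2 * t) ^ 2), ‖mulOp hχ.memLp (weakGrad (T s f))‖ₑ ^ 2) +
        (‖mulOp hχ.memLp (T ((2 * t) ^ 2) f)‖ₑ ^ 2 + (a + a')) := by
        gcongr
        exact hχ.enorm_mulOp_sq_le_add_annulus hχ' hΩ (hb.enorm_le _ ht2)
    _ ≤ ‖mulOp hχ.memLp (T (t ^ 2) f)‖ₑ ^ 2 + ENNReal.ofReal (4 / δ ^ 3) *
          (∫⁻ s in Ioc (t ^ 2) ((2 * t) ^ 2), ‖mulVecOp hχ.memLp_grad (T s f)‖ₑ ^ 2) +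
        (a + a') := by
        rw [← add_assoc]
        gcongr ?_ + _
        exact hT.energy_le hΩ hA hδ f hχ.toIsCutoff (sq_nonneg t) hsq
    _ ≤ ‖mulOp hχ.memLp (T (t ^ 2) f)‖ₑ ^ 2 +
        ENNReal.ofReal (4 / δ ^ 3) * (ENNReal.ofReal (12 * n) * a) + (a + a') := by
        gcongr
        exact lintegral_grad_cutoff_le hΩ hb ht ht2 hχ
    _ = _ := by
        rw [← mul_assoc, ← ENNReal.ofReal_mul (by positivity),
          show 4 / δ ^ 3 * (12 * n) = 48 * n / δ ^ 3 by ring]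
        ring

lemma sawtooth_dyadic_le (hT : IsSemigroupGeneratedByNeg (IsDivFormOperator A (sobolevW0 Ω)) T)
    (hΩ : IsOpen Ω) (hA : IsElliptic δ A) (hδ : 0 < δ)
    (hb : IsSawtoothBound Ω E (fun t => T (t ^ 2) f) Λ N) {ε : ℝ} (hε : 0 < ε) {m : ℕ}
    (hm : ε * 2 ^ m ∈ times Ω) :
    ENNReal.ofReal δ * (∫⁻ s in Ioc (ε ^ 2) ((ε * 2 ^ m) ^ 2), sliceEnergy E s (T s f)) ≤
      (ENNReal.ofReal (48 * n / δ ^ 3) + 3) *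
        (Λ ^ 2 * volume (Ω \ E) + ∫⁻ y in E, N y ^ 2) := by
  set τ : ℕ → ℝ := fun j => ε * 2 ^ j
  have hτ (j : ℕ) : 0 < τ j := by positivity
  have hτ_succ (j : ℕ) : τ (j + 1) = 2 * τ j := by simp only [τ]; ring
  have hτ_mono : Monotone τ := fun i j hij => by simp only [τ]; gcongr; exact one_le_two
  have hτsq_mono : Monotone fun j => τ j ^ 2 := fun i j hij =>
    pow_le_pow_left₀ (hτ i).le (hτ_mono hij) 2
  have hτ_zero : τ 0 = ε := by simp [τ]
  have hτ_times {j : ℕ} (hj : j ≤ m) : τ j ∈ times Ω := mem_times_of_le hm (hτ j) (hτ_mono hj)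
  choose χ hχ using fun j => exists_isCutoffAround E (mul_pos two_pos (hτ j))
  set C := ENNReal.ofReal (48 * n / δ ^ 3)
  set B := Λ ^ 2 * volume (Ω \ E)
  set a : ℕ → ℝ≥0∞ := fun j => Λ ^ 2 * volume (annulus Ω E (τ j))
  set I : ℕ → ℝ≥0∞ := fun j => ∫⁻ s in Ioc (τ j ^ 2) (τ (j + 1) ^ 2), sliceEnergy E s (T s f)
  set e : ℕ → ℝ≥0∞ := fun j => ‖mulOp (hχ j).memLp (T (τ j ^ 2) f)‖ₑ ^ 2
  have hstep : ∀ j < m, ENNReal.ofReal δ * I j + e (j + 1) ≤ e j + ((C + 1) * a j + a (j + 1)) := by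
    intro j hj
    have := hT.dyadic_energy_le hΩ hA hδ hb (hτ j) (hτ_succ j ▸ hτ_times hj) (hχ j)
      (hτ_succ j ▸ hχ (j + 1))
    simpa only [← hτ_succ] using this
  have hbottom : e 0 ≤ B + ∫⁻ y in E, N y ^ 2 :=
    (hχ 0).enorm_mulOp_sq_le_of_le hb.subset (hb.enorm_le _ (hτ_times m.zero_le))
      (hb.enorm_le_on _ (hτ_times m.zero_le))
  have hsum (k : ℕ) : ∑ j ∈ Finset.range k, a j ≤ B := by
    rw [← Finset.mul_sum]
    exact mul_le_mul_right (sum_volume_annulus_le hΩ E hε k) _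
  have hsum_succ : ∑ j ∈ Finset.range m, a (j + 1) ≤ B :=
    le_trans (by rw [Finset.sum_range_succ']; exact le_self_add) (hsum (m + 1))
  calc _ ≤ ∑ j ∈ Finset.range m, ENNReal.ofReal δ * I j := by
        rw [← Finset.mul_sum]
        gcongr
        simpa only [hτ_zero] using setLIntegral_Ioc_le_sum hτsq_mono m
    _ ≤ e 0 + ∑ j ∈ Finset.range m, ((C + 1) * a j + a (j + 1)) :=
        le_self_add.trans (sum_add_le_add_sum hstep)
    _ ≤ (B + ∫⁻ y in E, N y ^ 2) + ((C + 1) * B + B) := by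
        rw [Finset.sum_add_distrib, ← Finset.mul_sum]
        gcongr
        exact hsum m
    _ ≤ (B + ∫⁻ y in E, N y ^ 2) + ((C + 1) * B + B) + (C + 2) * ∫⁻ y in E, N y ^ 2 := le_self_add
    _ = _ := by ring

end IsSemigroupGeneratedByNeg

lemma setLIntegral_Ioc_zero_le {F : ℝ → ℝ≥0∞} {B : ℝ≥0∞} {t : ℝ} (ht : 0 < t)
    (h : ∀ m : ℕ, ∫⁻ s in Ioc ((t / 2 ^ m) ^ 2) (t ^ 2), F s ≤ B) :
    ∫⁻ s in Ioc 0 (t ^ 2), F s ≤ B := by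
  have hIoc : Ioc 0 (t ^ 2) ⊆ ⋃ m : ℕ, Ioc ((t / 2 ^ m) ^ 2) (t ^ 2) := fun s hs => by
    obtain ⟨m, hm⟩ := exists_pow_lt_of_lt_one (div_pos hs.1 (pow_pos ht 2))
      (show (1 / 4 : ℝ) < 1 by norm_num)
    refine mem_iUnion.2 ⟨m, ?_, hs.2⟩
    calc (t / 2 ^ m) ^ 2 = (1 / 4) ^ m * t ^ 2 := by
          rw [div_pow, ← pow_mul, mul_comm m, pow_mul, div_pow, one_pow]; norm_num; ring
      _ < s := (lt_div_iff₀ (pow_pos ht 2)).1 hm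
  refine (lintegral_mono_set hIoc).trans ?_
  rw [setLIntegral_iUnion_of_directed _
    (Monotone.directed_le fun k l hkl => Ioc_subset_Ioc_left ?_)]
  · exact iSup_le h
  · gcongr
    exact one_le_two

lemma setLIntegral_sq_times_le {F : ℝ → ℝ≥0∞} {B : ℝ≥0∞}
    (h : ∀ t ∈ times Ω, ∫⁻ s in Ioc 0 (t ^ 2), F s ≤ B) :
    ∫⁻ s in (fun t => t ^ 2) '' times Ω, F s ≤ B := by
  have hsub : (fun t => t ^ 2) '' times Ω ⊆
      ⋃ q : {q : ℚ // (q : ℝ) ∈ times Ω}, Ioc 0 ((q.1 : ℝ) ^ 2) := by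
    rintro _ ⟨t, ⟨ht0, htd⟩, rfl⟩
    obtain ⟨r, htr, hrd⟩ := ENNReal.lt_iff_exists_nnreal_btwn.1 htd
    rw [← ENNReal.ofReal_coe_nnreal] at htr hrd
    obtain ⟨q, htq, hqr⟩ := exists_rat_btwn
      ((ENNReal.ofReal_lt_ofReal_iff_of_nonneg ht0.le).1 htr)
    have hq : (q : ℝ) ∈ times Ω :=
      mem_times_of_le ⟨ht0.trans (htq.trans hqr), hrd⟩ (ht0.trans htq) hqr.le
    exact mem_iUnion.2 ⟨⟨q, hq⟩, pow_pos ht0 2, pow_le_pow_left₀ ht0.le htq.le 2⟩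
  refine (lintegral_mono_set hsub).trans ?_
  rw [setLIntegral_iUnion_of_directed _
    (Monotone.directed_le fun p q hpq => Ioc_subset_Ioc_right ?_)]
  · exact iSup_le fun q => h _ q.2
  · exact pow_le_pow_left₀ p.2.1.le (by exact_mod_cast hpq) 2

/-- The constant in `IsSemigroupGeneratedByNeg.sawtooth_le`. -/
def sawtoothConst (n : ℕ) (δ : ℝ) : ℝ≥0∞ :=
  (ENNReal.ofReal δ)⁻¹ * (ENNReal.ofReal (48 * n / δ ^ 3) + 3)

theorem IsSemigroupGeneratedByNeg.sawtooth_le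
    {A : (Fin n → ℝ) → Matrix (Fin n) (Fin n) ℂ} {δ : ℝ} {T : ℝ → L2 Ω →L[ℂ] L2 Ω} {f : L2 Ω}
    {Λ : ℝ≥0∞} {N : (Fin n → ℝ) → ℝ≥0∞}
    (hT : IsSemigroupGeneratedByNeg (IsDivFormOperator A (sobolevW0 Ω)) T)
    (hΩ : IsOpen Ω) (hA : IsElliptic δ A) (hδ : 0 < δ)
    (hb : IsSawtoothBound Ω E (fun t => T (t ^ 2) f) Λ N) :
    ∫⁻ s in (fun t => t ^ 2) '' times Ω, sliceEnergy E s (T s f) ≤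
      sawtoothConst n δ * (Λ ^ 2 * volume (Ω \ E) + ∫⁻ y in E, N y ^ 2) := by
  refine setLIntegral_sq_times_le fun t ht => setLIntegral_Ioc_zero_le ht.1 fun m => ?_
  have ht' : t / 2 ^ m * 2 ^ m = t := div_mul_cancel₀ t (by positivity)
  have hdyadic := hT.sawtooth_dyadic_le hΩ hA hδ hb (div_pos ht.1 (pow_pos two_pos m))
    (ht'.symm ▸ ht)
  rw [sawtoothConst, mul_assoc,
    ← ENNReal.mul_le_iff_le_inv (by simpa using hδ) ENNReal.ofReal_ne_top]
  simpa only [ht'] using hdyadic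

end Sawtooth

section AreaFunction

open Metric

variable {n : ℕ} {Ω : Set (Fin n → ℝ)} {A : (Fin n → ℝ) → Matrix (Fin n) (Fin n) ℂ} {δ : ℝ}

lemma measurableSet_times : MeasurableSet (times Ω) :=
  measurableSet_Ioi.inter (measurableSet_lt ENNReal.measurable_ofReal measurable_const)

lemma setLIntegral_sq_times (F : ℝ → ℝ≥0∞) :
    ∫⁻ s in (fun t => t ^ 2) '' times Ω, F s =
      ∫⁻ t in times Ω, ENNReal.ofReal (2 * t) * F (t ^ 2) := by
  rw [lintegral_image_eq_lintegral_abs_deriv_mul (f' := fun t => 2 * t) measurableSet_times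
    (fun t _ => by simpa using (hasDerivAt_pow 2 t).hasDerivWithinAt)
    fun a ha b hb hab => (pow_left_inj₀ ha.1.le hb.1.le two_ne_zero).1 hab]
  refine setLIntegral_congr_fun measurableSet_times fun t ht => ?_
  rw [abs_of_pos (mul_pos two_pos ht.1)]

lemma quasiMeasurePreserving_sq :
    Measure.QuasiMeasurePreserving (fun t : ℝ => t ^ 2) (volume.restrict (Ioi 0))
      (volume.restrict (Ioi 0)) := by
  refine ⟨by fun_prop, Measure.AbsolutelyContinuous.mk fun s hs hs0 => ?_⟩
  have hsq : Measurable fun t : ℝ => t ^ 2 := by fun_prop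
  rw [Measure.restrict_apply hs] at hs0
  rw [Measure.map_apply hsq hs, Measure.restrict_apply (hsq hs)]
  refine measure_mono_null (t := Real.sqrt '' (s ∩ Ioi 0))
    (fun t ht => ⟨t ^ 2, ⟨ht.1, mem_Ioi.2 (pow_pos (mem_Ioi.1 ht.2) 2)⟩,
      Real.sqrt_sq (mem_Ioi.1 ht.2).le⟩)
    (addHaar_image_eq_zero_of_differentiableOn_of_addHaar_eq_zero volume
      (fun s hs => ?_) hs0)
  exact (Real.hasDerivAt_sqrt hs.2.ne').differentiableAt.differentiableWithinAt

/-- The energy of `g` on `Ω ∩ B(x, t)`, as a function of `p = (t, x)`. -/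
def ballEnergy (g : L2Vec Ω) (p : ℝ × (Fin n → ℝ)) : ℝ≥0∞ :=
  ∫⁻ y in Ω ∩ ball p.2 p.1, ‖g y‖ₑ ^ 2

lemma measurableSet_dist_lt :
    MeasurableSet {q : (ℝ × (Fin n → ℝ)) × (Fin n → ℝ) | dist q.2 q.1.2 < q.1.1} :=
  (isOpen_lt (by fun_prop) (by fun_prop)).measurableSet

lemma measurable_ballEnergy (hΩ : IsOpen Ω) (g : L2Vec Ω) : Measurable (ballEnergy g) := by
  have hm : Measurable (({q : (ℝ × (Fin n → ℝ)) × (Fin n → ℝ) | q.2 ∈ Ω} ∩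
      {q | dist q.2 q.1.2 < q.1.1}).indicator fun q => ‖g q.2‖ₑ ^ 2) :=
    (((Lp.stronglyMeasurable g).measurable.comp measurable_snd).enorm.pow_const 2).indicator
      ((hΩ.measurableSet.preimage measurable_snd).inter measurableSet_dist_lt)
  convert! hm.lintegral_prod_right' (ν := volume) using 2 with p
  rw [ballEnergy, ← lintegral_indicator (hΩ.measurableSet.inter isOpen_ball.measurableSet)]
  rfl

lemma ballEnergy_eq_setLIntegral_indicator (g : L2Vec Ω) (p : ℝ × (Fin n → ℝ)) :
    ballEnergy g p = ∫⁻ y in Ω, (ball p.2 p.1).indicator (fun y => ‖g y‖ₑ ^ 2) y := by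
  rw [ballEnergy, inter_comm, ← Measure.restrict_restrict isOpen_ball.measurableSet,
    ← lintegral_indicator isOpen_ball.measurableSet]

lemma continuous_ballEnergy (p : ℝ × (Fin n → ℝ)) :
    Continuous fun g : L2Vec Ω => ballEnergy g p := by
  have hm : MemLp ((ball p.2 p.1).indicator fun _ : Fin n → ℝ => (1 : ℝ)) ∞
      (volume.restrict Ω) :=
    memLp_top_of_bound (measurable_const.indicator isOpen_ball.measurableSet).aestronglyMeasurable
      1 (Eventually.of_forall fun x => (norm_indicator_le_norm_self _ _).trans (by simp))
  have heq : (fun g : L2Vec Ω => ballEnergy g p) = fun g => ‖mulOp hm g‖ₑ ^ 2 := by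
    ext g
    rw [enorm_mulOp_sq, ballEnergy_eq_setLIntegral_indicator]
    refine lintegral_congr fun x => ?_
    by_cases hx : x ∈ ball p.2 p.1 <;> simp [hx]
  rw [heq]
  exact (ENNReal.continuous_pow 2).comp (mulOp hm).continuous.enorm

lemma aemeasurable_uncurry_comp_fst {X α β : Type*} [TopologicalSpace X]
    [TopologicalSpace.MetrizableSpace X] [SecondCountableTopology X] [MeasurableSpace α]
    [MeasurableSpace β] {ν : Measure α} {ρ : Measure β} {g : α → X}
    {F : X → α × β → ℝ≥0∞} (hF : ∀ p, Continuous fun x => F x p) (hF' : ∀ x, Measurable (F x))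
    (hg : AEStronglyMeasurable g ν) :
    AEMeasurable (fun p : α × β => F (g p.1) p) (ν.prod ρ) := by
  borelize X
  obtain ⟨g', hg', hgg'⟩ := hg
  refine ⟨fun p => F (g' p.1) p, (measurable_uncurry_of_continuous_of_measurable hF hF').comp
      ((hg'.measurable.comp measurable_fst).prodMk measurable_id), ?_⟩
  filter_upwards [Measure.quasiMeasurePreserving_fst.ae hgg'] with p hp
  rw [hp]

lemma aemeasurable_ballEnergy_comp (hΩ : IsOpen Ω) {ν : Measure ℝ} {ρ : Measure (Fin n → ℝ)}
    {g : ℝ → L2Vec Ω} (hg : AEStronglyMeasurable g ν) :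
    AEMeasurable (fun p : ℝ × (Fin n → ℝ) => ballEnergy (g p.1) p) (ν.prod ρ) := by
  have : Fact ((2 : ℝ≥0∞) ≠ ⊤) := ⟨ENNReal.ofNat_ne_top⟩
  have hcont := continuous_ballEnergy (Ω := Ω)
  have hmeas := measurable_ballEnergy hΩ
  -- Otherwise unification unfolds the integral.
  generalize ballEnergy (Ω := Ω) = F at *
  exact aemeasurable_uncurry_comp_fst hcont hmeas hg

lemma aemeasurable_ballEnergy
    (hT : IsSemigroupGeneratedByNeg (IsDivFormOperator A (sobolevW0 Ω)) (heatSemigroup Ω A))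
    (hΩ : IsOpen Ω) (hA : IsElliptic δ A) (hδ : 0 < δ) (f : L2 Ω) (E : Set (Fin n → ℝ)) :
    AEMeasurable
      (fun p : ℝ × (Fin n → ℝ) => ballEnergy (weakGrad (heatSemigroup Ω A (p.1 ^ 2) f)) p)
      ((volume.restrict (times Ω)).prod (volume.restrict E)) := by
  have hmeas := ((hT.memLp_weakGrad hΩ hA hδ f).aestronglyMeasurable.comp_quasiMeasurePreserving
    quasiMeasurePreserving_sq).mono_measure
      (Measure.restrict_mono (show times Ω ⊆ Ioi 0 from fun t ht => ht.1) le_rfl)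
  exact aemeasurable_ballEnergy_comp (g := fun t => weakGrad (heatSemigroup Ω A (t ^ 2) f)) hΩ
    hmeas

/-- The weight `t² / (t |Q(x, t) ∩ Ω|)` of the area function, as a function of `p = (t, x)`. -/
def areaWeight (Ω : Set (Fin n → ℝ)) (p : ℝ × (Fin n → ℝ)) : ℝ≥0∞ :=
  ‖p.1‖ₑ ^ 2 / (ENNReal.ofReal p.1 * volume (closedBall p.2 (p.1 / 2) ∩ Ω))

lemma measurable_areaWeight (hΩ : IsOpen Ω) : Measurable (areaWeight Ω) := by
  have hset : MeasurableSet {q : (ℝ × (Fin n → ℝ)) × (Fin n → ℝ) | dist q.2 q.1.2 ≤ q.1.1 / 2} :=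
    (isClosed_le (by fun_prop) (by fun_prop)).measurableSet
  exact (measurable_fst.enorm.pow_const 2).div (measurable_fst.ennreal_ofReal.mul
    (measurable_measure_prodMk_left (hset.inter (hΩ.measurableSet.preimage measurable_snd))))

lemma areaFn_eq (f : L2 Ω) (x : Fin n → ℝ) :
    areaFn A f x = (∫⁻ t in times Ω, areaWeight Ω (t, x) *
      ballEnergy (weakGrad (heatSemigroup Ω A (t ^ 2) f)) (t, x)) ^ (1 / 2 : ℝ) := by
  refine congrArg (· ^ (1 / 2 : ℝ)) (lintegral_congr fun t => ?_)
  rw [ballEnergy, areaWeight,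
    ← lintegral_const_mul _ ((Lp.stronglyMeasurable _).measurable.enorm.pow_const 2)]
  refine lintegral_congr fun y => ?_
  rw [enorm_smul, mul_pow, ENNReal.mul_div_right_comm]

lemma areaFn_sq (f : L2 Ω) (x : Fin n → ℝ) :
    areaFn A f x ^ 2 = ∫⁻ t in times Ω, areaWeight Ω (t, x) *
      ballEnergy (weakGrad (heatSemigroup Ω A (t ^ 2) f)) (t, x) := by
  rw [areaFn_eq, ← ENNReal.rpow_natCast, ← ENNReal.rpow_mul]
  norm_num

lemma aemeasurable_areaFn_integrand
    (hT : IsSemigroupGeneratedByNeg (IsDivFormOperator A (sobolevW0 Ω)) (heatSemigroup Ω A))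
    (hΩ : IsOpen Ω) (hA : IsElliptic δ A) (hδ : 0 < δ) (f : L2 Ω) (E : Set (Fin n → ℝ)) :
    AEMeasurable (fun p : (Fin n → ℝ) × ℝ => areaWeight Ω p.swap *
      ballEnergy (weakGrad (heatSemigroup Ω A (p.2 ^ 2) f)) p.swap)
      ((volume.restrict E).prod (volume.restrict (times Ω))) :=
  ((measurable_areaWeight hΩ).aemeasurable.mul (aemeasurable_ballEnergy hT hΩ hA hδ f E)).prod_swap

lemma aemeasurable_areaFn
    (hT : IsSemigroupGeneratedByNeg (IsDivFormOperator A (sobolevW0 Ω)) (heatSemigroup Ω A))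
    (hΩ : IsOpen Ω) (hA : IsElliptic δ A) (hδ : 0 < δ) (f : L2 Ω) :
    AEMeasurable (areaFn A f) (volume.restrict Ω) := by
  simp_rw [funext (areaFn_eq (A := A) f)]
  exact (aemeasurable_areaFn_integrand hT hΩ hA hδ f Ω).lintegral_prod_right'.pow_const _

lemma lintegral_ballEnergy_le (g : L2Vec Ω) {t : ℝ} (ht : 0 < t) (E : Set (Fin n → ℝ)) :
    ∫⁻ x in E, ballEnergy g (t, x) ≤
      ENNReal.ofReal (2 * t) ^ n * ∫⁻ y in Ω ∩ thickening t E, ‖g y‖ₑ ^ 2 := by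
  have hgm : Measurable fun y => ‖g y‖ₑ ^ 2 :=
    (Lp.stronglyMeasurable g).measurable.enorm.pow_const 2
  have hindicator (x y : Fin n → ℝ) : (ball x t).indicator (fun y => ‖g y‖ₑ ^ 2) y =
      (ball y t).indicator (fun _ => ‖g y‖ₑ ^ 2) x := by
    simp only [indicator, mem_ball, dist_comm]
  have hmeas : Measurable fun q : (Fin n → ℝ) × (Fin n → ℝ) =>
      (ball q.1 t).indicator (fun y => ‖g y‖ₑ ^ 2) q.2 :=
    (hgm.comp measurable_snd).indicator (s := {q | dist q.2 q.1 < t})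
      (isOpen_lt (by fun_prop) continuous_const).measurableSet
  have hslice (y : Fin n → ℝ) : ∫⁻ x in E, (ball y t).indicator (fun _ => ‖g y‖ₑ ^ 2) x ≤
      ENNReal.ofReal (2 * t) ^ n * (thickening t E).indicator (fun y => ‖g y‖ₑ ^ 2) y := by
    rw [lintegral_indicator isOpen_ball.measurableSet, setLIntegral_const,
      Measure.restrict_apply isOpen_ball.measurableSet, mul_comm]
    by_cases hy : y ∈ thickening t E
    · rw [indicator_of_mem hy]
      gcongr
      refine (measure_mono inter_subset_left).trans_eq ?_
      rw [Real.volume_pi_ball y ht, ENNReal.ofReal_pow (mul_pos two_pos ht).le, Fintype.card_fin]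
    · have hempty : ball y t ∩ E = ∅ := eq_empty_of_forall_notMem fun x hx =>
        hy (mem_thickening_iff.2 ⟨x, hx.2, mem_ball'.1 hx.1⟩)
      simp [hempty]
  calc ∫⁻ x in E, ballEnergy g (t, x)
      = ∫⁻ y in Ω, ∫⁻ x in E, (ball y t).indicator (fun _ => ‖g y‖ₑ ^ 2) x := by
        simp_rw [ballEnergy_eq_setLIntegral_indicator]
        rw [lintegral_lintegral_swap hmeas.aemeasurable]
        simp_rw [hindicator]
    _ ≤ ∫⁻ y in Ω, ENNReal.ofReal (2 * t) ^ n *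
          (thickening t E).indicator (fun y => ‖g y‖ₑ ^ 2) y := lintegral_mono hslice
    _ = _ := by
        rw [lintegral_const_mul _ (hgm.indicator isOpen_thickening.measurableSet),
          lintegral_indicator isOpen_thickening.measurableSet,
          Measure.restrict_restrict isOpen_thickening.measurableSet, inter_comm]

lemma HasMeasureDensity.areaWeight_mul_le {c : ℝ≥0} (hd : HasMeasureDensity c Ω) (hc : 0 < c)
    {x : Fin n → ℝ} (hx : x ∈ Ω) {t : ℝ} (ht : t ∈ times Ω) :
    areaWeight Ω (t, x) * ENNReal.ofReal (2 * t) ^ n ≤ 4 ^ n / c * ENNReal.ofReal t := by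
  have hfill : c * ENNReal.ofReal (t / 2) ^ n ≤ volume (closedBall x (t / 2) ∩ Ω) :=
    (hd x hx (t / 2) (mem_times_of_le ht (half_pos ht.1) (half_le_self ht.1.le))).trans
      (measure_mono (inter_subset_inter_left _ ball_subset_closedBall))
  have h2t : ENNReal.ofReal (2 * t) = 4 * ENNReal.ofReal (t / 2) := by
    rw [← ENNReal.ofReal_ofNat 4, ← ENNReal.ofReal_mul (by norm_num)]
    congr 1
    ring
  have hc' : (c : ℝ≥0∞) ≠ 0 := by exact_mod_cast hc.ne'
  rw [areaWeight, Real.enorm_eq_ofReal ht.1.le, h2t, ← ENNReal.mul_div_right_comm]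
  refine ENNReal.div_le_of_le_mul ?_
  calc ENNReal.ofReal t ^ 2 * (4 * ENNReal.ofReal (t / 2)) ^ n
      = 4 ^ n / c * ENNReal.ofReal t *
          (ENNReal.ofReal t * (c * ENNReal.ofReal (t / 2) ^ n)) := by
        rw [mul_pow]
        nth_rw 1 [← ENNReal.div_mul_cancel (a := c) (b := 4 ^ n) hc' ENNReal.coe_ne_top]
        ring
    _ ≤ _ := by gcongr

theorem lintegral_areaFn_sq_le
    (hT : IsSemigroupGeneratedByNeg (IsDivFormOperator A (sobolevW0 Ω)) (heatSemigroup Ω A))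
    (hΩ : IsOpen Ω) (hA : IsElliptic δ A) (hδ : 0 < δ) {c : ℝ≥0} (hc : 0 < c)
    (hd : HasMeasureDensity c Ω) (f : L2 Ω) {E : Set (Fin n → ℝ)} (hE : MeasurableSet E)
    (hEΩ : E ⊆ Ω) :
    ∫⁻ x in E, areaFn A f x ^ 2 ≤ 4 ^ n / c *
      ∫⁻ s in (fun t => t ^ 2) '' times Ω, sliceEnergy E s (heatSemigroup Ω A s f) := by
  have hCtop : (4 : ℝ≥0∞) ^ n / c ≠ ⊤ := ENNReal.div_ne_top (by simp) (by exact_mod_cast hc.ne')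
  simp_rw [areaFn_sq]
  rw [lintegral_lintegral_swap (aemeasurable_areaFn_integrand hT hΩ hA hδ f E),
    setLIntegral_sq_times, ← lintegral_const_mul' _ _ hCtop]
  refine setLIntegral_mono' measurableSet_times fun t ht => ?_
  set g := weakGrad (heatSemigroup Ω A (t ^ 2) f)
  have h2t : (0 : ℝ) < 2 * t := mul_pos two_pos ht.1
  have hV0 : ENNReal.ofReal (2 * t) ^ n ≠ 0 := pow_ne_zero _ (ENNReal.ofReal_pos.2 h2t).ne'
  have hVtop : ENNReal.ofReal (2 * t) ^ n ≠ ⊤ := ENNReal.pow_ne_top ENNReal.ofReal_ne_top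
  calc ∫⁻ x in E, areaWeight Ω (t, x) * ballEnergy g (t, x)
      ≤ ∫⁻ x in E, 4 ^ n / c * ENNReal.ofReal t / ENNReal.ofReal (2 * t) ^ n *
          ballEnergy g (t, x) := by
        refine setLIntegral_mono' hE fun x hx => mul_le_mul_left ?_ _
        exact (ENNReal.le_div_iff_mul_le (Or.inl hV0) (Or.inl hVtop)).2
          (hd.areaWeight_mul_le hc (hEΩ hx) ht)
    _ = 4 ^ n / c * ENNReal.ofReal t / ENNReal.ofReal (2 * t) ^ n *
          ∫⁻ x in E, ballEnergy g (t, x) :=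
        lintegral_const_mul _ ((measurable_ballEnergy hΩ g).comp measurable_prodMk_left)
    _ ≤ 4 ^ n / c * ENNReal.ofReal t / ENNReal.ofReal (2 * t) ^ n *
          (ENNReal.ofReal (2 * t) ^ n * ∫⁻ y in Ω ∩ thickening t E, ‖g y‖ₑ ^ 2) := by
        gcongr
        exact lintegral_ballEnergy_le g ht.1 E
    _ = 4 ^ n / c * (ENNReal.ofReal t * ∫⁻ y in Ω ∩ thickening t E, ‖g y‖ₑ ^ 2) := by
        rw [← mul_assoc, ENNReal.div_mul_cancel hV0 hVtop, mul_assoc]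
    _ ≤ _ := by
        rw [sliceEnergy, Real.sqrt_sq ht.1.le]
        gcongr
        linarith [ht.1]

end AreaFunction

section GoodLambda

/-- A good-`λ` type domination of `S` by `N`: the level sets of `S` are controlled by those of `N`
and by the truncated second moments of `N`. -/
def IsDistributionallyDominated {X : Type*} [MeasurableSpace X] (ν : Measure X) (C : ℝ≥0∞)
    (S N : X → ℝ≥0∞) : Prop :=
  ∀ Λ : ℝ≥0∞, Λ ≠ 0 → Λ ≠ ⊤ →
    ν {x | Λ < S x} ≤ C * (ν {x | Λ < N x} + ∫⁻ x in {x | N x ≤ Λ}, (N x / Λ) ^ 2 ∂ν)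

variable {X : Type*} [MeasurableSpace X] {ν : Measure X} {C : ℝ≥0∞} {S N : X → ℝ≥0∞}

lemma IsDistributionallyDominated.div_const (h : IsDistributionallyDominated ν C S N) {l : ℝ≥0∞}
    (hl : l ≠ 0) (hl' : l ≠ ⊤) :
    IsDistributionallyDominated ν C (fun x => S x / l) fun x => N x / l := by
  intro Λ hΛ hΛ'
  have hdiv (x : X) : N x / l / Λ = N x / (Λ * l) := by
    rw [div_eq_mul_inv, div_eq_mul_inv, div_eq_mul_inv, mul_comm Λ,
      ENNReal.mul_inv (Or.inl hl) (Or.inl hl'), mul_assoc]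
  simpa only [ENNReal.lt_div_iff_mul_lt (Or.inl hl) (Or.inl hl'),
    ENNReal.div_le_iff_le_mul (Or.inl hl) (Or.inl hl'), hdiv]
    using h (Λ * l) (mul_ne_zero hΛ hl) (ENNReal.mul_ne_top hΛ' hl')

lemma isDistributionallyDominated_of_goodSet {K₁ K₂ : ℝ≥0∞} (hS : AEMeasurable S ν)
    (h : ∀ Λ : ℝ≥0∞, Λ ≠ 0 → Λ ≠ ⊤ → ∃ G : Set X, G ⊆ {x | N x ≤ Λ} ∧
      ν Gᶜ ≤ K₂ * ν {x | Λ < N x} ∧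
      ∫⁻ x in G, S x ^ 2 ∂ν ≤ K₁ * (Λ ^ 2 * ν Gᶜ + ∫⁻ x in G, N x ^ 2 ∂ν)) :
    IsDistributionallyDominated ν ((1 + K₁) * K₂ + K₁) S N := by
  intro Λ hΛ hΛ'
  obtain ⟨G, hGN, hbad, hint⟩ := h Λ hΛ hΛ'
  have hΛ2 : Λ ^ 2 ≠ 0 := pow_ne_zero 2 hΛ
  have hΛ2' : Λ ^ 2 ≠ ⊤ := ENNReal.pow_ne_top hΛ'
  set V := ν {x | Λ < N x}
  set J := ∫⁻ x in {x | N x ≤ Λ}, (N x / Λ) ^ 2 ∂ν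
  have hJ : (∫⁻ x in G, N x ^ 2 ∂ν) / Λ ^ 2 ≤ J := by
    rw [div_eq_mul_inv, ← lintegral_mul_const' _ _ (ENNReal.inv_ne_top.2 hΛ2)]
    refine (lintegral_mono_set hGN).trans_eq (lintegral_congr fun x => ?_)
    rw [div_eq_mul_inv, mul_pow, ENNReal.inv_pow]
  have hchebyshev : ν (G ∩ {x | Λ < S x}) ≤ K₁ * (ν Gᶜ + J) :=
    calc ν (G ∩ {x | Λ < S x}) ≤ ν ({x | Λ ^ 2 ≤ S x ^ 2} ∩ G) :=
          measure_mono fun x hx => ⟨pow_le_pow_left' (le_of_lt hx.2) 2, hx.1⟩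
      _ ≤ ν.restrict G {x | Λ ^ 2 ≤ S x ^ 2} := Measure.le_restrict_apply _ _
      _ ≤ (∫⁻ x in G, S x ^ 2 ∂ν) / Λ ^ 2 :=
          meas_ge_le_lintegral_div (hS.restrict.pow_const 2) hΛ2 hΛ2'
      _ ≤ K₁ * (Λ ^ 2 * ν Gᶜ + ∫⁻ x in G, N x ^ 2 ∂ν) / Λ ^ 2 := by gcongr
      _ = K₁ * (ν Gᶜ + (∫⁻ x in G, N x ^ 2 ∂ν) / Λ ^ 2) := by
          rw [mul_div_assoc, ENNReal.add_div, mul_comm (Λ ^ 2),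
            ENNReal.mul_div_cancel_right hΛ2 hΛ2']
      _ ≤ _ := by gcongr
  calc ν {x | Λ < S x} ≤ ν (Gᶜ ∪ G ∩ {x | Λ < S x}) :=
        measure_mono fun x hx => (Classical.em (x ∈ G)).symm.imp_right fun hxG => ⟨hxG, hx⟩
    _ ≤ ν Gᶜ + K₁ * (ν Gᶜ + J) := (measure_union_le _ _).trans (by gcongr)
    _ ≤ K₂ * V + K₁ * (K₂ * V + J) := by gcongr
    _ = (1 + K₁) * K₂ * V + K₁ * J := by ring
    _ ≤ ((1 + K₁) * K₂ + K₁) * V + ((1 + K₁) * K₂ + K₁) * J := by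
        gcongr
        · exact le_self_add
        · exact le_add_self
    _ = _ := (mul_add _ _ _).symm

end GoodLambda

section Covering

open Metric

/-- The union of the balls `B(y, a t)`, `(y, t) ∈ W`: the points whose cone of aperture `a` meets
`W`. -/
def shadow {X : Type*} [PseudoMetricSpace X] (W : Set (X × ℝ)) (a : ℝ) : Set X :=
  ⋃ p ∈ W, ball p.1 (a * p.2)

section Metric

variable {X : Type*} [PseudoMetricSpace X] {W : Set (X × ℝ)} {a : ℝ} {x : X}

lemma isOpen_shadow : IsOpen (shadow W a) :=
  isOpen_biUnion fun _ _ => isOpen_ball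

lemma mem_shadow : x ∈ shadow W a ↔ ∃ p ∈ W, dist x p.1 < a * p.2 := by
  simp [shadow]

lemma ball_subset_shadow_one {p : X × ℝ} (hp : p ∈ W) : ball p.1 p.2 ⊆ shadow W 1 := fun x hx =>
  mem_shadow.2 ⟨p, hp, by rwa [one_mul]⟩

lemma shadow_mono (hW : ∀ p ∈ W, 0 < p.2) {b : ℝ} (hab : a ≤ b) : shadow W a ⊆ shadow W b :=
  biUnion_mono Subset.rfl fun p hp =>
    ball_subset_ball (mul_le_mul_of_nonneg_right hab (hW p hp).le)

lemma exists_disjoint_covering_shadow [SecondCountableTopology X] (hW : ∀ p ∈ W, 0 < p.2) {R : ℝ}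
    (hR : ∀ p ∈ W, p.2 ≤ R) (ha : 1 ≤ a) :
    ∃ u ⊆ W, u.Countable ∧ u.PairwiseDisjoint (fun p => ball p.1 p.2) ∧
      shadow W a ⊆ ⋃ p ∈ u, closedBall p.1 (5 * (a * p.2)) := by
  obtain ⟨u, huW, hdisj, hcov⟩ := Vitali.exists_disjoint_subfamily_covering_enlargement_closedBall
    W (fun p => p.1) (fun p => a * p.2) (a * R)
    (fun p hp => mul_le_mul_of_nonneg_left (hR p hp) (zero_le_one.trans ha)) 5 (by norm_num)
  have hdisj' : u.PairwiseDisjoint fun p => ball p.1 p.2 := hdisj.mono_on fun p hp =>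
    ball_subset_closedBall.trans
      (closedBall_subset_closedBall (le_mul_of_one_le_left (hW p (huW hp)).le ha))
  refine ⟨u, huW, hdisj'.countable_of_isOpen (fun _ _ => isOpen_ball)
    (fun p hp => nonempty_ball.2 (hW p (huW hp))), hdisj', fun x hx => ?_⟩
  obtain ⟨p, hp, hxp⟩ := mem_shadow.1 hx
  obtain ⟨b, hb, hpb⟩ := hcov p hp
  exact mem_biUnion hb (hpb (mem_closedBall.2 hxp.le))

end Metric

variable {n : ℕ} {Ω : Set (Fin n → ℝ)} {c : ℝ≥0} {W : Set ((Fin n → ℝ) × ℝ)}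

lemma FillsBall.volume_closedBall_mul_le {x : Fin n → ℝ} {t a : ℝ} (hf : FillsBall c Ω x t)
    (hc : 0 < c) (ha : 0 ≤ a) (ht : 0 ≤ t) :
    volume (closedBall x (a * t)) ≤ ENNReal.ofReal (2 * a) ^ n / c * volume (ball x t ∩ Ω) := by
  have hc' : (c : ℝ≥0∞) ≠ 0 := by exact_mod_cast hc.ne'
  calc volume (closedBall x (a * t))
      = ENNReal.ofReal (2 * a) ^ n * ENNReal.ofReal t ^ n := by
        rw [Real.volume_pi_closedBall _ (mul_nonneg ha ht), Fintype.card_fin, ← mul_assoc,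
          ENNReal.ofReal_pow (mul_nonneg (mul_nonneg two_pos.le ha) ht), ← mul_pow,
          ENNReal.ofReal_mul (mul_nonneg two_pos.le ha)]
    _ = ENNReal.ofReal (2 * a) ^ n / c * (c * ENNReal.ofReal t ^ n) := by
        rw [← mul_assoc, ENNReal.div_mul_cancel hc' ENNReal.coe_ne_top]
    _ ≤ _ := mul_le_mul_right hf _

lemma exists_forall_le_of_volume_inter_shadow_ne_top (hn : n ≠ 0) (hc : 0 < c)
    (hW : ∀ p ∈ W, 0 < p.2) (hfill : ∀ p ∈ W, FillsBall c Ω p.1 p.2)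
    (hfin : volume (Ω ∩ shadow W 1) ≠ ⊤) : ∃ R, ∀ p ∈ W, p.2 ≤ R := by
  have hc' : (c : ℝ≥0∞) ≠ 0 := by exact_mod_cast hc.ne'
  refine ⟨max 1 (volume (Ω ∩ shadow W 1) / c).toReal, fun p hp => ?_⟩
  rcases le_or_gt p.2 1 with h1 | h1
  · exact h1.trans (le_max_left _ _)
  have hpow : ENNReal.ofReal (p.2 ^ n) ≤ volume (Ω ∩ shadow W 1) / c := by
    rw [ENNReal.le_div_iff_mul_le (Or.inl hc') (Or.inl ENNReal.coe_ne_top), mul_comm,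
      ENNReal.ofReal_pow (hW p hp).le, inter_comm]
    exact (hfill p hp).trans
      (measure_mono (inter_subset_inter_left _ (ball_subset_shadow_one hp)))
  exact (le_self_pow₀ h1.le hn).trans (((ENNReal.ofReal_le_iff_le_toReal
    (ENNReal.div_ne_top hfin hc')).1 hpow).trans (le_max_right _ _))

theorem volume_inter_shadow_le (hn : n ≠ 0) (hΩ : MeasurableSet Ω) (hc : 0 < c)
    (hW : ∀ p ∈ W, 0 < p.2) (hfill : ∀ p ∈ W, FillsBall c Ω p.1 p.2) :
    volume (Ω ∩ shadow W 4) ≤ 40 ^ n / c * volume (Ω ∩ shadow W 1) := by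
  by_cases hfin : volume (Ω ∩ shadow W 1) = ⊤
  · rw [hfin, ENNReal.mul_top (ENNReal.div_pos (by simp) ENNReal.coe_ne_top).ne']
    exact le_top
  obtain ⟨R, hR⟩ := exists_forall_le_of_volume_inter_shadow_ne_top hn hc hW hfill hfin
  obtain ⟨u, huW, hu, hdisj, hcov⟩ := exists_disjoint_covering_shadow (a := 4) hW hR (by norm_num)
  have hball (p) (hp : p ∈ u) : volume (closedBall p.1 (5 * (4 * p.2))) ≤
      40 ^ n / c * volume.restrict Ω (ball p.1 p.2) := by
    rw [← mul_assoc, Measure.restrict_apply isOpen_ball.measurableSet]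
    convert! (hfill p (huW hp)).volume_closedBall_mul_le hc (a := 5 * 4) (by norm_num)
      (hW p (huW hp)).le using 4
    norm_num
  have := hu.to_subtype
  calc volume (Ω ∩ shadow W 4)
      ≤ volume (⋃ p ∈ u, closedBall p.1 (5 * (4 * p.2))) :=
        measure_mono (inter_subset_right.trans hcov)
    _ ≤ ∑' p : u, volume (closedBall p.1.1 (5 * (4 * p.1.2))) := measure_biUnion_le _ hu _
    _ ≤ ∑' p : u, 40 ^ n / c * volume.restrict Ω (ball p.1.1 p.1.2) :=
        ENNReal.tsum_le_tsum fun p => hball p.1 p.2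
    _ = 40 ^ n / c * volume.restrict Ω (⋃ p ∈ u, ball p.1 p.2) := by
        rw [ENNReal.tsum_mul_left, measure_biUnion hu hdisj fun _ _ => isOpen_ball.measurableSet]
    _ ≤ 40 ^ n / c * volume.restrict Ω (shadow W 1) := by
        gcongr
        exact iUnion₂_subset fun p hp => ball_subset_shadow_one (huW hp)
    _ = _ := by rw [Measure.restrict_apply' hΩ, inter_comm]

end Covering

section MaximalFunction

open Metric

variable {n : ℕ} {Ω : Set (Fin n → ℝ)} {u : ℝ → (Fin n → ℝ) → ℂ} {Λ : ℝ≥0∞} {x : Fin n → ℝ}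

/-- The nontangential maximal function of `u t y`, over the cones of aperture `1` in
`Ω × (0, d_Ω)`. -/
def ntMaximalFn (Ω : Set (Fin n → ℝ)) (u : ℝ → (Fin n → ℝ) → ℂ) (x : Fin n → ℝ) : ℝ≥0∞ :=
  ⨆ (y : Fin n → ℝ) (t : ℝ) (_ : y ∈ Ω ∧ 0 < t ∧ ENNReal.ofReal t < dOmega Ω ∧ ‖y - x‖ < t),
    ‖u t y‖ₑ

/-- The points `(y, t)` of `Ω × (0, d_Ω)` at which `|u|` exceeds `Λ`. -/
def levelSet (Ω : Set (Fin n → ℝ)) (u : ℝ → (Fin n → ℝ) → ℂ) (Λ : ℝ≥0∞) :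
    Set ((Fin n → ℝ) × ℝ) :=
  {p | p.1 ∈ Ω ∧ p.2 ∈ times Ω ∧ Λ < ‖u p.2 p.1‖ₑ}

lemma pos_of_mem_levelSet {p : (Fin n → ℝ) × ℝ} (hp : p ∈ levelSet Ω u Λ) : 0 < p.2 :=
  hp.2.1.1

lemma lt_ntMaximalFn_iff : Λ < ntMaximalFn Ω u x ↔ x ∈ shadow (levelSet Ω u Λ) 1 := by
  simp only [ntMaximalFn, lt_iSup_iff, mem_shadow, levelSet, times, mem_ofPred_eq, Prod.exists,
    one_mul, exists_prop, ← dist_eq_norm, dist_comm x, and_assoc]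
  exact exists_congr fun y => exists_congr fun t => by tauto

lemma measurable_ntMaximalFn : Measurable (ntMaximalFn Ω u) :=
  measurable_of_Ioi fun Λ => by
    convert! (isOpen_shadow (W := levelSet Ω u Λ) (a := 1)).measurableSet using 1
    exact Set.ext fun x => lt_ntMaximalFn_iff

lemma ne_zero_of_mem_times {t : ℝ} (ht : t ∈ times Ω) : n ≠ 0 := by
  rintro rfl
  have hd : dOmega Ω = 0 := by
    rw [dOmega, ediam_subsingleton subsingleton_of_subsingleton, mul_zero]
  exact not_lt_zero (hd ▸ ht.2)

/-- The points of `Ω` whose cone of aperture `4` avoids the set where `|u| > Λ`. -/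
def goodSet (Ω : Set (Fin n → ℝ)) (u : ℝ → (Fin n → ℝ) → ℂ) (Λ : ℝ≥0∞) : Set (Fin n → ℝ) :=
  Ω \ shadow (levelSet Ω u Λ) 4

lemma measurableSet_goodSet (hΩ : IsOpen Ω) : MeasurableSet (goodSet Ω u Λ) :=
  hΩ.measurableSet.diff isOpen_shadow.measurableSet

lemma goodSet_subset_setOf_le : goodSet Ω u Λ ⊆ {x | ntMaximalFn Ω u x ≤ Λ} := fun _ hx =>
  not_lt.1 fun h => hx.2 (shadow_mono (fun _ => pos_of_mem_levelSet) (by norm_num)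
    (lt_ntMaximalFn_iff.1 h))

lemma isSawtoothBound_goodSet (hΩ : IsOpen Ω) {v : ℝ → (Fin n → ℝ) → ℂ}
    (hv : ∀ t ∈ times Ω, v t =ᵐ[volume.restrict Ω] u t) :
    IsSawtoothBound Ω (goodSet Ω u Λ) v Λ (ntMaximalFn Ω u) where
  subset := sdiff_subset
  enorm_le t ht := by
    filter_upwards [hv t ht, ae_restrict_mem hΩ.measurableSet] with y hy hyΩ hyG
    obtain ⟨x, hx, hyx⟩ := mem_thickening_iff.1 hyG
    rw [hy]
    exact not_lt.1 fun h => hx.2 (mem_shadow.2 ⟨(y, t), ⟨hyΩ, ht, h⟩, by rwa [dist_comm]⟩)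
  enorm_le_on t ht := by
    filter_upwards [ae_restrict_of_ae_restrict_of_subset sdiff_subset (hv t ht),
      ae_restrict_mem (measurableSet_goodSet hΩ)] with y hy hyG
    rw [hy]
    exact le_iSup₂_of_le y t (le_iSup_of_le ⟨hyG.1, ht.1, ht.2, by simpa using ht.1⟩ le_rfl)

lemma HasMeasureDensity.volume_compl_goodSet_le {c : ℝ≥0} (hd : HasMeasureDensity c Ω)
    (hc : 0 < c) (hΩ : IsOpen Ω) :
    volume.restrict Ω (goodSet Ω u Λ)ᶜ ≤
      40 ^ n / c * volume.restrict Ω {x | Λ < ntMaximalFn Ω u x} := by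
  have hlevel : {x | Λ < ntMaximalFn Ω u x} = shadow (levelSet Ω u Λ) 1 :=
    Set.ext fun x => lt_ntMaximalFn_iff
  rw [hlevel, Measure.restrict_apply' hΩ.measurableSet, Measure.restrict_apply' hΩ.measurableSet,
    inter_comm, ← Set.sdiff_eq, goodSet, Set.sdiff_sdiff_right_self, inter_comm (shadow _ 1)]
  rcases (levelSet Ω u Λ).eq_empty_or_nonempty with hW | ⟨q, hq⟩
  · simp [hW, shadow]
  · exact volume_inter_shadow_le (ne_zero_of_mem_times hq.2.1) hΩ.measurableSet hc
      (fun p => pos_of_mem_levelSet) fun p hp => hd p.1 hp.1 p.2 hp.2.1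

/-- The constant of the good-`λ` inequality for the area function: with `K₁ = 4ⁿ / c` times the
constant of the energy estimate in the sawtooth region, and `K₂ = 40ⁿ / c` from the covering of the
bad set, it is `(1 + K₁) K₂ + K₁`. -/
def goodLambdaConst (n : ℕ) (c : ℝ≥0) (δ : ℝ) : ℝ≥0∞ :=
  (1 + 4 ^ n / c * sawtoothConst n δ) * (40 ^ n / c) + 4 ^ n / c * sawtoothConst n δ

theorem isDistributionallyDominated_areaFn {A : (Fin n → ℝ) → Matrix (Fin n) (Fin n) ℂ} {δ : ℝ}
    (hT : IsSemigroupGeneratedByNeg (IsDivFormOperator A (sobolevW0 Ω)) (heatSemigroup Ω A))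
    (hΩ : IsOpen Ω) {c : ℝ≥0} (hc : 0 < c) (hd : HasMeasureDensity c Ω) (hA : IsElliptic δ A)
    (hδ : 0 < δ) {f : L2 Ω}
    (hu : ∀ t ∈ times Ω, heatSemigroup Ω A (t ^ 2) f =ᵐ[volume.restrict Ω] u t) :
    IsDistributionallyDominated (volume.restrict Ω) (goodLambdaConst n c δ) (areaFn A f)
      (ntMaximalFn Ω u) := by
  refine isDistributionallyDominated_of_goodSet (aemeasurable_areaFn hT hΩ hA hδ f)
    fun Λ _ _ => ⟨goodSet Ω u Λ, goodSet_subset_setOf_le,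
      hd.volume_compl_goodSet_le hc hΩ, ?_⟩
  have hsub : goodSet Ω u Λ ⊆ Ω := sdiff_subset
  rw [Measure.restrict_restrict_of_subset hsub, Measure.restrict_apply' hΩ.measurableSet,
    inter_comm, ← Set.sdiff_eq, mul_assoc]
  exact (lintegral_areaFn_sq_le hT hΩ hA hδ hc hd f (measurableSet_goodSet hΩ) hsub).trans
    (mul_le_mul_right (hT.sawtooth_le hΩ hA hδ (isSawtoothBound_goodSet hΩ hu)) _)

end MaximalFunction

section DyadicGrowth

/-- Doubling-type growth of `φ : [0, ∞] → [0, ∞]` along powers of two: `φ` shrinks at least like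
`r ^ j` when its argument is divided by `2 ^ j` and grows at most like `R ^ j` when it is multiplied
by `2 ^ j`. This is the form in which the lower and upper types of an Orlicz function are used. -/
structure HasDyadicGrowth (C r R : ℝ≥0∞) (φ : ℝ≥0∞ → ℝ≥0∞) : Prop where
  monotone : Monotone φ
  zero : φ 0 = 0
  top : φ ⊤ = ⊤
  one_ne_zero : φ 1 ≠ 0
  div_le : ∀ (j : ℕ) (s : ℝ≥0∞), φ (s / 2 ^ j) ≤ C * r ^ j * φ s
  mul_le : ∀ (j : ℕ) (s : ℝ≥0∞), φ (2 ^ j * s) ≤ C * R ^ j * φ s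

lemma tsum_int_le_geometric {a : ℤ → ℝ≥0∞} {b q : ℝ≥0∞} {g : ℕ → ℤ} (hg : Function.Injective g)
    (hsupp : Function.support a ⊆ range g) (h : ∀ j, a (g j) ≤ b * q ^ j) :
    ∑' k, a k ≤ b * (1 - q)⁻¹ := by
  rw [← hg.tsum_eq hsupp, ← ENNReal.tsum_geometric, ← ENNReal.tsum_mul_left]
  exact ENNReal.tsum_le_tsum h

lemma two_zpow_ne_zero (k : ℤ) : (2 : ℝ≥0∞) ^ k ≠ 0 :=
  (ENNReal.zpow_pos two_ne_zero ENNReal.ofNat_ne_top k).ne'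

lemma two_zpow_ne_top (k : ℤ) : (2 : ℝ≥0∞) ^ k ≠ ⊤ :=
  (ENNReal.zpow_lt_top two_ne_zero ENNReal.ofNat_ne_top k).ne

lemma two_zpow_add (k l : ℤ) : (2 : ℝ≥0∞) ^ (k + l) = 2 ^ k * 2 ^ l :=
  ENNReal.zpow_add two_ne_zero ENNReal.ofNat_ne_top k l

lemma monotone_two_zpow : Monotone fun k : ℤ => (2 : ℝ≥0∞) ^ k := fun _ _ h =>
  ENNReal.zpow_le_of_le (by norm_num) h

namespace HasDyadicGrowth

variable {C r R : ℝ≥0∞} {φ : ℝ≥0∞ → ℝ≥0∞}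

lemma le_tsum_indicator_Ioi (h : HasDyadicGrowth C r R φ) (s : ℝ≥0∞) :
    φ s ≤ ∑' k : ℤ, (Ioi ((2 : ℝ≥0∞) ^ k)).indicator (fun _ => φ (2 ^ (k + 1))) s := by
  rcases eq_or_ne s 0 with rfl | hs
  · simp [h.zero]
  rcases eq_or_ne s ⊤ with rfl | hs'
  · calc φ ⊤ ≤ ∑' _ : ℕ, φ 1 := by simp [ENNReal.tsum_const_eq_top_of_ne_zero h.one_ne_zero]
      _ ≤ ∑' k : ℕ, φ (2 ^ ((k : ℤ) + 1)) := ENNReal.tsum_le_tsum fun k =>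
          h.monotone (monotone_two_zpow (by positivity : (0 : ℤ) ≤ k + 1))
      _ ≤ ∑' k : ℤ, φ (2 ^ (k + 1)) :=
          ENNReal.tsum_comp_le_tsum_of_injective Nat.cast_injective
            fun k : ℤ => φ (2 ^ (k + 1))
      _ = _ := tsum_congr fun k => (indicator_of_mem
          (mem_Ioi.2 (two_zpow_ne_top k).lt_top) fun _ => φ (2 ^ (k + 1))).symm
  · obtain ⟨k, hk, hk'⟩ :=
      ENNReal.exists_mem_Ioc_zpow hs hs' ENNReal.one_lt_two ENNReal.ofNat_ne_top
    refine le_trans ?_ (ENNReal.le_tsum k)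
    rw [indicator_of_mem (mem_Ioi.2 hk)]
    exact h.monotone hk'

lemma tsum_indicator_Ioi_le (h : HasDyadicGrowth C r R φ) (s : ℝ≥0∞) :
    ∑' k : ℤ, (Ioi ((2 : ℝ≥0∞) ^ k)).indicator (fun _ => φ (2 ^ (k + 1))) s ≤
      C ^ 2 * R * (1 - r)⁻¹ * φ s := by
  rcases eq_or_ne s 0 with rfl | hs
  · simp
  rcases eq_or_ne s ⊤ with rfl | hs'
  · have hCR : C * R ≠ 0 := by
      intro h0
      simpa [h0, h.top] using h.mul_le 1 ⊤
    rw [h.top, ENNReal.mul_top]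
    · exact le_top
    · exact mul_ne_zero (mul_ne_zero (pow_ne_zero 2 (left_ne_zero_of_mul hCR))
        (right_ne_zero_of_mul hCR)) (ENNReal.inv_ne_zero.2 (ENNReal.sub_ne_top ENNReal.one_ne_top))
  obtain ⟨m, hm, hm'⟩ := ENNReal.exists_mem_Ioc_zpow hs hs' ENNReal.one_lt_two ENNReal.ofNat_ne_top
  rw [mul_right_comm]
  refine tsum_int_le_geometric (g := fun j : ℕ => m - j) (fun a b hab => by simpa using hab)
    (fun k hk => ?_) fun j => (indicator_le_self _ _ _).trans ?_
  · have hks : (2 : ℝ≥0∞) ^ k < s :=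
      mem_of_indicator_ne_zero (s := Ioi _) (Function.mem_support.1 hk)
    have hkm : k < m + 1 := monotone_two_zpow.reflect_lt (hks.trans_le hm')
    exact ⟨(m - k).toNat, by simp only; omega⟩
  · have hpow : (2 : ℝ≥0∞) ^ (m - j + 1) = 2 ^ 1 * (2 ^ m / 2 ^ j) := by
      rw [two_zpow_add, sub_eq_add_neg, two_zpow_add, ENNReal.zpow_neg, zpow_natCast, zpow_one,
        pow_one, mul_comm, div_eq_mul_inv]
    calc φ (2 ^ (m - j + 1)) ≤ C * R ^ 1 * φ (2 ^ m / 2 ^ j) := hpow ▸ h.mul_le 1 _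
      _ ≤ C * R ^ 1 * (C * r ^ j * φ s) := by
          gcongr
          exact (h.div_le j _).trans (by gcongr; exact h.monotone hm.le)
      _ = _ := by ring

lemma tsum_mul_indicator_Iic_le (h : HasDyadicGrowth C r R φ) (s : ℝ≥0∞) :
    ∑' k : ℤ, φ (2 ^ (k + 1)) *
        (Iic ((2 : ℝ≥0∞) ^ k)).indicator (fun s => (s / 2 ^ k) ^ 2) s ≤
      C * R ^ 2 * (1 - R / 4)⁻¹ * φ s := by
  rcases eq_or_ne s 0 with rfl | hs
  · simp
  rcases eq_or_ne s ⊤ with rfl | hs'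
  · simp [two_zpow_ne_top]
  obtain ⟨m, hm, hm'⟩ := ENNReal.exists_mem_Ioc_zpow hs hs' ENNReal.one_lt_two ENNReal.ofNat_ne_top
  rw [mul_right_comm]
  refine tsum_int_le_geometric (g := fun j : ℕ => m + 1 + j) (fun a b hab => by simpa using hab)
    (fun k hk => ?_) fun j => (mul_le_mul_right (indicator_le_self _ _ _) _).trans ?_
  · have hsk : s ≤ (2 : ℝ≥0∞) ^ k :=
      mem_of_indicator_ne_zero (s := Iic _) (right_ne_zero_of_mul (Function.mem_support.1 hk))
    have hkm : m < k := monotone_two_zpow.reflect_lt (hm.trans_le hsk)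
    exact ⟨(k - (m + 1)).toNat, by simp only; omega⟩
  · have hgrow : φ (2 ^ (m + 1 + j + 1)) ≤ C * R ^ (j + 2) * φ s := by
      have hpow : (2 : ℝ≥0∞) ^ (m + 1 + j + 1) = 2 ^ (j + 2) * 2 ^ m := by
        rw [← zpow_natCast, ← two_zpow_add]
        push_cast
        ring_nf
      exact hpow ▸ (h.mul_le _ _).trans (by gcongr; exact h.monotone hm.le)
    have hdecay : s / 2 ^ (m + 1 + j) ≤ 2⁻¹ ^ j := by
      rw [two_zpow_add, zpow_natCast]
      refine ENNReal.div_le_of_le_mul' (hm'.trans_eq ?_)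
      rw [mul_assoc, ← mul_pow, ENNReal.mul_inv_cancel two_ne_zero ENNReal.ofNat_ne_top, one_pow,
        mul_one]
    calc φ (2 ^ (m + 1 + j + 1)) * (s / 2 ^ (m + 1 + j)) ^ 2
        ≤ C * R ^ (j + 2) * φ s * (2⁻¹ ^ j) ^ 2 := by gcongr
      _ = C * R ^ 2 * φ s * (R * 2⁻¹ ^ 2) ^ j := by ring
      _ = _ := by norm_num [div_eq_mul_inv, ← ENNReal.inv_pow]

/-- The constant of the modular inequality: the two summands are the constants of
`tsum_indicator_Ioi_le` and `tsum_mul_indicator_Iic_le`. -/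
def modularConst (C r R : ℝ≥0∞) : ℝ≥0∞ :=
  C ^ 2 * R * (1 - r)⁻¹ + C * R ^ 2 * (1 - R / 4)⁻¹

lemma modularConst_ne_top (hC : C ≠ ⊤) (hr : r < 1) (hR : R < 4) : modularConst C r R ≠ ⊤ := by
  have hr' : (1 - r)⁻¹ ≠ ⊤ := ENNReal.inv_ne_top.2 (tsub_pos_of_lt hr).ne'
  have hR' : (1 - R / 4)⁻¹ ≠ ⊤ := ENNReal.inv_ne_top.2
    (tsub_pos_of_lt (ENNReal.div_lt_of_lt_mul (by rwa [one_mul]))).ne'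
  have hR'' : R ≠ ⊤ := hR.ne_top
  rw [modularConst]
  finiteness

variable {X : Type*} [MeasurableSpace X] {ν : Measure X} {S N : X → ℝ≥0∞} {K : ℝ≥0∞}

lemma lintegral_le_tsum_measure (h : HasDyadicGrowth C r R φ) (hS : AEMeasurable S ν) :
    ∫⁻ x, φ (S x) ∂ν ≤ ∑' k : ℤ, φ (2 ^ (k + 1)) * ν {x | 2 ^ k < S x} :=
  calc ∫⁻ x, φ (S x) ∂ν
      ≤ ∫⁻ x, ∑' k : ℤ, (Ioi (2 ^ k)).indicator (fun _ => φ (2 ^ (k + 1))) (S x) ∂ν :=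
        lintegral_mono fun x => h.le_tsum_indicator_Ioi (S x)
    _ = ∑' k : ℤ, ∫⁻ x, (Ioi (2 ^ k)).indicator (fun _ => φ (2 ^ (k + 1))) (S x) ∂ν :=
        lintegral_tsum fun _ =>
          (measurable_const.indicator measurableSet_Ioi).comp_aemeasurable hS
    _ = _ := tsum_congr fun _ =>
        lintegral_indicator_const₀ (hS.nullMeasurable measurableSet_Ioi) _

lemma tsum_measure_le_lintegral (h : HasDyadicGrowth C r R φ) (hN : Measurable N) :
    ∑' k : ℤ, φ (2 ^ (k + 1)) * ν {x | 2 ^ k < N x} ≤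
      C ^ 2 * R * (1 - r)⁻¹ * ∫⁻ x, φ (N x) ∂ν := by
  have hφN : Measurable fun x => φ (N x) := h.monotone.measurable.comp hN
  have hmeas (k : ℤ) :
      Measurable fun x => (Ioi (2 ^ k)).indicator (fun _ => φ (2 ^ (k + 1))) (N x) :=
    (measurable_const.indicator measurableSet_Ioi).comp hN
  calc ∑' k : ℤ, φ (2 ^ (k + 1)) * ν {x | 2 ^ k < N x}
      = ∑' k : ℤ, ∫⁻ x, (Ioi (2 ^ k)).indicator (fun _ => φ (2 ^ (k + 1))) (N x) ∂ν :=
        tsum_congr fun k => (lintegral_indicator_const (hN measurableSet_Ioi) _).symm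
    _ = ∫⁻ x, ∑' k : ℤ, (Ioi (2 ^ k)).indicator (fun _ => φ (2 ^ (k + 1))) (N x) ∂ν :=
        (lintegral_tsum fun k => (hmeas k).aemeasurable).symm
    _ ≤ _ := (lintegral_mono fun x => h.tsum_indicator_Ioi_le (N x)).trans_eq
        (lintegral_const_mul _ hφN)

lemma tsum_setLIntegral_sq_le_lintegral (h : HasDyadicGrowth C r R φ) (hN : Measurable N) :
    ∑' k : ℤ, φ (2 ^ (k + 1)) * ∫⁻ x in {x | N x ≤ 2 ^ k}, (N x / 2 ^ k) ^ 2 ∂ν ≤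
      C * R ^ 2 * (1 - R / 4)⁻¹ * ∫⁻ x, φ (N x) ∂ν := by
  have hφN : Measurable fun x => φ (N x) := h.monotone.measurable.comp hN
  have hmeas (k : ℤ) :
      Measurable fun x => (Iic (2 ^ k)).indicator (fun s => (s / 2 ^ k) ^ 2) (N x) :=
    (((measurable_id.div_const _).pow_const 2).indicator measurableSet_Iic).comp hN
  calc ∑' k : ℤ, φ (2 ^ (k + 1)) * ∫⁻ x in {x | N x ≤ 2 ^ k}, (N x / 2 ^ k) ^ 2 ∂ν
      = ∑' k : ℤ, ∫⁻ x, φ (2 ^ (k + 1)) *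
          (Iic (2 ^ k)).indicator (fun s => (s / 2 ^ k) ^ 2) (N x) ∂ν := by
        refine tsum_congr fun k => ?_
        have hset : MeasurableSet {x | N x ≤ 2 ^ k} := hN measurableSet_Iic
        rw [lintegral_const_mul _ (hmeas k), ← lintegral_indicator hset]
        rfl
    _ = ∫⁻ x, ∑' k : ℤ, φ (2 ^ (k + 1)) *
          (Iic (2 ^ k)).indicator (fun s => (s / 2 ^ k) ^ 2) (N x) ∂ν :=
        (lintegral_tsum fun k => ((hmeas k).const_mul _).aemeasurable).symm
    _ ≤ _ := (lintegral_mono fun x => h.tsum_mul_indicator_Iic_le (N x)).trans_eq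
        (lintegral_const_mul _ hφN)

theorem lintegral_le_of_isDistributionallyDominated (h : HasDyadicGrowth C r R φ)
    (hS : AEMeasurable S ν) (hN : Measurable N) (hSN : IsDistributionallyDominated ν K S N) :
    ∫⁻ x, φ (S x) ∂ν ≤ K * modularConst C r R * ∫⁻ x, φ (N x) ∂ν :=
  calc ∫⁻ x, φ (S x) ∂ν
      ≤ ∑' k : ℤ, φ (2 ^ (k + 1)) * ν {x | 2 ^ k < S x} := h.lintegral_le_tsum_measure hS
    _ ≤ ∑' k : ℤ, K * (φ (2 ^ (k + 1)) * ν {x | 2 ^ k < N x} +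
          φ (2 ^ (k + 1)) * ∫⁻ x in {x | N x ≤ 2 ^ k}, (N x / 2 ^ k) ^ 2 ∂ν) := by
        refine ENNReal.tsum_le_tsum fun k => ?_
        rw [← mul_add, mul_left_comm]
        gcongr
        exact hSN _ (two_zpow_ne_zero k) (two_zpow_ne_top k)
    _ ≤ K * (C ^ 2 * R * (1 - r)⁻¹ * ∫⁻ x, φ (N x) ∂ν +
          C * R ^ 2 * (1 - R / 4)⁻¹ * ∫⁻ x, φ (N x) ∂ν) := by
        rw [ENNReal.tsum_mul_left, ENNReal.tsum_add]
        gcongr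
        · exact h.tsum_measure_le_lintegral hN
        · exact h.tsum_setLIntegral_sq_le_lintegral hN
    _ = _ := by rw [modularConst, mul_assoc K, add_mul]

end HasDyadicGrowth

end DyadicGrowth

section Orlicz

/-- `Φ : (0, ∞) → (0, ∞)` is nondecreasing, of lower type `p` and of upper type `q`; only the values
on `(0, ∞)` matter. -/
structure IsOfType (p q : ℝ) (Φ : ℝ → ℝ) : Prop where
  pos : ∀ s, 0 < s → 0 < Φ s
  monotoneOn : MonotoneOn Φ (Ioi 0)
  lowerType : ∃ C : ℝ, ∀ t s : ℝ, 0 < t → t ≤ 1 → 0 < s → Φ (s * t) ≤ C * t ^ p * Φ s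
  upperType : ∃ C : ℝ, ∀ t s : ℝ, 1 ≤ t → 0 < s → Φ (s * t) ≤ C * t ^ q * Φ s

variable {Φ : ℝ → ℝ}

lemma AssumptionA.exists_isOfType_one {n : ℕ} {μ : ℝ} (hμ : 0 < μ) (hΦ : AssumptionA n μ Φ) :
    ∃ p, 0 < p ∧ IsOfType p 1 Φ := by
  have hcrit : 0 < criticalLowerType Φ := lt_of_le_of_lt (by positivity) hΦ.lt_criticalLowerType
  have hne : {p : ℝ | 0 < p ∧
      ∀ t s : ℝ, 0 < t → t < 1 → 0 < s → Φ (s * t) ≤ t ^ p * Φ s}.Nonempty := by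
    by_contra hempty
    rw [criticalLowerType, not_nonempty_iff_eq_empty.1 hempty, Real.sSup_empty] at hcrit
    exact hcrit.false
  obtain ⟨p, hp, hlower⟩ := hne
  obtain ⟨C, -, hupper⟩ := hΦ.upperType
  refine ⟨p, hp, hΦ.pos, hΦ.strictMonoOn.monotoneOn, ⟨1, fun t s ht ht' hs => ?_⟩, ⟨C, ?_⟩⟩
  · rcases ht'.eq_or_lt with rfl | ht'
    · simp
    · simpa using hlower t s ht ht' hs
  · simpa using hupper

lemma extendPhi_zero : extendPhi Φ 0 = 0 := if_pos rfl

lemma extendPhi_top : extendPhi Φ ⊤ = ⊤ := by simp [extendPhi]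

lemma extendPhi_ofReal {s : ℝ} (hs : 0 < s) :
    extendPhi Φ (ENNReal.ofReal s) = ENNReal.ofReal (Φ s) := by
  simp [extendPhi, hs, hs.le]

lemma eq_zero_or_top_or_ofReal (s : ℝ≥0∞) :
    s = 0 ∨ s = ⊤ ∨ ∃ r : ℝ, 0 < r ∧ s = ENNReal.ofReal r := by
  rcases eq_or_ne s 0 with h0 | h0
  · exact Or.inl h0
  rcases eq_or_ne s ⊤ with ht | ht
  · exact Or.inr (Or.inl ht)
  · exact Or.inr (Or.inr ⟨s.toReal, ENNReal.toReal_pos h0 ht, (ENNReal.ofReal_toReal ht).symm⟩)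

lemma extendPhi_mul_ofReal_le {a b : ℝ} (ha : 0 < a) (hb : 0 < b)
    (h : ∀ s, 0 < s → Φ (s * a) ≤ b * Φ s) (s : ℝ≥0∞) :
    extendPhi Φ (s * ENNReal.ofReal a) ≤ ENNReal.ofReal b * extendPhi Φ s := by
  rcases eq_zero_or_top_or_ofReal s with rfl | rfl | ⟨r, hr, rfl⟩
  · simp [extendPhi_zero]
  · simp [extendPhi_top, hb]
  · rw [← ENNReal.ofReal_mul hr.le, extendPhi_ofReal (mul_pos hr ha), extendPhi_ofReal hr,
      ← ENNReal.ofReal_mul hb.le]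
    exact ENNReal.ofReal_le_ofReal (h r hr)

namespace IsOfType

variable {p q : ℝ}

lemma monotone_extendPhi (hΦ : IsOfType p q Φ) : Monotone (extendPhi Φ) := by
  intro a b hab
  rcases eq_zero_or_top_or_ofReal a with rfl | rfl | ⟨r, hr, rfl⟩
  · simp [extendPhi_zero]
  · rw [top_le_iff.1 hab]
  rcases eq_zero_or_top_or_ofReal b with rfl | rfl | ⟨s, hs, rfl⟩
  · exact absurd hab (by simpa using hr)
  · simp [extendPhi_top]
  · rw [extendPhi_ofReal hr, extendPhi_ofReal hs]
    exact ENNReal.ofReal_le_ofReal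
      (hΦ.monotoneOn hr hs ((ENNReal.ofReal_le_ofReal_iff hs.le).1 hab))

theorem exists_hasDyadicGrowth (hΦ : IsOfType p q Φ) :
    ∃ C : ℝ≥0∞, C ≠ ⊤ ∧ HasDyadicGrowth C (ENNReal.ofReal (2 ^ (-p))) (ENNReal.ofReal (2 ^ q))
      (extendPhi Φ) := by
  obtain ⟨C₁, hlower⟩ := hΦ.lowerType
  obtain ⟨C₂, hupper⟩ := hΦ.upperType
  set C := max 1 (max C₁ C₂)
  have hC : 0 < C := lt_max_of_lt_left one_pos
  have hpow (x : ℝ) (j : ℕ) : ENNReal.ofReal C * ENNReal.ofReal (2 ^ x) ^ j =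
      ENNReal.ofReal (C * ((2 : ℝ) ^ j) ^ x) := by
    rw [← ENNReal.ofReal_pow (by positivity), ← ENNReal.ofReal_mul hC.le, ← Real.rpow_natCast,
      ← Real.rpow_natCast, ← Real.rpow_mul zero_le_two, ← Real.rpow_mul zero_le_two, mul_comm x]
  have htwo (j : ℕ) : (2 : ℝ≥0∞) ^ j = ENNReal.ofReal (2 ^ j) := by
    rw [ENNReal.ofReal_pow zero_le_two, ENNReal.ofReal_ofNat]
  refine ⟨ENNReal.ofReal C, ENNReal.ofReal_ne_top, hΦ.monotone_extendPhi, extendPhi_zero,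
    extendPhi_top, ?_, fun j s => ?_, fun j s => ?_⟩
  · rw [← ENNReal.ofReal_one, extendPhi_ofReal one_pos]
    exact (ENNReal.ofReal_pos.2 (hΦ.pos 1 one_pos)).ne'
  · rw [hpow, htwo, div_eq_mul_inv, ← ENNReal.ofReal_inv_of_pos (by positivity)]
    refine extendPhi_mul_ofReal_le (by positivity) (by positivity) (fun s hs => ?_) s
    have hΦs := (hΦ.pos s hs).le
    rw [Real.rpow_neg (by positivity), ← Real.inv_rpow (by positivity)]
    refine (hlower _ s (by positivity) (inv_le_one_of_one_le₀ (one_le_pow₀ one_le_two)) hs).trans ?_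
    gcongr
    exact (le_max_left _ _).trans (le_max_right _ _)
  · rw [hpow, htwo, mul_comm]
    refine extendPhi_mul_ofReal_le (by positivity) (by positivity) (fun s hs => ?_) s
    have hΦs := (hΦ.pos s hs).le
    refine (hupper _ s (one_le_pow₀ one_le_two) hs).trans ?_
    gcongr
    exact (le_max_right _ _).trans (le_max_right _ _)

end IsOfType

lemma HasDyadicGrowth.exists_div_two_pow_mul_le {C r R K : ℝ≥0∞} {φ : ℝ≥0∞ → ℝ≥0∞}
    (h : HasDyadicGrowth C r R φ) (hC : C ≠ ⊤) (hr : r < 1) (hK : K ≠ ⊤) :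
    ∃ (j : ℕ) (Q : ℝ≥0∞), Q ≠ ⊤ ∧ Q * K ≤ 1 ∧ ∀ s, φ (s / 2 ^ j) ≤ Q * φ s := by
  have hlim : Tendsto (fun j : ℕ => C * r ^ j * K) atTop (𝓝 (C * 0 * K)) :=
    ENNReal.Tendsto.mul_const (ENNReal.Tendsto.const_mul
      (ENNReal.tendsto_pow_atTop_nhds_zero_of_lt_one hr) (Or.inr hC)) (Or.inr hK)
  rw [mul_zero, zero_mul] at hlim
  obtain ⟨j, hj⟩ := (hlim.eventually_le_const zero_lt_one).exists
  exact ⟨j, C * r ^ j, ENNReal.mul_ne_top hC (ENNReal.pow_ne_top hr.ne_top), hj, h.div_le j⟩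

lemma orliczNorm_le_ofReal {n : ℕ} {Ω : Set (Fin n → ℝ)} {g : (Fin n → ℝ) → ℝ≥0∞} {l : ℝ}
    (hl : 0 < l) (h : ∫⁻ x in Ω, extendPhi Φ (g x / ENNReal.ofReal l) ≤ 1) :
    orliczNorm Φ Ω g ≤ ENNReal.ofReal l :=
  iInf₂_le l ⟨hl, h⟩

theorem HasDyadicGrowth.exists_orliczNorm_le {n : ℕ} {Ω : Set (Fin n → ℝ)} {C r R K : ℝ≥0∞}
    (h : HasDyadicGrowth C r R (extendPhi Φ)) (hC : C ≠ ⊤) (hr : r < 1) (hK : K ≠ ⊤) :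
    ∃ M : ℝ≥0, 0 < M ∧ ∀ S N : (Fin n → ℝ) → ℝ≥0∞,
      (∀ l : ℝ, 0 < l → ∫⁻ x in Ω, extendPhi Φ (S x / ENNReal.ofReal l) ≤
        K * ∫⁻ x in Ω, extendPhi Φ (N x / ENNReal.ofReal l)) →
      orliczNorm Φ Ω S ≤ M * orliczNorm Φ Ω N := by
  obtain ⟨j, Q, hQ, hQK, hscale⟩ := h.exists_div_two_pow_mul_le hC hr hK
  refine ⟨2 ^ j, by positivity, fun S N hSN => ?_⟩
  have hj : ENNReal.ofReal (2 ^ j) = ((2 ^ j : ℝ≥0) : ℝ≥0∞) := by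
    rw [ENNReal.ofReal_pow zero_le_two, ENNReal.ofReal_ofNat]; norm_cast
  have hmul (l : ℝ) (hl : 0 < l) : ENNReal.ofReal (l * 2 ^ j) = ENNReal.ofReal l * 2 ^ j := by
    rw [ENNReal.ofReal_mul hl.le, hj]; norm_cast
  rw [mul_comm, ← ENNReal.div_le_iff_le_mul (Or.inl (by simp)) (Or.inl (by simp))]
  refine le_iInf₂ fun l ⟨hl, hN⟩ => ?_
  rw [ENNReal.div_le_iff_le_mul (Or.inl (by simp)) (Or.inl (by simp)), ← hj,
    ← ENNReal.ofReal_mul hl.le]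
  refine orliczNorm_le_ofReal (by positivity) ?_
  calc ∫⁻ x in Ω, extendPhi Φ (S x / ENNReal.ofReal (l * 2 ^ j))
      ≤ ∫⁻ x in Ω, Q * extendPhi Φ (S x / ENNReal.ofReal l) := by
        refine lintegral_mono fun x => le_of_eq_of_le ?_ (hscale _)
        rw [hmul l hl, div_eq_mul_inv, ENNReal.mul_inv (Or.inl (ENNReal.ofReal_pos.2 hl).ne')
          (Or.inl ENNReal.ofReal_ne_top), ← mul_assoc, ← div_eq_mul_inv, ← div_eq_mul_inv]
    _ = Q * ∫⁻ x in Ω, extendPhi Φ (S x / ENNReal.ofReal l) := lintegral_const_mul' _ _ hQ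
    _ ≤ Q * (K * 1) := by
        gcongr
        exact (hSN l hl).trans (by gcongr)
    _ ≤ 1 := by rwa [mul_one]

theorem IsOfType.exists_orliczNorm_le {n : ℕ} {Ω : Set (Fin n → ℝ)} {p q : ℝ}
    (hΦ : IsOfType p q Φ) (hp : 0 < p) (hq : q < 2) {K : ℝ≥0∞} (hK : K ≠ ⊤) :
    ∃ M : ℝ≥0, 0 < M ∧ ∀ S N : (Fin n → ℝ) → ℝ≥0∞, AEMeasurable S (volume.restrict Ω) →
      Measurable N → IsDistributionallyDominated (volume.restrict Ω) K S N →
      MemOrlicz Φ Ω N → MemOrlicz Φ Ω S ∧ orliczNorm Φ Ω S ≤ M * orliczNorm Φ Ω N := by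
  obtain ⟨C, hC, hgrowth⟩ := hΦ.exists_hasDyadicGrowth
  have hr : ENNReal.ofReal (2 ^ (-p)) < 1 := ENNReal.ofReal_lt_one.2
    (Real.rpow_lt_one_of_one_lt_of_neg one_lt_two (neg_neg_of_pos hp))
  have hR : ENNReal.ofReal (2 ^ q) < 4 := by
    rw [ENNReal.ofReal_lt_ofNat]
    exact (Real.rpow_lt_rpow_of_exponent_lt one_lt_two hq).trans_eq (by norm_num)
  have hK' := ENNReal.mul_ne_top hK (HasDyadicGrowth.modularConst_ne_top hC hr hR)
  obtain ⟨M, hM, hnorm⟩ := hgrowth.exists_orliczNorm_le (Ω := Ω) hC hr hK'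
  refine ⟨M, hM, fun S N hS hN hSN hmem => ?_⟩
  have hmodular (l : ℝ) (hl : 0 < l) := hgrowth.lintegral_le_of_isDistributionallyDominated
    (hS.div_const _) (hN.div_const _)
    (hSN.div_const (ENNReal.ofReal_pos.2 hl).ne' ENNReal.ofReal_ne_top)
  refine ⟨⟨hS, ?_⟩, hnorm S N hmodular⟩
  have h1 := hmodular 1 one_pos
  simp only [ENNReal.ofReal_one, div_one] at h1
  exact h1.trans_lt (ENNReal.mul_lt_top hK'.lt_top hmem.2)

end Orlicz

section HeatSemigroup

variable {n : ℕ} {Ω : Set (Fin n → ℝ)} {A : (Fin n → ℝ) → Matrix (Fin n) (Fin n) ℂ} {δ : ℝ}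

lemma contRep_ae_eq (u : L2 Ω) : u =ᵐ[volume.restrict Ω] contRep u := by
  by_cases h : ∃ g : (Fin n → ℝ) → ℂ, ContinuousOn g Ω ∧ u =ᵐ[volume.restrict Ω] g
  · rw [contRep, dif_pos h]
    exact h.choose_spec.2
  · rw [contRep, dif_neg h]

lemma isSemigroupGeneratedByNeg_heatSemigroup_or_eq_zero :
    IsSemigroupGeneratedByNeg (IsDivFormOperator A (sobolevW0 Ω)) (heatSemigroup Ω A) ∨
      heatSemigroup Ω A = 0 := by
  rw [heatSemigroup]
  split_ifs with h
  · exact Or.inl h.choose_spec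
  · exact Or.inr rfl

lemma areaFn_eq_zero (hΩ : IsOpen Ω) (hT : heatSemigroup Ω A = 0) (f : L2 Ω) :
    areaFn A f = 0 := by
  have henergy (p : ℝ × (Fin n → ℝ)) : ballEnergy (0 : L2Vec Ω) p = 0 := by
    rw [ballEnergy_eq_setLIntegral_indicator, lintegral_eq_zero_of_ae_eq_zero]
    filter_upwards [Lp.coeFn_zero (EuclideanSpace ℂ (Fin n)) 2 (volume.restrict Ω)] with y hy
    simp only [indicator, hy, Pi.zero_apply, enorm_zero, zero_pow two_ne_zero, ite_self]
  funext x
  simp [areaFn_eq, hT, weakGrad_zero hΩ, henergy]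

lemma goodLambdaConst_ne_top {c : ℝ≥0} (hc : 0 < c) (hδ : 0 < δ) :
    goodLambdaConst n c δ ≠ ⊤ := by
  have hc' : (c : ℝ≥0∞) ≠ 0 := ENNReal.coe_ne_zero.2 hc.ne'
  have hδ' : (ENNReal.ofReal δ)⁻¹ ≠ ⊤ := ENNReal.inv_ne_top.2 (ENNReal.ofReal_pos.2 hδ).ne'
  rw [goodLambdaConst, sawtoothConst]
  finiteness

theorem aemeasurable_and_isDistributionallyDominated_areaFn (hΩ : IsOpen Ω) {c : ℝ≥0} (hc : 0 < c)
    (hd : HasMeasureDensity c Ω) (hA : IsElliptic δ A) (hδ : 0 < δ) {f : L2 Ω}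
    {u : ℝ → (Fin n → ℝ) → ℂ}
    (hu : ∀ t ∈ times Ω, heatSemigroup Ω A (t ^ 2) f =ᵐ[volume.restrict Ω] u t) :
    AEMeasurable (areaFn A f) (volume.restrict Ω) ∧
      IsDistributionallyDominated (volume.restrict Ω) (goodLambdaConst n c δ) (areaFn A f)
        (ntMaximalFn Ω u) := by
  rcases isSemigroupGeneratedByNeg_heatSemigroup_or_eq_zero (Ω := Ω) (A := A) with hT | hT
  · exact ⟨aemeasurable_areaFn hT hΩ hA hδ f,
      isDistributionallyDominated_areaFn hT hΩ hc hd hA hδ hu⟩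
  · rw [areaFn_eq_zero hΩ hT]
    exact ⟨aemeasurable_const, fun Λ _ _ => by simp⟩

end HeatSemigroup

end OrliczHardy

end

open OrliczHardy in
theorem proposition3p2_general {n : ℕ} {Ω : Set (Fin n → ℝ)} (hΩ : IsOpen Ω) {c : ℝ≥0} (hc : 0 < c)
    (hd : HasMeasureDensity c Ω) {A : (Fin n → ℝ) → Matrix (Fin n) (Fin n) ℂ} {δ : ℝ} (hδ : 0 < δ)
    (hA : IsElliptic δ A) {Φ : ℝ → ℝ} {p q : ℝ} (hp : 0 < p) (hq : q < 2) (hΦ : IsOfType p q Φ) :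
    ∃ C : ℝ≥0, 0 < C ∧ ∀ (f : L2 Ω) (u : ℝ → (Fin n → ℝ) → ℂ),
      (∀ t ∈ times Ω, heatSemigroup Ω A (t ^ 2) f =ᵐ[volume.restrict Ω] u t) →
      MemOrlicz Φ Ω (ntMaximalFn Ω u) →
      MemOrlicz Φ Ω (areaFn A f) ∧
        orliczNorm Φ Ω (areaFn A f) ≤ C * orliczNorm Φ Ω (ntMaximalFn Ω u) := by
  obtain ⟨C, hC, hle⟩ := hΦ.exists_orliczNorm_le (Ω := Ω) hp hq (goodLambdaConst_ne_top hc hδ)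
  refine ⟨C, hC, fun f u hu => ?_⟩
  obtain ⟨hS, hSN⟩ := aemeasurable_and_isDistributionallyDominated_areaFn hΩ hc hd hA hδ hu
  exact hle _ _ hS measurable_ntMaximalFn hSN

theorem proposition3p2 {n : ℕ} (Ω : Set (Fin n → ℝ)) (hΩ : OrliczHardy.IsStronglyLipschitzDomain Ω)
    (A : (Fin n → ℝ) → Matrix (Fin n) (Fin n) ℂ)
    (hA : ∃ δ : ℝ, 0 < δ ∧ δ ≤ 1 ∧ OrliczHardy.IsElliptic δ A)
    (μ : ℝ) (hμ0 : 0 < μ) (hμ1 : μ ≤ 1)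
    (hG : OrliczHardy.HasGaussianProperty (OrliczHardy.heatSemigroup Ω A) (Metric.ediam Ω) μ)
    (Φ : ℝ → ℝ) (hΦ : OrliczHardy.AssumptionA n μ Φ) :
    ∃ C : ℝ≥0, 0 < C ∧ ∀ f : OrliczHardy.L2 Ω, OrliczHardy.MemHardy Φ A f →
      OrliczHardy.MemOrlicz Φ Ω (OrliczHardy.areaFn A f) ∧
      OrliczHardy.orliczNorm Φ Ω (OrliczHardy.areaFn A f) ≤ C * OrliczHardy.hardyNorm Φ A f := by
  obtain ⟨δ, hδ, -, hA⟩ := hA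
  obtain ⟨c, hc, hd⟩ := hΩ.exists_hasMeasureDensity
  obtain ⟨p, hp, hΦ⟩ := hΦ.exists_isOfType_one hμ0
  obtain ⟨C, hC, hle⟩ := proposition3p2_general hΩ.isOpen hc hd hδ hA hp one_lt_two hΦ
  exact ⟨C, hC, fun f => hle f _ fun t _ => OrliczHardy.contRep_ae_eq _⟩
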